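/- **Setting.** Fix angles $\theta,\theta'\in\mathbb R$ and write $a\approx b$ for $|a-b|\le 1/\log_2^2(d)$. Let $L,C,C'\subseteq S^{d-1}$ be finite sets of size $2^{O(d)}$, let $R\subseteq S^{d-1}\times C$ and $R'\subseteq S^{d-1}\times C'$ be arbitrary relations, and write $R(x)=\{c:(x,c)\in R\}$, $R_L=R\cap(L\times C)$, $R'_L=R'\cap(L\times C')$, $u_{xy}=\frac{x-y}{\|x-y\|}$ (if $x=y$, put $R'(u_{xy})=\emptyset$). Define $$M_1=\{(x,y)\in L^2:\langle x,y\rangle\approx\cos\theta,\ R(x)\cap R(y)\ne\emptyset\},$$ $$T(R,R')=\{(x,y,z)\in L^3:\langle x,y\rangle\approx\cos\theta,\ \langle u_{xy},z\rangle\approx\cos\theta',\ R(x)\cap R(y)\neq\emptyset,\ R'(u_{xy})\cap R'(z)\ne\emptyset\},$$ $$L(x,y,c')=\{z\in L:\langle u_{xy},z\rangle\approx\cos\theta',\ c'\in R'(u_{xy})\cap R'(z)\},$$ $$W(x,c,y,c')=|L|\cdot|R(x)|\cdot|R_L^{-1}(c)|\cdot|R'(u_{xy})|\cdot|L(x,y,c')|.$$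 **Model.** Vectors of $L\cup C\cup C'$ (and a symbol $\bot$) are encoded by distinct words of $2^{o(d)}$ bits. Data structures $D(R_L)$, $D(R'_L)$ stored in QCRAM contain, for every key $x$ (resp. $c$), the size and an array of the elements of $R_L(x)$ (resp. $R_L^{-1}(c)$), and likewise for $R'_L$, and an array of the elements of $L$. A circuit acts on registers holding one word each; its instructions are: reading a word from QCRAM, $|n\rangle|0\rangle\mapsto|n\rangle\frac1{\sqrt n}\sum_{i<n}|i\rangle$, testing $\langle x,y\rangle\approx\cos\theta$ or $\langle u_{xy},z\rangle\approx\cos\theta'$, copying a flag, multiplying by a phase (globally, if a flag is $1$, or if given registers are $0$), and a call of an oracle $$|x,y\rangle|0\rangle\mapsto|x,y\rangle\tfrac1{\sqrt{|S(u_{xy})|}}\sum_{c'\in S(u_{xy})}|c'\rangle\quad(|x,y\rangle|\bot\rangle\text{ if }S(u_{xy})=\emptyset),$$ as well as the inverses of these. Here $S\subseteq R'$ is a relation with $S(u)=R'(u)$ whenever $|R'(u)|\le2^{d/\log_2 d}$; for example $S=R'$, or $R'$ with every $R'(u)$ truncated to its first $2^{d/\log_2 d}$ elements. Every instruction takes at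 most $\kappa(d)=2^{o(d)}$ elementary steps and uses at most $2^{o(d)}$ auxiliary qubits. Reading a word counts as one QCRAM query per bit. Let $\delta_d>0$ with $\log(1/\delta_d)\le2^{o(d)}$ be a prescribed accuracy (for example $\delta_d=\exp(-2^{\sqrt d})$). **Algorithms.** $\mathrm{AA}_r(\mathrm{Samp},\mathrm{Check})$ applies Samp, then $r$ rounds of a phase on the states accepted by Check, followed by a phase on Samp$|0\rangle$, and finally a phase on the accepted states, a global phase, and Check, which writes a flag qubit. * RCollisionSamp creates a uniform superposition over $x\in L$, then over $c\in R(x)$, then over $y\in R_L^{-1}(c)$ (with $c=y=\bot$ if $R(x)=\emptyset$). * TupleSamp$_{(r_1,r_2)}$ applies $\mathrm{AA}_{r_1}$ to RCollisionSamp with the check $y\ne\bot$, $\langle x,y\rangle\approx\cos\theta$; then the oracle, creating $c'$; then, controlled on $(x,c,y,c')$, $\mathrm{AA}_{r_2}$ to the uniform superposition over $z\in(R'_L)^{-1}(c')$ with the check $z\neq\bot$, $\langle u_{xy},z\rangle\approx\cos\theta'$, whose result is the flag $b$. * SolutionSearch$_{(r_1,r_2,r_3)}$ applies $\mathrm{AA}_{r_3}$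 to TupleSamp with the check $b=1$, and measures $(x,y,z)$. Let $\psi$ be the output state of RCollisionSamp, $\psi'$ that of TupleSamp$_{(r_1,r_2)}$, and $\Pi$, $\Pi'$ the orthogonal projections onto $M_1$ (acting on $x,y$) and onto $T(R,R')$ (acting on $x,y,z$). **Theorem.** There are angles for amplitude amplification, depending only on $d$, the number of rounds, and the bounds of the model (the constant in $2^{O(d)}$, the word length, $\kappa$, the number of auxiliary qubits, and $\delta$), not on the sets, relations or angles $\theta,\theta'$, such that the following holds, with $o(d)$-terms that likewise depend only on $d$ and these bounds. If $T(R,R')\ne\emptyset$ then $\|\Pi\psi\|>0$. If $\|\Pi\psi\|>0$, then there are $r_1,r_2$ such that: 1. TupleSamp$_{(r_1,r_2)}$ uses at most $\bigl(\|\Pi\psi\|^{-1}+\max_{c'\in C'}\sqrt{|(R'_L)^{-1}(c')|}\bigr)2^{o(d)}$ time and QCRAM queries and $2^{o(d)}$ qubits, and, for all $(x,y,z)\in T(R,R')$ with $|R'(u_{xy})|\le2^{d/\log_2d}$, all $c\in R(x)\cap R(y)$ and all $c'\in R'(u_{xy})\cap R'(z)$, the amplitude $\langle x,c,y,c',z,1|\psi'\rangle$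 differs by at most $\delta_d$ from $\bigl(\|\Pi\psi\|^2\,W(x,c,y,c')\bigr)^{-1/2}$. 2. Suppose that $T(R,R')\ne\emptyset$ and, if $S\neq R'$, that some $(x,y,z)\in T(R,R')$ even satisfies $S(u_{xy})\cap R'(z)\ne\emptyset$. Then $\|\Pi'\psi'\|>0$ and there is $r_3$ such that SolutionSearch$_{(r_1,r_2,r_3)}$ outputs an element of $T(R,R')$ with probability at least $1-\delta_d$, uses at most $$\|\Pi'\psi'\|^{-1}\Bigl(\|\Pi\psi\|^{-1}+\max_{c'\in C'}\sqrt{|(R'_L)^{-1}(c')|}\Bigr)2^{o(d)}$$ time and QCRAM queries and $2^{o(d)}$ qubits, and, for every $(x,y,z)\in T(R,R')$ with $|R'(u_{xy})|\le2^{d/\log_2d}$, outputs $(x,y,z)$ with a probability that differs by at most $\delta_d$ from $$\sum_{c\in R(x)\cap R(y)}\ \sum_{c'\in R'(u_{xy})\cap R'(z)}\frac{1}{\|\Pi\psi\|^2\,\|\Pi'\psi'\|^2\,W(x,c,y,c')}.$$ -/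

import Mathlib

open Filter Asymptotics

noncomputable section

namespace TripleSearch

/-! ### Vectors, relations and solution triples -/

/-- The ambient space `ℝ^d` with its Euclidean norm. -/
abbrev E (d : ℕ) := EuclideanSpace ℝ (Fin d)

/-- The tolerance `ε = 1 / log₂(d)²`. -/
def tol (d : ℕ) : ℝ := 1 / (Real.logb 2 d) ^ 2

/-- `⟨a, b⟩ ≈_ε cos t`. -/
def Near {d : ℕ} (t : ℝ) (a b : E d) : Prop := |inner ℝ a b - Real.cos t| ≤ tol d

/-- The normalised difference `(x - y) / ‖x - y‖`. For `x = y` this is the zero vector, which is not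
on the unit sphere and therefore is related to nothing. -/
def dir {d : ℕ} (x y : E d) : E d := ‖x - y‖⁻¹ • (x - y)

open Classical in
/-- `R(x)`, for a relation `R` whose second coordinates lie in `C`. -/
def fiber {d : ℕ} (R : Set (E d × E d)) (C : Finset (E d)) (x : E d) : Finset (E d) :=
  C.filter fun c => (x, c) ∈ R

open Classical in
/-- `(R_L)⁻¹(c)`, where `R_L` is the restriction of `R` to first coordinates in `L`. -/
def cofiber {d : ℕ} (R : Set (E d × E d)) (L : Finset (E d)) (c : E d) : Finset (E d) :=
  L.filter fun x => (x, c) ∈ R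

/-- Finite sets `L, C, C'` of unit vectors, and relations `R` on `S^{d-1} × C`,
`R'` on `S^{d-1} × C'`. -/
structure SearchInput (d : ℕ) where
  L : Finset (E d)
  C : Finset (E d)
  C' : Finset (E d)
  R : Set (E d × E d)
  R' : Set (E d × E d)
  L_unit : ∀ x ∈ L, ‖x‖ = 1
  C_unit : ∀ x ∈ C, ‖x‖ = 1
  C'_unit : ∀ x ∈ C', ‖x‖ = 1
  R_sub : ∀ p ∈ R, ‖p.1‖ = 1 ∧ p.2 ∈ C
  R'_sub : ∀ p ∈ R', ‖p.1‖ = 1 ∧ p.2 ∈ C'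

namespace SearchInput

variable {d : ℕ} (I : SearchInput d)

open Classical in
/-- `R(x) ∩ R(y)`. -/
def common (x y : E d) : Finset (E d) := fiber I.R I.C x ∩ fiber I.R I.C y

open Classical in
/-- `R'(u) ∩ R'(z)`. -/
def common' (u z : E d) : Finset (E d) := fiber I.R' I.C' u ∩ fiber I.R' I.C' z

/-- `M₁(R)`: the `R`-collisions `(x, y) ∈ L²` with `⟨x, y⟩ ≈ cos θ`. -/
def M1 (θ : ℝ) : Set (E d × E d) :=
  {p | p.1 ∈ I.L ∧ p.2 ∈ I.L ∧ Near θ p.1 p.2 ∧ (I.common p.1 p.2).Nonempty}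

/-- `T(R, R')`: the triples `(x, y, z) ∈ L³` with `⟨x, y⟩ ≈ cos θ` and
`⟨(x-y)/‖x-y‖, z⟩ ≈ cos θ'` such that `R(x) ∩ R(y)` and `R'((x-y)/‖x-y‖) ∩ R'(z)` are nonempty. -/
def T (θ θ' : ℝ) : Set (E d × E d × E d) :=
  {t | t.1 ∈ I.L ∧ t.2.1 ∈ I.L ∧ t.2.2 ∈ I.L ∧ Near θ t.1 t.2.1 ∧
    Near θ' (dir t.1 t.2.1) t.2.2 ∧ (I.common t.1 t.2.1).Nonempty ∧
    (I.common' (dir t.1 t.2.1) t.2.2).Nonempty}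

open Classical in
/-- `L(x, y, c')`: the `z ∈ L` with `⟨(x-y)/‖x-y‖, z⟩ ≈ cos θ'` and
`c' ∈ R'((x-y)/‖x-y‖) ∩ R'(z)`. -/
def third (θ' : ℝ) (x y c' : E d) : Finset (E d) :=
  I.L.filter fun z => Near θ' (dir x y) z ∧ c' ∈ I.common' (dir x y) z

/-- `|L| · |R(x)| · |(R_L)⁻¹(c)| · |R'((x-y)/‖x-y‖)| · |L(x, y, c')|`. -/
def weight (θ' : ℝ) (x c y c' : E d) : ℝ :=
  (I.L.card : ℝ) * (fiber I.R I.C x).card * (cofiber I.R I.L c).card *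
    (fiber I.R' I.C' (dir x y)).card * (I.third θ' x y c').card

/-- `|R'((x-y)/‖x-y‖)| ≤ 2^{d / log₂ d}`. -/
def Small (u : E d) : Prop :=
  ((fiber I.R' I.C' u).card : ℝ) ≤ (2 : ℝ) ^ ((d : ℝ) / Real.logb 2 d)

/-- `S` is obtained from `R'` by possibly dropping elements of those `R'(u)` which have more than
`2^{d / log₂ d}` elements. In particular `S = R'` is allowed. -/
def IsTruncation (S : Set (E d × E d)) : Prop :=
  S ⊆ I.R' ∧ ∀ u, I.Small u → fiber S I.C' u = fiber I.R' I.C' u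

/-- The triples of `T(R, R')` that have a witness `c' ∈ S((x-y)/‖x-y‖) ∩ R'(z)`;
this is `T(R, R')` itself if `S = R'`. -/
def TWitnessed (θ θ' : ℝ) (S : Set (E d × E d)) : Set (E d × E d × E d) :=
  {t | t ∈ I.T θ θ' ∧ ∃ c' ∈ I.common' (dir t.1 t.2.1) t.2.2, (dir t.1 t.2.1, c') ∈ S}

/-- `max_{c' ∈ C'} |(R'_L)⁻¹(c')|`. -/
def maxBucket : ℕ := I.C'.sup fun c' => (cofiber I.R' I.L c').card

end SearchInput

/-! ### Words, encodings, and data structures in QCRAM -/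

/-- A word of `w` bits. -/
abbrev Word (w : ℕ) := BitVec w

instance instFintypeWord (w : ℕ) : Fintype (Word w) :=
  Fintype.ofEquiv (Fin (2 ^ w)) BitVec.equivFin.symm.toEquiv

/-- Every vector of `L`, `C`, `C'` has its own `w`-bit code word, and one more word is reserved
for `⊥`. -/
structure Encoding {d : ℕ} (I : SearchInput d) (w : ℕ) where
  code : E d → Word w
  bot : Word w
  code_inj : Set.InjOn code {v | v ∈ I.L ∨ v ∈ I.C ∨ v ∈ I.C'}
  code_ne_bot : ∀ v, (v ∈ I.L ∨ v ∈ I.C ∨ v ∈ I.C') → code v ≠ bot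

/-- Memory of a keyed data structure: for every key a size, and an array of words. -/
structure Table (w : ℕ) where
  count : Word w → Word w
  entry : Word w → Word w → Word w

/-- Under the key `k`, the table stores the size of `S` and an array that lists the elements of `S`
without repetition; for `S = ∅` the array starts with `⊥`. -/
def Table.Stores {w : ℕ} (t : Table w) (bot k : Word w) (S : Finset (Word w)) : Prop :=
  (t.count k).toNat = S.card ∧
    Set.BijOn (fun i : ℕ => t.entry k (BitVec.ofNat w i)) (Set.Iio S.card) (S : Set (Word w)) ∧
    (S = ∅ → t.entry k 0 = bot)

/-- `v` is the entry with index `i` of the array stored under the key `k`. -/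
def Table.PointsTo {w : ℕ} (t : Table w) (k i v : Word w) : Prop :=
  i.toNat < (t.count k).toNat ∧ t.entry k i = v

/-- Contents of the QCRAM for a finite relation: an array of all first coordinates (under the
key `0`), and the relation stored once by first and once by second coordinate. -/
structure QData (w : ℕ) where
  list : Table w
  fwd : Table w
  inv : Table w

/-- `D` is a data structure `D(R_L)` for the restriction `R_L` of `R` to `L × C`. -/
def QData.StoresRel {d w : ℕ} {I : SearchInput d} (D : QData w) (e : Encoding I w)
    (C : Finset (E d)) (R : Set (E d × E d)) : Prop :=
  D.list.Stores e.bot 0 (I.L.image e.code) ∧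
  (∀ x ∈ I.L, D.fwd.Stores e.bot (e.code x) ((fiber R C x).image e.code)) ∧
  D.fwd.Stores e.bot e.bot ∅ ∧
  (∀ c ∈ C, D.inv.Stores e.bot (e.code c) ((cofiber R I.L c).image e.code)) ∧
  D.inv.Stores e.bot e.bot ∅

/-! ### Quantum circuits with QCRAM queries -/

/-- The registers, each holding one word: the vectors `x, c, y, c', z`, the array indices
`IX, IC, IY, IZ` at which `x, c, y, z` were found, a scratch register `N` for array sizes, and flags
`F₁` (collision check), `F` (check of `z`), `G` (outermost check). -/
inductive Reg
  | X | C | Y | C' | Z | IX | IC | IY | IZ | N | F₁ | F | G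
  deriving DecidableEq

instance instFintypeReg : Fintype Reg where
  elems := {.X, .C, .Y, .C', .Z, .IX, .IC, .IY, .IZ, .N, .F₁, .F, .G}
  complete r := by cases r <;> decide

/-- A computational basis state. -/
abbrev Cfg (w : ℕ) := Reg → Word w

/-- A pure state, with the usual Hilbert space norm. -/
abbrev State (w : ℕ) := EuclideanSpace ℂ (Cfg w)

/-- The basis state in which all registers are zero. -/
def zeroState (w : ℕ) : State w := EuclideanSpace.single (fun _ => 0) 1

/-- A unitary acting on words. -/
abbrev Gate (w : ℕ) := Matrix (Word w) (Word w) ℂ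

/-- The unitary `U` maps `|0⟩` to the uniform superposition over `S`, or to `|dflt⟩` if `S = ∅`. -/
def Prepares {w : ℕ} (U : Gate w) (S : Finset (Word w)) (dflt : Word w) : Prop :=
  U ∈ Matrix.unitaryGroup (Word w) ℂ ∧
  ∀ v, U v 0 = if S = ∅ then (if v = dflt then 1 else 0)
    else if v ∈ S then ((1 / Real.sqrt S.card : ℝ) : ℂ) else 0

/-- `|n⟩|0⟩ ↦ |n⟩ ∑_{i < n} |i⟩ / √n`. -/
def IsUniformGate {w : ℕ} (U : Word w → Gate w) : Prop :=
  ∀ n, Prepares (U n) (Finset.univ.filter fun i => i.toNat < n.toNat) 0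

/-- The oracle for a relation `S ⊆ S^{d-1} × C'`, applied at `u = (x-y)/‖x-y‖`:
`|x, y⟩|0⟩ ↦ |x, y⟩ ∑_{c' ∈ S(u)} |c'⟩ / √|S(u)|`, or `|x, y⟩|⊥⟩` if `S(u) = ∅`. -/
def IsDecoder {d w : ℕ} {I : SearchInput d} (e : Encoding I w) (S : Set (E d × E d))
    (U : Word w → Word w → Gate w) : Prop :=
  (∀ a b, U a b ∈ Matrix.unitaryGroup (Word w) ℂ) ∧
  ∀ x ∈ I.L, ∀ y ∈ I.L,
    Prepares (U (e.code x) (e.code y)) ((fiber S I.C' (dir x y)).image e.code) e.bot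

/-- What a circuit has access to: the QCRAM contents `D` and `D'`, the gate that creates uniform
superpositions, the oracle for `R'`, and the two inner-product tests on encoded vectors. -/
structure Machine (w : ℕ) where
  D : QData w
  D' : QData w
  unif : Word w → Gate w
  dec : Word w → Word w → Gate w
  testXY : Word w → Word w → Prop
  testXYZ : Word w → Word w → Word w → Prop

/-- The machine for a given input. The tests check that the words are codes of vectors of `L` (in
particular not `⊥`), and `⟨x, y⟩ ≈ cos θ` or `⟨(x-y)/‖x-y‖, z⟩ ≈ cos θ'` respectively. -/
def machine {d w : ℕ} {I : SearchInput d} (e : Encoding I w) (θ θ' : ℝ) (D D' : QData w)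
    (unif : Word w → Gate w) (dec : Word w → Word w → Gate w) : Machine w where
  D := D
  D' := D'
  unif := unif
  dec := dec
  testXY := fun a b => ∃ x ∈ I.L, ∃ y ∈ I.L, e.code x = a ∧ e.code y = b ∧ Near θ x y
  testXYZ := fun a b c => ∃ x ∈ I.L, ∃ y ∈ I.L, ∃ z ∈ I.L,
    e.code x = a ∧ e.code y = b ∧ e.code z = c ∧ Near θ' (dir x y) z

/-- The tables that are read: those of `D(R_L)`, and the lookup by `c'` of `D(R'_L)`. -/
inductive TableId
  | list | fwd | inv | inv'

def Machine.table {w : ℕ} (M : Machine w) : TableId → Table w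
  | .list => M.D.list
  | .fwd => M.D.fwd
  | .inv => M.D.inv
  | .inv' => M.D'.inv

/-- Elementary instructions. A key `none` stands for the constant key `0`. -/
inductive Instr
  | readCount (t : TableId) (key : Option Reg) (dst : Reg)
  | readEntry (t : TableId) (key : Option Reg) (idx dst : Reg)
  | unif (n dst : Reg) (adj : Bool)
  | dec (x y dst : Reg) (adj : Bool)
  | testXY (x y dst : Reg)
  | testXYZ (x y z dst : Reg)
  | copy (src dst : Reg)
  | phaseFlag (r : Reg) (t : ℝ)
  | phaseZero (rs : Finset Reg) (t : ℝ)
  | phase (t : ℝ)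

/-- `|s⟩ ↦ |s with s_dst replaced by s_dst ⊕ g(s)⟩`, used where `g(s)` does not depend on
`s_dst`. -/
def xorOn {w : ℕ} (dst : Reg) (g : Cfg w → Word w) (ψ : State w) : State w :=
  WithLp.toLp 2 fun s => ψ (Function.update s dst (s dst ^^^ g s))

/-- Apply `U(s)`, or its adjoint, to the register `dst`, used where `U(s)` does not depend on
`s_dst`. -/
def gateOn {w : ℕ} (dst : Reg) (U : Cfg w → Gate w) (adj : Bool) (ψ : State w) : State w :=
  WithLp.toLp 2 fun s =>
    ∑ v, (if adj then (U s).conjTranspose else U s) (s dst) v * ψ (Function.update s dst v)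

open Classical in
/-- Multiply by `e^{it}` the amplitudes of the basis states with the property `p`. -/
def phaseOn {w : ℕ} (p : Cfg w → Prop) (t : ℝ) (ψ : State w) : State w :=
  WithLp.toLp 2 fun s => (if p s then Complex.exp (t * Complex.I) else 1) * ψ s

open Classical in
/-- The unitary that an instruction performs. -/
def Instr.apply {w : ℕ} (M : Machine w) : Instr → State w → State w
  | .readCount t key dst => xorOn dst fun s => (M.table t).count (key.elim 0 s)
  | .readEntry t key idx dst => xorOn dst fun s => (M.table t).entry (key.elim 0 s) (s idx)
  | .unif n dst adj => gateOn dst (fun s => M.unif (s n)) adj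
  | .dec x y dst adj => gateOn dst (fun s => M.dec (s x) (s y)) adj
  | .testXY x y dst => xorOn dst fun s => if M.testXY (s x) (s y) then 1 else 0
  | .testXYZ x y z dst => xorOn dst fun s => if M.testXYZ (s x) (s y) (s z) then 1 else 0
  | .copy src dst => xorOn dst fun s => s src
  | .phaseFlag r t => phaseOn (fun s => s r = 1) t
  | .phaseZero rs t => phaseOn (fun s => ∀ r ∈ rs, s r = 0) t
  | .phase t => phaseOn (fun _ => True) t

/-- The inverse instruction. -/
def Instr.inverse : Instr → Instr
  | .unif n dst adj => .unif n dst (!adj)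
  | .dec x y dst adj => .dec x y dst (!adj)
  | .phaseFlag r t => .phaseFlag r (-t)
  | .phaseZero rs t => .phaseZero rs (-t)
  | .phase t => .phase (-t)
  | i => i

def Instr.isRead : Instr → Bool
  | .readCount .. => true
  | .readEntry .. => true
  | _ => false

/-- A circuit: the instructions in the order in which they are executed. -/
abbrev Circuit := List Instr

def Circuit.run {w : ℕ} (M : Machine w) (P : Circuit) (ψ : State w) : State w :=
  P.foldl (fun φ i => i.apply M φ) ψ

def Circuit.inverse (P : Circuit) : Circuit := (P.map Instr.inverse).reverse

/-- Number of steps, if one instruction takes `κ` steps (elementary gates). -/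
def Circuit.time (κ : ℕ) (P : Circuit) : ℕ := κ * List.length P

/-- Number of QCRAM queries; reading a word of `w` bits takes `w` queries. -/
def Circuit.queries (w : ℕ) (P : Circuit) : ℕ := w * List.countP Instr.isRead P

/-- Number of qubits: all registers, and `a` auxiliary qubits used within instructions. -/
def qubits (w a : ℕ) : ℕ := Fintype.card Reg * w + a

/-! ### The algorithms -/

/-- The angles of the reflections in amplitude amplification. -/
structure Phases where
  flag : ℕ → ℝ
  zero : ℕ → ℝ
  global : ℝ

/-- `AA_r(Samp, Check)`: `r` rounds of amplitude amplification on the registers `rs`, where `check`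
writes its result into the register `fl`, which holds the flag at the end. -/
def amplify (φ : Phases) (r : ℕ) (samp check : Circuit) (fl : Reg) (rs : Finset Reg) : Circuit :=
  samp ++
  (List.range r).flatMap (fun j =>
    check ++ [.phaseFlag fl (φ.flag j)] ++ Circuit.inverse check ++
      Circuit.inverse samp ++ [.phaseZero rs (φ.zero j)] ++ samp) ++
  check ++ [.phaseFlag fl (φ.flag r), .phase φ.global]

/-- Superposition over the array stored under a key: `|k⟩|0⟩|0⟩ ↦ |k⟩ ∑_i |i⟩|v_i⟩ / √N`, or
`|k⟩|0⟩|⊥⟩` if the array is empty. -/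
def lookup (t : TableId) (key : Option Reg) (idx out : Reg) : Circuit :=
  [.readCount t key .N, .unif .N idx false, .readCount t key .N, .readEntry t key idx out]

/-- `RCollisionSamp`. -/
def rCollisionSamp : Circuit :=
  lookup .list none .IX .X ++ lookup .fwd (some .X) .IC .C ++ lookup .inv (some .C) .IY .Y

/-- `TupleSamp_{(r₁, r₂)}`; `φ r` are the angles for `r` rounds of amplification. -/
def tupleSamp (φ : ℕ → Phases) (r₁ r₂ : ℕ) : Circuit :=
  amplify (φ r₁) r₁ rCollisionSamp [.testXY .X .Y .F₁] .F₁ {.N, .IX, .X, .IC, .C, .IY, .Y} ++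
  [.dec .X .Y .C' false] ++
  amplify (φ r₂) r₂ (lookup .inv' (some .C') .IZ .Z) [.testXYZ .X .Y .Z .F] .F {.N, .IZ, .Z}

/-- `SolutionSearch_{(r₁, r₂, r₃)}` up to the final measurement of `(x, y, z)`. -/
def solutionSearch (φ : ℕ → Phases) (r₁ r₂ r₃ : ℕ) : Circuit :=
  amplify (φ r₃) r₃ (tupleSamp φ r₁ r₂) [.copy .F .G] .G (Finset.univ \ {.G})

/-! ### Projections, amplitudes and measurement -/

open Classical in
/-- The orthogonal projection onto the pairs `(x, y)` in `A`. -/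
def projPairs {d w : ℕ} {I : SearchInput d} (e : Encoding I w) (A : Set (E d × E d))
    (ψ : State w) : State w :=
  WithLp.toLp 2 fun s => if ∃ p ∈ A, s .X = e.code p.1 ∧ s .Y = e.code p.2 then ψ s else 0

open Classical in
/-- The orthogonal projection onto the triples `(x, y, z)` in `A`. -/
def projTriples {d w : ℕ} {I : SearchInput d} (e : Encoding I w) (A : Set (E d × E d × E d))
    (ψ : State w) : State w :=
  WithLp.toLp 2 fun s =>
    if ∃ t ∈ A, s .X = e.code t.1 ∧ s .Y = e.code t.2.1 ∧ s .Z = e.code t.2.2 then ψ s else 0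

/-- The probability that measuring `(x, y, z)` in the state `ψ` yields an element of `A`. -/
def outputProb {d w : ℕ} {I : SearchInput d} (e : Encoding I w) (A : Set (E d × E d × E d))
    (ψ : State w) : ℝ := ‖projTriples e A ψ‖ ^ 2

/-- `s` is the basis state `|x, c, y, c', z, 1⟩`, where the index registers hold the positions at
which `x`, `c`, `y`, `z` are stored in the respective arrays. -/
def Represents {d w : ℕ} {I : SearchInput d} (e : Encoding I w) (D D' : QData w) (s : Cfg w)
    (x c y c' z : E d) : Prop :=
  s .X = e.code x ∧ s .C = e.code c ∧ s .Y = e.code y ∧ s .C' = e.code c' ∧ s .Z = e.code z ∧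
  s .F = 1 ∧ s .F₁ = 1 ∧ s .G = 0 ∧ s .N = 0 ∧
  D.list.PointsTo 0 (s .IX) (e.code x) ∧ D.fwd.PointsTo (e.code x) (s .IC) (e.code c) ∧
  D.inv.PointsTo (e.code c) (s .IY) (e.code y) ∧ D'.inv.PointsTo (e.code c') (s .IZ) (e.code z)

/-- `g(d) ≤ 2^{o(d)}`. -/
def Subexp (g : ℕ → ℝ) : Prop :=
  ∃ f : ℕ → ℝ, f =o[atTop] (fun d : ℕ => (d : ℝ)) ∧ ∀ d, g d ≤ (2 : ℝ) ^ f d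

end TripleSearch

end

open Filter Asymptotics TripleSearch

/-!
Write `p` for `‖Πψ‖` and `p'` for `‖Π'ψ'‖`. The theorem follows from one fact about amplitude
amplification: for every accuracy `η` there is a single family of angles, indexed by the number
`r` of rounds, such that `r = O(log (1 / η) / x)` rounds multiply the accepted part of a state of
unknown acceptance amplitude at least `x` by the reciprocal of that amplitude, up to an error `η`
*including the phase* (`exists_fixedPoint_family`). The phase matters, because amplitudes of `ψ'`
are to be compared with a positive real number.

**Angles.** After `r` rounds on a state with acceptance probability `y`, the accepted and the
rejected part are multiplied by polynomials `G(y)` and `B(y)` of degree at most `r` with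
`y |G|² + (1 - y) |B|² = 1`; conversely every such pair arises from suitable angles
(`exists_phases`). So it suffices to find a real `g` with `y g(y)² < 1` on `[0, 1]` for which
`x g(x²)` is close to `1` for all `x` that are not too small. Such an odd polynomial is the
normalised integral of an even power of the Dirichlet kernel `sin ((2j+1)t) / sin t`
(`exists_step`). By the Markov–Lukács theorem `1 - y g² = y a² + (1 - y) b²` with real polynomials
`a` and `b` (`oddRep_of_pos`), and `G = g + i a`, `B = b` is the required pair. Since
`|x G(x²)| ≤ 1` and its real part is close to `1`, it is itself close to `1`.

**Circuits.** A circuit commutes with diagonal operators on registers that it does not write, and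
preserves norms. Hence `amplify` acts as the abstract recursion for `G` and `B` predicts, even if
other registers are entangled with the amplified ones (`run_amplify`, `run_eq_mul_run_basis`).
This gives explicit amplitudes: a tuple `(x, c, y, c', z)` with flag `1` has in `ψ'` the amplitude
`(p² W)^(-1/2)`, up to a factor close to `1` (`Setting.Full.exists_apply_eq`). Here the second
amplification acts, for each `(x, y, c')`, on a success amplitude that is at least the square root
of `1 / max |(R'_L)⁻¹(c')|`, which determines `r₂`.

**Search.** The flag of `ψ'` is also set on tuples for which the check of `(x, y)` failed, but
their total weight is `O(η)` (`Setting.acceptProb_psi'_bounds`). On the other hand `p'²` is at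
least a constant times `2^(-5Ad)` as soon as one solution has a witness in `S`
(`Setting.p'_lower`). With `η` smaller than `δ` by a factor of order `2^(5Ad)` (`ampError`), the
last amplification multiplies the probability of every solution by almost exactly `p'^(-2)`
(`Setting.outputProb_out_bounds`). The number of rounds grows only by the factor `log (1 / η)`,
which is `O(d + |log δ|)` and hence `2^{o(d)}` (`subexp_log_ampError`), and the circuit lengths
follow by counting instructions (`length_bounds`).
-/

noncomputable section

namespace TripleSearch

section Polynomials

open Polynomial

/-! ### Polynomials that are positive on `[0, 1]` -/

/-- `h = X a² + (1 - X) b²` with `a` and `b` of degree at most `k`. -/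
def OddRep (k : ℕ) (h : ℝ[X]) : Prop :=
  ∃ a b : ℝ[X], a.natDegree ≤ k ∧ b.natDegree ≤ k ∧ h = X * a ^ 2 + (1 - X) * b ^ 2

/-- `h = a² + X (1 - X) b²` with `a` of degree at most `k` and `b` of degree less than `k`. The
bound on `b` is phrased through `X * b` so that it also makes sense for `k = 0`, where it forces
`b = 0`. -/
def EvenRep (k : ℕ) (h : ℝ[X]) : Prop :=
  ∃ a b : ℝ[X], a.natDegree ≤ k ∧ (X * b).natDegree ≤ k ∧ h = a ^ 2 + X * (1 - X) * b ^ 2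

lemma natDegree_le_natDegree_X_mul (b : ℝ[X]) : b.natDegree ≤ (X * b).natDegree := by
  by_cases hb : b = 0
  · simp [hb]
  · rw [natDegree_X_mul hb]; omega

lemma natDegree_one_sub_X_le : (1 - X : ℝ[X]).natDegree ≤ 1 := by
  compute_degree

lemma natDegree_mul_le_add {p q : ℝ[X]} {m n : ℕ} (hp : p.natDegree ≤ m) (hq : q.natDegree ≤ n) :
    (p * q).natDegree ≤ m + n :=
  natDegree_mul_le.trans (add_le_add hp hq)

lemma natDegree_one_sub_X_mul_le {b : ℝ[X]} {l : ℕ} (hb : (X * b).natDegree ≤ l) :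
    ((1 - X) * b).natDegree ≤ l := by
  rw [sub_mul, one_mul]
  exact (natDegree_sub_le _ _).trans
    (max_le ((natDegree_le_natDegree_X_mul b).trans hb) hb)

lemma OddRep.mul_odd {l : ℕ} {g h : ℝ[X]} (hg : OddRep 0 g) (hh : OddRep l h) :
    EvenRep (l + 1) (g * h) := by
  obtain ⟨a, b, ha, hb, rfl⟩ := hg
  obtain ⟨c, d, hc, hd, rfl⟩ := hh
  refine ⟨X * (a * c) + (1 - X) * (b * d), a * d - b * c, ?_, ?_, by ring⟩
  · refine (natDegree_add_le _ _).trans (max_le ?_ ?_)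
    · exact (natDegree_mul_le_add natDegree_X_le (natDegree_mul_le_add ha hc)).trans (by omega)
    · exact (natDegree_mul_le_add natDegree_one_sub_X_le
        (natDegree_mul_le_add hb hd)).trans (by omega)
  · refine (natDegree_mul_le_add natDegree_X_le (n := l) ?_).trans (by omega)
    refine (natDegree_sub_le _ _).trans (max_le ?_ ?_)
    · exact (natDegree_mul_le_add ha hd).trans (by omega)
    · exact (natDegree_mul_le_add hb hc).trans (by omega)

lemma OddRep.mul_even {l : ℕ} {g h : ℝ[X]} (hg : OddRep 0 g) (hh : EvenRep l h) :
    OddRep l (g * h) := by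
  obtain ⟨a, b, ha, hb, rfl⟩ := hg
  obtain ⟨c, d, hc, hd, rfl⟩ := hh
  refine ⟨a * c + b * ((1 - X) * d), b * c - a * (X * d), ?_, ?_, by ring⟩
  · refine (natDegree_add_le _ _).trans (max_le ?_ ?_)
    · exact (natDegree_mul_le_add ha hc).trans (by omega)
    · exact (natDegree_mul_le_add hb (natDegree_one_sub_X_mul_le hd)).trans (by omega)
  · refine (natDegree_sub_le _ _).trans (max_le ?_ ?_)
    · exact (natDegree_mul_le_add hb hc).trans (by omega)
    · exact (natDegree_mul_le_add ha hd).trans (by omega)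

lemma EvenRep.mul_odd {l : ℕ} {g h : ℝ[X]} (hg : EvenRep 1 g) (hh : OddRep l h) :
    OddRep (l + 1) (g * h) := by
  obtain ⟨a, b, ha, hb, rfl⟩ := hg
  obtain ⟨c, d, hc, hd, rfl⟩ := hh
  refine ⟨a * c + ((1 - X) * b) * d, a * d - (X * b) * c, ?_, ?_, by ring⟩
  · refine (natDegree_add_le _ _).trans (max_le ?_ ?_)
    · exact (natDegree_mul_le_add ha hc).trans (by omega)
    · exact (natDegree_mul_le_add (natDegree_one_sub_X_mul_le hb) hd).trans (by omega)
  · refine (natDegree_sub_le _ _).trans (max_le ?_ ?_)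
    · exact (natDegree_mul_le_add ha hd).trans (by omega)
    · exact (natDegree_mul_le_add hb hc).trans (by omega)

lemma EvenRep.mul_even {l : ℕ} {g h : ℝ[X]} (hg : EvenRep 1 g) (hh : EvenRep l h) :
    EvenRep (l + 1) (g * h) := by
  obtain ⟨a, b, ha, hb, rfl⟩ := hg
  obtain ⟨c, d, hc, hd, rfl⟩ := hh
  refine ⟨a * c - ((1 - X) * b) * (X * d), a * d + b * c, ?_, ?_, by ring⟩
  · refine (natDegree_sub_le _ _).trans (max_le ?_ ?_)
    · exact (natDegree_mul_le_add ha hc).trans (by omega)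
    · exact (natDegree_mul_le_add (natDegree_one_sub_X_mul_le hb) hd).trans (by omega)
  · rw [show X * (a * d + b * c) = a * (X * d) + (X * b) * c by ring]
    refine (natDegree_add_le _ _).trans (max_le ?_ ?_)
    · exact (natDegree_mul_le_add ha hd).trans (by omega)
    · exact (natDegree_mul_le_add hb hc).trans (by omega)

lemma oddRep_of_natDegree_eq_one {h : ℝ[X]} (hd : h.natDegree ≤ 1) (h0 : 0 ≤ h.eval 0)
    (h1 : 0 ≤ h.eval 1) : OddRep 0 h := by
  refine ⟨C √(h.eval 1), C √(h.eval 0), by simp, by simp, ?_⟩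
  rw [← C_pow, ← C_pow, Real.sq_sqrt h0, Real.sq_sqrt h1]
  obtain ⟨a, b, rfl⟩ := exists_eq_X_add_C_of_natDegree_le_one hd
  simp only [eval_add, eval_mul, eval_C, eval_X, mul_one, mul_zero, zero_add, C_add]
  ring

/-- A real quadratic without real roots that is positive at `0` and `1` is a sum of the required
form; its discriminant is negative, which is what makes the coefficient of the second square
nonnegative. -/
lemma evenRep_of_natDegree_eq_two {h : ℝ[X]} (hd : h.natDegree = 2) (h0 : 0 < h.eval 0)
    (h1 : 0 < h.eval 1) (hr : ∀ x, h.eval x ≠ 0) : EvenRep 1 h := by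
  obtain ⟨p, q, r, hp, rfl⟩ : ∃ p q r : ℝ, p ≠ 0 ∧ h = C p * X ^ 2 + C q * X + C r := by
    refine ⟨h.coeff 2, h.coeff 1, h.coeff 0, ?_, ?_⟩
    · rw [← hd]; simpa using fun h' : h = 0 => by simp [h'] at hd
    · conv_lhs => rw [h.as_sum_range, hd]
      simp only [Finset.sum_range_succ, Finset.sum_range_zero, ← C_mul_X_pow_eq_monomial]
      simp; ring
  have hdisc : q ^ 2 < 4 * p * r := by
    by_contra! hle
    obtain ⟨x, hx⟩ := exists_quadratic_eq_zero (b := q) (c := r) hp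
      ⟨√(discrim p q r), (Real.mul_self_sqrt (by unfold discrim; linarith)).symm⟩
    apply hr x
    simp only [eval_add, eval_mul, eval_C, eval_X, eval_pow]
    linarith
  have hr0 : 0 < r := by simpa using h0
  have hs : 0 < p + q + r := by simpa using h1
  set s := √r with hs_def
  set t := √(p + q + r) with ht_def
  have hs2 : s ^ 2 = r := Real.sq_sqrt hr0.le
  have ht2 : t ^ 2 = p + q + r := Real.sq_sqrt hs.le
  have hs0 : 0 ≤ s := Real.sqrt_nonneg _
  have ht0 : 0 ≤ t := Real.sqrt_nonneg _
  have hg : 0 ≤ 2 * r + q + 2 * (s * t) := by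
    by_contra! hlt
    have : 0 ≤ s * t := mul_nonneg hs0 ht0
    have h2 : (2 * (s * t)) ^ 2 < (-(2 * r + q)) ^ 2 :=
      pow_lt_pow_left₀ (by linarith) (by linarith) two_ne_zero
    have h3 : (2 * (s * t)) ^ 2 = 4 * r * (p + q + r) := by rw [← ht2, ← hs2]; ring
    nlinarith
  refine ⟨C (-(s + t)) * X + C s, C √(2 * r + q + 2 * (s * t)), ?_, ?_, ?_⟩
  · compute_degree
  · compute_degree
  · rw [← C_pow, Real.sq_sqrt hg]
    have hp' : p = (s + t) ^ 2 - (2 * r + q + 2 * (s * t)) := by nlinarith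
    have hCr : C r = (C s) ^ 2 := by rw [← C_pow, hs2]
    have hC2 : (C 2 : ℝ[X]) = 2 := rfl
    have hCp : C p = (C s + C t) ^ 2 - (2 * C r + C q + 2 * (C s * C t)) := by
      conv_lhs => rw [hp']
      simp [hC2]
    simp only [C_add, C_mul, C_neg]
    rw [hCp, hC2, hCr]
    ring

/-- The degree of the representation matches that of the polynomial. The proof splits off one
irreducible factor at a time, which has degree at most `2`; both kinds of representations are stable
under multiplication. -/
lemma exists_rep_of_pos (n : ℕ) (h : ℝ[X]) (hn : h.natDegree ≤ n)
    (hpos : ∀ x ∈ Set.Icc (0 : ℝ) 1, 0 < h.eval x) :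
    ∃ k, (2 * k ≤ h.natDegree ∧ EvenRep k h) ∨ (2 * k + 1 ≤ h.natDegree ∧ OddRep k h) := by
  induction n generalizing h with
  | zero =>
    refine ⟨0, Or.inl ⟨by simp, C √(h.eval 0), 0, by simp, by simp, ?_⟩⟩
    rw [← C_pow, Real.sq_sqrt (hpos 0 (by simp)).le]
    obtain ⟨c, rfl⟩ := natDegree_eq_zero.1 (Nat.le_zero.1 hn)
    simp
  | succ n ih =>
    rcases Nat.lt_or_ge h.natDegree (n + 1) with hlt | hge
    · exact ih h (by omega) hpos
    have hdeg : h.natDegree = n + 1 := le_antisymm hn hge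
    have hh0 : h ≠ 0 := by rintro rfl; simp at hdeg
    have hnu : ¬ IsUnit h := fun hu => by
      rw [natDegree_eq_zero_of_isUnit hu] at hdeg; omega
    -- an irreducible factor, with the sign that makes it positive at `0`
    obtain ⟨r, hr, g, hrg, hr0⟩ : ∃ r : ℝ[X], Irreducible r ∧ ∃ g, h = r * g ∧ 0 < r.eval 0 := by
      obtain ⟨r, hr, g, hrg⟩ := WfDvdMonoid.exists_irreducible_factor hnu hh0
      have hne : r.eval 0 ≠ 0 := fun h0 => by
        have := hpos 0 (by simp)
        rw [hrg, eval_mul, h0, zero_mul] at this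
        exact this.false
      rcases lt_or_gt_of_ne hne with hlt | hgt
      · exact ⟨-r, (Associated.irreducible_iff (Associated.neg_left (Associated.refl r))).2 hr, -g,
          by rw [hrg]; ring, by simpa using hlt⟩
      · exact ⟨r, hr, g, hrg, hgt⟩
    have hrpos : ∀ x ∈ Set.Icc (0 : ℝ) 1, 0 < r.eval x := by
      intro x hx
      by_contra! hle
      obtain ⟨c, hc, hc0⟩ : (0 : ℝ) ∈ (fun t => r.eval t) '' Set.Icc 0 x :=
        intermediate_value_Icc' hx.1 r.continuous.continuousOn ⟨hle, hr0.le⟩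
      have := hpos c ⟨hc.1, hc.2.trans hx.2⟩
      rw [hrg, eval_mul, show r.eval c = 0 from hc0, zero_mul] at this
      exact this.false
    have hgpos : ∀ x ∈ Set.Icc (0 : ℝ) 1, 0 < g.eval x := by
      intro x hx
      have := hpos x hx
      rw [hrg, eval_mul] at this
      exact pos_of_mul_pos_right this (hrpos x hx).le
    have hg0 : g ≠ 0 := by rintro rfl; simp [hrg] at hh0
    have hdeg' : h.natDegree = r.natDegree + g.natDegree := by
      rw [hrg, natDegree_mul hr.ne_zero hg0]
    have hrd := hr.natDegree_pos
    have hrd2 := hr.natDegree_le_two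
    obtain ⟨k, hk⟩ := ih g (by omega) hgpos
    rcases (by omega : r.natDegree = 1 ∨ r.natDegree = 2) with h1 | h2
    · have hrep : OddRep 0 r := oddRep_of_natDegree_eq_one h1.le hr0.le (hrpos 1 (by simp)).le
      rw [hrg] at hdeg' ⊢
      rcases hk with ⟨hk, hR⟩ | ⟨hk, hR⟩
      · exact ⟨k, Or.inr ⟨by omega, hrep.mul_even hR⟩⟩
      · exact ⟨k + 1, Or.inl ⟨by omega, hrep.mul_odd hR⟩⟩
    · have hroot : ∀ x, r.eval x ≠ 0 := fun x hx => by
        have := degree_eq_one_of_irreducible_of_root hr hx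
        rw [degree_eq_natDegree hr.ne_zero, h2] at this
        norm_num at this
      have hrep := evenRep_of_natDegree_eq_two h2 hr0 (hrpos 1 (by simp)) hroot
      rw [hrg] at hdeg' ⊢
      rcases hk with ⟨hk, hR⟩ | ⟨hk, hR⟩
      · exact ⟨k + 1, Or.inl ⟨by omega, hrep.mul_even hR⟩⟩
      · exact ⟨k + 1, Or.inr ⟨by omega, hrep.mul_odd hR⟩⟩

/-- The Markov–Lukács representation. -/
lemma oddRep_of_pos {r : ℕ} {h : ℝ[X]} (hn : h.natDegree ≤ 2 * r + 1)
    (hpos : ∀ x ∈ Set.Icc (0 : ℝ) 1, 0 < h.eval x) : OddRep r h := by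
  obtain ⟨k, ⟨hk, hR⟩ | ⟨hk, hR⟩⟩ := exists_rep_of_pos _ h le_rfl hpos
  · -- the degree is padded by multiplying with `1 = X + (1 - X)`
    have h1 : OddRep 0 (1 : ℝ[X]) := ⟨1, 1, by simp, by simp, by ring⟩
    obtain ⟨a, b, ha, hb, hab⟩ := h1.mul_even hR
    exact ⟨a, b, by omega, by omega, by rw [← hab, one_mul]⟩
  · obtain ⟨a, b, ha, hb, hab⟩ := hR
    exact ⟨a, b, by omega, by omega, hab⟩

/-! ### Odd polynomials that approximate the sign function -/

/-- The Dirichlet kernel `sin ((2j+1)t) / sin t` is a polynomial of degree `j` in `sin² t`. -/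
lemma exists_dirichlet (j : ℕ) : ∃ σ : ℝ[X], σ.natDegree ≤ j ∧
    ∀ t, Real.sin t * σ.eval (Real.sin t ^ 2) = Real.sin ((2 * j + 1) * t) := by
  suffices h : ∀ j : ℕ, ∃ σ τ : ℝ[X], σ.natDegree ≤ j ∧ τ.natDegree ≤ j + 1 ∧
      (∀ t, Real.sin t * σ.eval (Real.sin t ^ 2) = Real.sin ((2 * j + 1) * t)) ∧
      ∀ t, Real.sin t * τ.eval (Real.sin t ^ 2) = Real.sin ((2 * j + 3) * t) by
    obtain ⟨σ, -, h1, -, h2, -⟩ := h j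
    exact ⟨σ, h1, h2⟩
  intro j
  induction j with
  | zero =>
    refine ⟨1, 3 - 4 * X, by simp, by compute_degree, by simp, fun t => ?_⟩
    have : Real.sin ((2 * (0 : ℕ) + 3) * t) = Real.sin (3 * t) := by norm_num
    rw [this, Real.sin_three_mul]
    simp
    ring
  | succ j ih =>
    obtain ⟨σ, τ, hσ, hτ, h1, h2⟩ := ih
    refine ⟨τ, (2 - 4 * X) * τ - σ, hτ, ?_, fun t => ?_, fun t => ?_⟩
    · refine (natDegree_sub_le _ _).trans (max_le ?_ (by omega))
      refine (natDegree_mul_le_add (m := 1) (by compute_degree) hτ).trans (by omega)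
    · rw [h2]; push_cast; ring_nf
    · have e : Real.sin ((2 * (j + 1 : ℕ) + 3) * t) =
          2 * Real.sin ((2 * j + 3) * t) * Real.cos (2 * t) - Real.sin ((2 * j + 1) * t) := by
        rw [show (2 * ((j + 1 : ℕ) : ℝ) + 3) * t = (2 * j + 3) * t + 2 * t by push_cast; ring,
          show (2 * (j : ℝ) + 1) * t = (2 * j + 3) * t - 2 * t by ring, Real.sin_add, Real.sin_sub]
        ring
      rw [e, ← h1, ← h2, Real.cos_two_mul, Real.cos_sq']
      simp
      ring

/-- The odd antiderivative of the even polynomial `u ↦ F (u²)` has the form `x ↦ x g (x²)`. -/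
lemma exists_odd_antiderivative {N : ℕ} {F : ℝ[X]} (hF : F.natDegree ≤ N) :
    ∃ g : ℝ[X], g.natDegree ≤ N ∧
      ∀ x : ℝ, HasDerivAt (fun x => x * g.eval (x ^ 2)) (F.eval (x ^ 2)) x := by
  refine ⟨∑ i ∈ Finset.range (N + 1), C (F.coeff i / (2 * i + 1)) * X ^ i, ?_, fun x => ?_⟩
  · refine natDegree_sum_le_of_forall_le _ _ fun i hi => ?_
    exact (natDegree_C_mul_X_pow_le _ _).trans (by simpa [Nat.lt_succ_iff] using hi)
  · have h1 : (fun x : ℝ => x * (∑ i ∈ Finset.range (N + 1),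
        C (F.coeff i / (2 * i + 1)) * X ^ i : ℝ[X]).eval (x ^ 2)) =
        fun x => ∑ i ∈ Finset.range (N + 1), F.coeff i / (2 * i + 1) * x ^ (2 * i + 1) := by
      funext x
      simp only [eval_finsetSum, eval_mul, eval_C, eval_pow, eval_X, Finset.mul_sum]
      exact Finset.sum_congr rfl fun i _ => by ring
    rw [h1, eval_eq_sum_range' (Nat.lt_succ_of_le hF)]
    refine HasDerivAt.fun_sum fun i _ => ?_
    refine ((hasDerivAt_pow (2 * i + 1) x).const_mul (F.coeff i / (2 * i + 1))).congr_deriv ?_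
    have : (2 * (i : ℝ) + 1) ≠ 0 := by positivity
    push_cast
    rw [pow_mul]
    field_simp

/-- The odd polynomial `x g(x²)` is the normalised integral of a power of the Dirichlet kernel,
which is at least `(2j+1)/2` near the origin and at most `1/u` further out. -/
lemma exists_step (j n : ℕ) {ε : ℝ} (hε : 0 < ε) (hε1 : ε ≤ 1) (hn : (1 / 4 : ℝ) ^ n ≤ ε) :
    ∃ g : ℝ[X], g.natDegree ≤ 2 * (n + 1) * j ∧
      (∀ y ∈ Set.Icc (0 : ℝ) 1, y * g.eval y ^ 2 < 1) ∧
      ∀ x ∈ Set.Icc (4 / (2 * j + 1) : ℝ) 1, 1 - 2 * ε ≤ x * g.eval (x ^ 2) := by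
  obtain ⟨σ, hσ, hsin⟩ := exists_dirichlet j
  obtain ⟨G, hG, hder⟩ := exists_odd_antiderivative (F := σ ^ (2 * (n + 1)))
    (N := 2 * (n + 1) * j) (natDegree_pow_le.trans (by gcongr))
  set m : ℝ := 2 * j + 1 with hm_def
  have hm : 1 ≤ m := by simp [hm_def]
  have hm0 : 0 < m := by linarith
  set J : ℝ → ℝ := fun x => x * G.eval (x ^ 2) with hJ_def
  have hF : ∀ u, (σ ^ (2 * (n + 1))).eval (u ^ 2) = ((σ.eval (u ^ 2)) ^ 2) ^ (n + 1) := by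
    intro u; rw [eval_pow, pow_mul]
  have hup : ∀ u : ℝ, 0 < u → u ≤ 1 → σ.eval (u ^ 2) ^ 2 ≤ 1 / u ^ 2 := by
    intro u h0 h1
    have h := hsin (Real.arcsin u)
    rw [Real.sin_arcsin (by linarith) h1] at h
    rw [le_div_iff₀ (by positivity), ← mul_pow, mul_comm, h]
    exact Real.sin_sq_le_one _
  have hlow : ∀ u : ℝ, 0 < u → u ≤ 1 / m → m ^ 2 / 4 ≤ σ.eval (u ^ 2) ^ 2 := by
    intro u h0 h1
    have hu1 : u ≤ 1 := h1.trans (by rw [div_le_one hm0]; exact hm)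
    have hmu : m * u ≤ 1 := by rwa [le_div_iff₀ hm0, mul_comm] at h1
    have h := hsin (Real.arcsin u)
    have hs : Real.sin (Real.arcsin u) = u := Real.sin_arcsin (by linarith) hu1
    have ha0 : 0 ≤ Real.arcsin u := Real.arcsin_nonneg.2 h0.le
    have ha1 : u ≤ Real.arcsin u := by
      conv_lhs => rw [← hs]
      exact Real.sin_le ha0
    have ha2 : 2 / Real.pi * Real.arcsin u ≤ u := by
      conv_rhs => rw [← hs]
      exact Real.mul_le_sin ha0 (Real.arcsin_le_pi_div_two u)
    have hpi := Real.pi_pos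
    have hpi4 := Real.pi_le_four
    have ha3 : m * Real.arcsin u ≤ Real.pi / 2 := by
      rw [div_mul_eq_mul_div, div_le_iff₀ hpi] at ha2
      nlinarith
    have h2 := Real.mul_le_sin (mul_nonneg hm0.le ha0) ha3
    rw [hs] at h
    have h3 : m * u / 2 ≤ u * σ.eval (u ^ 2) := by
      rw [h]
      refine le_trans ?_ h2
      have : (1 : ℝ) / 2 ≤ 2 / Real.pi := by rw [div_le_div_iff₀ two_pos hpi]; linarith
      calc m * u / 2 = 1 / 2 * (m * u) := by ring
        _ ≤ 2 / Real.pi * (m * Real.arcsin u) := by gcongr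
    have h4 : m / 2 ≤ σ.eval (u ^ 2) := by
      by_contra! hlt
      nlinarith
    calc m ^ 2 / 4 = (m / 2) ^ 2 := by ring
      _ ≤ _ := pow_le_pow_left₀ (by positivity) h4 2
  have hJd : Differentiable ℝ J := fun x => (hder x).differentiableAt
  have hmono : Monotone J := by
    refine monotone_of_deriv_nonneg hJd fun x => ?_
    rw [(hder x).deriv, hF]
    positivity
  have hJ0 : J 0 = 0 := by simp [hJ_def]
  set B : ℝ := 1 / m * (m ^ 2 / 4) ^ (n + 1) with hB_def
  have hBpos : 0 < B := by positivity
  have hJlow : B ≤ J (1 / m) := by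
    have hmon : MonotoneOn (fun x => J x - x * (m ^ 2 / 4) ^ (n + 1)) (Set.Icc 0 (1 / m)) := by
      have hd : ∀ x, HasDerivAt (fun x => J x - x * (m ^ 2 / 4) ^ (n + 1))
          ((σ ^ (2 * (n + 1))).eval (x ^ 2) - 1 * (m ^ 2 / 4) ^ (n + 1)) x := fun x =>
        (hder x).sub ((hasDerivAt_id x).mul_const _)
      refine monotoneOn_of_deriv_nonneg (convex_Icc _ _)
        (fun x _ => (hd x).continuousAt.continuousWithinAt)
        (fun x _ => (hd x).differentiableAt.differentiableWithinAt) fun x hx => ?_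
      rw [interior_Icc] at hx
      rw [(hd x).deriv, hF, one_mul, sub_nonneg]
      exact pow_le_pow_left₀ (by positivity) (hlow x hx.1 hx.2.le) _
    have := hmon (Set.left_mem_Icc.2 (by positivity)) (Set.right_mem_Icc.2 (by positivity))
      (by positivity)
    simp only [hJ0, zero_mul, sub_zero] at this
    linarith
  have h1m : 1 / m ≤ 1 := by rw [div_le_one hm0]; exact hm
  have hJ1 : B ≤ J 1 := hJlow.trans (hmono h1m)
  have hJ1pos : 0 < J 1 := hBpos.trans_le hJ1
  have htail : ∀ x ∈ Set.Icc (4 / m) 1, J 1 - J x ≤ ε * J 1 := by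
    intro x hx
    have hx0 : 0 < 4 / m := by positivity
    have hxpos : 0 < x := hx0.trans_le hx.1
    set D : ℝ := ((m / 4) ^ 2) ^ n with hD
    have hanti : AntitoneOn (fun u => J u + D * u⁻¹) (Set.Icc x 1) := by
      have hd : ∀ u, 0 < u → HasDerivAt (fun u => J u + D * u⁻¹)
          ((σ ^ (2 * (n + 1))).eval (u ^ 2) + D * (-(u ^ 2)⁻¹)) u := fun u hu =>
        (hder u).add ((hasDerivAt_inv hu.ne').const_mul _)
      refine antitoneOn_of_deriv_nonpos (convex_Icc _ _)
        (fun u hu => (hd u (hxpos.trans_le hu.1)).continuousAt.continuousWithinAt)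
        (fun u hu => ?_) fun u hu => ?_
      · rw [interior_Icc] at hu
        exact (hd u (hxpos.trans hu.1)).differentiableAt.differentiableWithinAt
      · rw [interior_Icc] at hu
        have hu0 := hxpos.trans hu.1
        rw [(hd u hu0).deriv, hF, pow_succ]
        have h1 := hup u hu0 hu.2.le
        have h2 : σ.eval (u ^ 2) ^ 2 ≤ (m / 4) ^ 2 := by
          refine h1.trans ?_
          rw [div_le_iff₀ (by positivity), ← mul_pow]
          have : 1 ≤ m / 4 * u := by
            have := hx.1.trans hu.1.le
            rw [div_le_iff₀ hm0] at this
            linarith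
          exact one_le_pow₀ this
        have h3 : (σ.eval (u ^ 2) ^ 2) ^ n * σ.eval (u ^ 2) ^ 2 ≤ D * (1 / u ^ 2) := by
          gcongr
          exact pow_le_pow_left₀ (sq_nonneg _) h2 n
        rw [one_div] at h3
        linarith
    have h := hanti (Set.left_mem_Icc.2 hx.2) (Set.right_mem_Icc.2 hx.2) hx.2
    simp only [inv_one, mul_one] at h
    have hDpos : 0 ≤ D := by positivity
    have hinv : x⁻¹ ≤ m / 4 := by
      rw [inv_le_comm₀ hxpos (by positivity), inv_div]
      exact hx.1
    have h5 : D * (m / 4) = (1 / 4) ^ n * B := by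
      rw [hD, hB_def, show m ^ 2 / 4 = 4 * (m / 4) ^ 2 by ring, mul_pow, pow_succ ((m / 4) ^ 2) n,
        pow_succ (4 : ℝ) n]
      have h44 : (1 / 4 : ℝ) ^ n * 4 ^ n = 1 := by rw [← mul_pow]; norm_num
      calc ((m / 4) ^ 2) ^ n * (m / 4) =
          ((m / 4) ^ 2) ^ n * (m / 4) * ((1 / 4 : ℝ) ^ n * 4 ^ n) := by
            rw [h44, mul_one]
        _ = _ := by field_simp
    calc J 1 - J x ≤ D * x⁻¹ := by linarith
      _ ≤ D * (m / 4) := by gcongr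
      _ = (1 / 4) ^ n * B := h5
      _ ≤ ε * J 1 := by gcongr
  have hc : 0 ≤ (1 - ε) / J 1 := div_nonneg (by linarith) hJ1pos.le
  refine ⟨C ((1 - ε) / J 1) * G, (natDegree_C_mul_le _ _).trans hG, fun y hy => ?_, fun x hx => ?_⟩
  · have hs : √y ^ 2 = y := Real.sq_sqrt hy.1
    have h0 : 0 ≤ J √y := hJ0 ▸ hmono (Real.sqrt_nonneg y)
    have h1 : J √y ≤ J 1 := hmono (Real.sqrt_le_one.2 hy.2)
    have e : y * (C ((1 - ε) / J 1) * G).eval y ^ 2 = ((1 - ε) * (J √y / J 1)) ^ 2 := by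
      simp only [hJ_def, eval_mul, eval_C, hs]
      rw [show y * ((1 - ε) / (1 * eval (1 ^ 2) G) * eval y G) ^ 2 =
        √y ^ 2 * ((1 - ε) / (1 * eval (1 ^ 2) G) * eval y G) ^ 2 by rw [hs]]
      ring
    rw [e]
    have h2 : J √y / J 1 ≤ 1 := (div_le_one hJ1pos).2 h1
    have h3 : 0 ≤ J √y / J 1 := div_nonneg h0 hJ1pos.le
    have h4 : (1 - ε) * (J √y / J 1) < 1 := by nlinarith
    exact pow_lt_one₀ (mul_nonneg (by linarith) h3) h4 two_ne_zero
  · have h1 := htail x hx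
    have e : x * (C ((1 - ε) / J 1) * G).eval (x ^ 2) = (1 - ε) * (J x / J 1) := by
      simp only [hJ_def, eval_mul, eval_C]
      ring
    rw [e]
    have h2 : 1 - ε ≤ J x / J 1 := by rw [le_div_iff₀ hJ1pos]; linarith
    nlinarith

/-! ### Amplitudes and angles of amplitude amplification -/

/-- The coefficients of the accepted and of the rejected part of the sampled state after `r`
rounds of amplitude amplification, where `y` is the probability that the sampled state is
accepted. -/
def roundAmp (φ : Phases) (y : ℂ) : ℕ → ℂ × ℂ
  | 0 => (1, 1)
  | r + 1 =>
    let G := Complex.exp (φ.flag r * Complex.I) * (roundAmp φ y r).1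
    let B := (roundAmp φ y r).2
    let o := (Complex.exp (φ.zero r * Complex.I) - 1) * (y * G + (1 - y) * B)
    (G + o, B + o)

/-- The coefficient of the accepted part at the end of `r` rounds. -/
def goodAmp (φ : Phases) (r : ℕ) (y : ℂ) : ℂ :=
  Complex.exp (φ.global * Complex.I) *
    (Complex.exp (φ.flag r * Complex.I) * (roundAmp φ y r).1)

/-- The coefficient of the rejected part at the end of `r` rounds. -/
def badAmp (φ : Phases) (r : ℕ) (y : ℂ) : ℂ :=
  Complex.exp (φ.global * Complex.I) * (roundAmp φ y r).2

lemma roundAmp_congr {φ φ' : Phases} {r : ℕ} (hf : ∀ j < r, φ.flag j = φ'.flag j)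
    (hz : ∀ j < r, φ.zero j = φ'.zero j) (y : ℂ) : roundAmp φ y r = roundAmp φ' y r := by
  induction r with
  | zero => rfl
  | succ r ih =>
    simp only [roundAmp, ih (fun j hj => hf j (by omega)) (fun j hj => hz j (by omega)),
      hf r (by omega), hz r (by omega)]

lemma exists_eq_exp_mul {g b : ℂ} (h : ‖g‖ = ‖b‖) :
    ∃ α : ℝ, g = Complex.exp (α * Complex.I) * b := by
  by_cases hb : b = 0
  · subst hb
    exact ⟨0, by simpa using h⟩
  · refine ⟨(g / b).arg, ?_⟩
    have hn : ‖g / b‖ = 1 := by rw [norm_div, h, div_self (norm_ne_zero_iff.2 hb)]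
    have := Complex.norm_mul_exp_arg_mul_I (g / b)
    rw [hn, Complex.ofReal_one, one_mul] at this
    rw [this, div_mul_cancel₀ _ hb]

lemma exp_mul_I_mul_conj (α : ℝ) :
    Complex.exp (α * Complex.I) * (starRingEnd ℂ) (Complex.exp (α * Complex.I)) = 1 := by
  rw [Complex.mul_conj, Complex.normSq_eq_norm_sq, Complex.norm_exp_ofReal_mul_I]
  simp

/-- The polynomial with complex conjugate coefficients. -/
abbrev conjPoly (G : ℂ[X]) : ℂ[X] := G.map (starRingEnd ℂ)

lemma natDegree_conjPoly (G : ℂ[X]) : (conjPoly G).natDegree = G.natDegree :=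
  natDegree_map_eq_of_injective (RingHom.injective _) _

lemma coeff_mul_conjPoly {G : ℂ[X]} {r : ℕ} (hG : G.natDegree ≤ r) :
    (G * conjPoly G).coeff (r + r) = (‖G.coeff r‖ ^ 2 : ℝ) := by
  rw [coeff_mul_add_eq_of_natDegree_le hG ((natDegree_conjPoly G).trans_le hG), coeff_map,
    Complex.mul_conj, Complex.normSq_eq_norm_sq]

lemma natDegree_mul_conjPoly_le {G : ℂ[X]} {r : ℕ} (hG : G.natDegree ≤ r) :
    (G * conjPoly G).natDegree ≤ r + r :=
  natDegree_mul_le.trans (add_le_add hG ((natDegree_conjPoly G).trans_le hG))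

/-- Every pair of polynomials of degree at most `r` that satisfies the normalisation identity
arises as the pair of amplitudes of `r` rounds for suitable angles. The proof undoes one round at
a time: the identity determines a last flag angle that makes the leading coefficients equal, and a
reflection that then cancels both of them. -/
lemma exists_phases (r : ℕ) : ∀ G B : ℂ[X], G.natDegree ≤ r → B.natDegree ≤ r →
    X * (G * conjPoly G) + (1 - X) * (B * conjPoly B) = 1 →
    ∃ φ : Phases, ∀ y : ℂ, goodAmp φ r y = G.eval y ∧ badAmp φ r y = B.eval y := by
  induction r with
  | zero =>
    intro G B hG hB h
    obtain ⟨g, rfl⟩ := natDegree_eq_zero.1 (Nat.le_zero.1 hG)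
    obtain ⟨b, rfl⟩ := natDegree_eq_zero.1 (Nat.le_zero.1 hB)
    have h0 := congrArg (eval 0) h
    have h1 := congrArg (eval 1) h
    simp only [conjPoly, map_C, eval_add, eval_mul, eval_X, eval_C, eval_sub, eval_one, zero_mul,
      sub_zero, one_mul, zero_add, sub_self, add_zero, Complex.mul_conj,
      Complex.normSq_eq_norm_sq] at h0 h1
    have hb : ‖b‖ = 1 := by
      have : ‖b‖ ^ 2 = 1 := by exact_mod_cast h0
      nlinarith [norm_nonneg b]
    have hg : ‖g‖ = 1 := by
      have : ‖g‖ ^ 2 = 1 := by exact_mod_cast h1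
      nlinarith [norm_nonneg g]
    obtain ⟨α, hα⟩ := exists_eq_exp_mul (g := b) (b := 1) (by simpa using hb)
    obtain ⟨β, hβ⟩ := exists_eq_exp_mul (hg.trans hb.symm)
    refine ⟨⟨fun _ => β, fun _ => 0, α⟩, fun y => ?_⟩
    simp only [goodAmp, badAmp, roundAmp, mul_one, eval_C]
    rw [mul_one] at hα
    exact ⟨by rw [← hα, hβ]; ring, hα.symm⟩
  | succ r ih =>
    intro G B hG hB h
    have hlead : ‖G.coeff (r + 1)‖ = ‖B.coeff (r + 1)‖ := by
      have hc := congrArg (fun p : ℂ[X] => p.coeff (r + 1 + (r + 1) + 1)) h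
      have e : X * (G * conjPoly G) + (1 - X) * (B * conjPoly B) =
          X * (G * conjPoly G) + B * conjPoly B - X * (B * conjPoly B) := by ring
      simp only [e] at hc
      rw [coeff_sub, coeff_add, coeff_X_mul, coeff_X_mul, coeff_mul_conjPoly hG,
        coeff_mul_conjPoly hB, coeff_eq_zero_of_natDegree_lt
          ((natDegree_mul_conjPoly_le hB).trans_lt (Nat.lt_succ_self _)), coeff_one,
        if_neg (by omega), add_zero, sub_eq_zero] at hc
      have hc' : ‖G.coeff (r + 1)‖ ^ 2 = ‖B.coeff (r + 1)‖ ^ 2 := by exact_mod_cast hc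
      exact (pow_left_inj₀ (norm_nonneg _) (norm_nonneg _) two_ne_zero).1 hc'
    obtain ⟨α, hα⟩ := exists_eq_exp_mul hlead
    set u := Complex.exp (α * Complex.I) with hu
    have huu : u * (starRingEnd ℂ) u = 1 := exp_mul_I_mul_conj α
    -- undo the last flag phase
    set G' : ℂ[X] := C ((starRingEnd ℂ) u) * G with hG'
    have hGG' : C u * G' = G := by
      rw [hG', ← mul_assoc, ← C_mul, huu, C_1, one_mul]
    have hG'd : G'.natDegree ≤ r + 1 := (natDegree_C_mul_le _ _).trans hG
    have hG'c : G'.coeff (r + 1) = B.coeff (r + 1) := by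
      rw [hG', coeff_C_mul, hα, ← mul_assoc, mul_comm _ u, huu, one_mul]
    have h' : X * (G' * conjPoly G') + (1 - X) * (B * conjPoly B) = 1 := by
      have h2 : X * ((C u * G') * conjPoly (C u * G')) + (1 - X) * (B * conjPoly B) = 1 := by
        rw [hGG']; exact h
      have h3 : (C u * conjPoly (C u) : ℂ[X]) = 1 := by rw [conjPoly, map_C, ← C_mul, huu, C_1]
      simp only [conjPoly, Polynomial.map_mul] at h2 h3 ⊢
      linear_combination h2 - (X * (G' * map (starRingEnd ℂ) G')) * h3
    clear_value G'
    set D := G' - B with hD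
    have hDd : D.natDegree ≤ r := by
      rw [natDegree_le_iff_coeff_eq_zero]
      intro N hN
      rcases Nat.eq_or_lt_of_le (Nat.succ_le_of_lt hN) with rfl | hN
      · rw [hD, coeff_sub, hG'c, sub_self]
      · rw [hD, coeff_sub, coeff_eq_zero_of_natDegree_lt (hG'd.trans_lt hN),
          coeff_eq_zero_of_natDegree_lt (hB.trans_lt hN), sub_self]
    set O := X * G' + (1 - X) * B with hO
    have hOD : O = B + X * D := by rw [hO, hD]; ring
    have hOd : O.natDegree ≤ r + 1 := by
      rw [hOD]
      refine (natDegree_add_le _ _).trans (max_le hB ?_)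
      exact natDegree_mul_le.trans ((add_le_add natDegree_X_le hDd).trans (by omega))
    have hOO : O * conjPoly O + X * (D * conjPoly D) - X * (X * (D * conjPoly D)) = 1 := by
      rw [← h', hO, hD]
      simp only [conjPoly, Polynomial.map_add, Polynomial.map_mul, Polynomial.map_sub,
        Polynomial.map_one, map_X]
      ring
    have hnorm : ‖D.coeff r‖ = ‖O.coeff (r + 1)‖ := by
      have hc := congrArg (fun p : ℂ[X] => p.coeff (r + 1 + (r + 1))) hOO
      rw [coeff_sub, coeff_add, coeff_mul_conjPoly hOd,
        show r + 1 + (r + 1) = r + r + 1 + 1 by ring, coeff_X_mul, coeff_X_mul, coeff_X_mul,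
        coeff_mul_conjPoly hDd, coeff_eq_zero_of_natDegree_lt
          ((natDegree_mul_conjPoly_le hDd).trans_lt (Nat.lt_succ_self _)), coeff_one,
        if_neg (by omega), add_zero, sub_eq_zero] at hc
      have hc' : ‖O.coeff (r + 1)‖ ^ 2 = ‖D.coeff r‖ ^ 2 := by exact_mod_cast hc
      exact ((pow_left_inj₀ (norm_nonneg _) (norm_nonneg _) two_ne_zero).1 hc').symm
    have hOc : O.coeff (r + 1) = B.coeff (r + 1) + D.coeff r := by
      rw [hOD, coeff_add, coeff_X_mul]
    obtain ⟨β, hβ⟩ := exists_eq_exp_mul hnorm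
    set v := Complex.exp (β * Complex.I) with hv
    have hvv : v * (starRingEnd ℂ) v = 1 := exp_mul_I_mul_conj β
    -- undo the last reflection
    set B₁ := B + C (v - 1) * O with hB₁
    set G₁ := G' + C (v - 1) * O with hG₁
    have hB₁d : B₁.natDegree ≤ r := by
      rw [natDegree_le_iff_coeff_eq_zero]
      intro N hN
      rcases Nat.eq_or_lt_of_le (Nat.succ_le_of_lt hN) with rfl | hN
      · rw [hB₁, coeff_add, coeff_C_mul]
        linear_combination -hβ - hOc
      · rw [hB₁, coeff_add, coeff_C_mul, coeff_eq_zero_of_natDegree_lt (hB.trans_lt hN),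
          coeff_eq_zero_of_natDegree_lt (hOd.trans_lt hN), mul_zero, add_zero]
    have hG₁d : G₁.natDegree ≤ r := by
      have : G₁ = B₁ + D := by rw [hG₁, hB₁, hD]; ring
      rw [this]
      exact (natDegree_add_le _ _).trans (max_le hB₁d hDd)
    have h₁ : X * (G₁ * conjPoly G₁) + (1 - X) * (B₁ * conjPoly B₁) = 1 := by
      have hvC : (C v * C ((starRingEnd ℂ) v) : ℂ[X]) = 1 := by rw [← C_mul, hvv, C_1]
      have hOc' : conjPoly O = X * conjPoly G' + (1 - X) * conjPoly B := by
        rw [hO]; simp [conjPoly]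
      rw [hG₁, hB₁]
      simp only [conjPoly, Polynomial.map_add, Polynomial.map_mul, map_C, Polynomial.map_sub,
        Polynomial.map_one, map_sub, map_one] at *
      linear_combination h' + (O * map (starRingEnd ℂ) O) * hvC
        - (C v - 1) * O * hOc' - (C ((starRingEnd ℂ) v) - 1) * map (starRingEnd ℂ) O * hO
    obtain ⟨φ, hφ⟩ := ih G₁ B₁ hG₁d hB₁d h₁
    refine ⟨⟨fun j => if j ≤ r then φ.flag j else α, fun j => if j < r then φ.zero j else -β,
      φ.global⟩, fun y => ?_⟩
    obtain ⟨hg, hb⟩ := hφ y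
    have hcongr := roundAmp_congr (φ := ⟨fun j => if j ≤ r then φ.flag j else α,
      fun j => if j < r then φ.zero j else -β, φ.global⟩) (φ' := φ) (r := r)
      (fun j hj => by simp [hj.le]) (fun j hj => by simp [hj]) y
    simp only [goodAmp, badAmp, roundAmp, hcongr, le_refl, if_true, lt_irrefl, if_false,
      show ¬ (r + 1 ≤ r) by omega] at hg hb ⊢
    have hv' : Complex.exp (((-β : ℝ) : ℂ) * Complex.I) * v = 1 := by
      rw [hv, ← Complex.exp_add]; simp
    set v' := Complex.exp (((-β : ℝ) : ℂ) * Complex.I)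
    set q := Complex.exp (φ.global * Complex.I)
    set G₀ := Complex.exp (φ.flag r * Complex.I) * (roundAmp φ y r).1
    set B₀ := (roundAmp φ y r).2
    -- the reflection with angle `-β` is inverse to the one that was undone
    have hOy : q * (y * G₀ + (1 - y) * B₀) = v * O.eval y := by
      have e1 : q * (y * G₀ + (1 - y) * B₀) = y * G₁.eval y + (1 - y) * B₁.eval y := by
        rw [← hg, ← hb]; ring
      rw [e1, hG₁, hB₁, hO]
      simp only [eval_add, eval_mul, eval_C, eval_X, eval_sub, eval_one]
      ring
    have e2 : q * ((v' - 1) * (y * G₀ + (1 - y) * B₀)) = (1 - v) * O.eval y := by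
      linear_combination (v' - 1) * hOy + O.eval y * hv'
    constructor
    · rw [← hGG', eval_mul, eval_C]
      have : G'.eval y = G₁.eval y + (1 - v) * O.eval y := by
        rw [hG₁]; simp only [eval_add, eval_mul, eval_C]; ring
      rw [this, ← hg, ← e2]
      ring
    · have : B.eval y = B₁.eval y + (1 - v) * O.eval y := by
        rw [hB₁]; simp only [eval_add, eval_mul, eval_C]; ring
      rw [this, ← hb, ← e2]
      ring

/-- A reflection preserves the norm of a state with coefficients `G` and `B`. -/
lemma reflection_norm (y : ℝ) (ζ : ℝ) (G B : ℂ) :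
    y * ‖G + (Complex.exp (ζ * Complex.I) - 1) * (y * G + (1 - y) * B)‖ ^ 2 +
      (1 - y) * ‖B + (Complex.exp (ζ * Complex.I) - 1) * (y * G + (1 - y) * B)‖ ^ 2 =
    y * ‖G‖ ^ 2 + (1 - y) * ‖B‖ ^ 2 := by
  have hv := exp_mul_I_mul_conj ζ
  set v := Complex.exp (ζ * Complex.I)
  have key : ∀ z : ℂ, ((‖z‖ ^ 2 : ℝ) : ℂ) = z * (starRingEnd ℂ) z := fun z => by
    rw [Complex.mul_conj, Complex.normSq_eq_norm_sq]
  rw [← Complex.ofReal_inj]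
  simp only [Complex.ofReal_add, Complex.ofReal_mul, Complex.ofReal_sub, Complex.ofReal_one]
  rw [key, key, key, key]
  simp only [map_add, map_mul, map_sub, map_one, Complex.conj_ofReal]
  linear_combination ((y * G + (1 - y) * B) *
    (y * (starRingEnd ℂ) G + (1 - y) * (starRingEnd ℂ) B)) * hv

lemma amp_norm (φ : Phases) (r : ℕ) (y : ℝ) :
    y * ‖goodAmp φ r y‖ ^ 2 + (1 - y) * ‖badAmp φ r y‖ ^ 2 = 1 := by
  have h : y * ‖(roundAmp φ y r).1‖ ^ 2 + (1 - y) * ‖(roundAmp φ y r).2‖ ^ 2 = 1 := by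
    induction r with
    | zero => simp [roundAmp]
    | succ r ih =>
      simp only [roundAmp]
      rw [reflection_norm, norm_mul, Complex.norm_exp_ofReal_mul_I, one_mul, ih]
  simpa [goodAmp, badAmp, Complex.norm_exp_ofReal_mul_I] using h

/-- Fixed-point amplitude amplification: the angles of `2 (n + 1) j` rounds that take any success
amplitude `x ≥ 4 / (2j + 1)` close to `1`, including its phase. -/
lemma exists_fixedPoint_phases (j n : ℕ) {ε : ℝ} (hε : 0 < ε) (hε1 : ε ≤ 1)
    (hn : (1 / 4 : ℝ) ^ n ≤ ε) :
    ∃ φ : Phases, ∀ x ∈ Set.Icc (4 / (2 * j + 1) : ℝ) 1,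
      ‖(x : ℂ) * goodAmp φ (2 * (n + 1) * j) ((x ^ 2 : ℝ) : ℂ) - 1‖ ^ 2 ≤ 4 * ε := by
  obtain ⟨g, hgd, hg1, hg2⟩ := exists_step j n hε hε1 hn
  obtain ⟨a, b, ha, hb, hab⟩ := oddRep_of_pos (r := 2 * (n + 1) * j) (h := 1 - X * g ^ 2) (by
      refine (natDegree_sub_le _ _).trans (max_le (by simp) ?_)
      refine (natDegree_mul_le_add natDegree_X_le (natDegree_pow_le_of_le 2 hgd)).trans (by omega))
    (fun y hy => by simpa using hg1 y hy)
  have hmapd : ∀ p : ℝ[X], (p.map Complex.ofRealHom).natDegree = p.natDegree := fun p =>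
    natDegree_map_eq_of_injective (RingHom.injective _) p
  set ι : ℝ[X] →+* ℂ[X] := mapRingHom Complex.ofRealHom with hι
  have hconj : ∀ p : ℝ[X], conjPoly (ι p) = ι p := fun p => by
    simp only [hι, coe_mapRingHom, conjPoly, Polynomial.map_map]
    congr 1
    ext x; simp
  have hιd : ∀ p : ℝ[X], (ι p).natDegree = p.natDegree := hmapd
  have hidx : X * (ι g) ^ 2 + X * (ι a) ^ 2 + (1 - X) * (ι b) ^ 2 = 1 := by
    have hX : ι X = X := by simp [hι]
    have := congrArg ι hab
    simp only [map_sub, map_add, map_mul, map_pow, map_one, hX] at this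
    linear_combination -this
  have hI : (C Complex.I * C Complex.I : ℂ[X]) = -1 := by
    rw [← C_mul, Complex.I_mul_I, C_neg, C_1]
  obtain ⟨φ, hφ⟩ := exists_phases (2 * (n + 1) * j) (ι g + C Complex.I * ι a) (ι b) (by
      refine (natDegree_add_le _ _).trans (max_le (by rw [hιd]; exact hgd) ?_)
      exact (natDegree_C_mul_le _ _).trans (by rw [hιd]; exact ha)) (by rw [hιd]; exact hb) (by
      have e : conjPoly (ι g + C Complex.I * ι a) = ι g - C Complex.I * ι a := by
        rw [conjPoly, Polynomial.map_add, Polynomial.map_mul]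
        change conjPoly _ + _ * conjPoly _ = _
        rw [hconj, hconj, map_C, Complex.conj_I, C_neg]
        ring
      rw [e, hconj]
      linear_combination hidx - X * (ι a) ^ 2 * hI)
  refine ⟨φ, fun x hx => ?_⟩
  have hx0 : 0 ≤ x := le_trans (by positivity) hx.1
  have hnorm := amp_norm φ (2 * (n + 1) * j) (x ^ 2)
  rw [(hφ _).1, (hφ _).2] at hnorm
  rw [(hφ _).1]
  have hev : ∀ p : ℝ[X], (ι p).eval ((x ^ 2 : ℝ) : ℂ) = ((p.eval (x ^ 2) : ℝ) : ℂ) := fun p => by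
    simp only [hι, coe_mapRingHom]
    exact eval_map_apply (f := Complex.ofRealHom) (p := p) (x ^ 2)
  set P : ℂ := (x : ℂ) * (ι g + C Complex.I * ι a).eval ((x ^ 2 : ℝ) : ℂ) with hP
  have hPre : P.re = x * g.eval (x ^ 2) := by
    rw [hP, eval_add, eval_mul, eval_C, hev, hev, Complex.re_ofReal_mul]
    simp
  have hPn : ‖P‖ ^ 2 ≤ 1 := by
    rw [hP, norm_mul, mul_pow, Complex.norm_real, Real.norm_eq_abs, sq_abs]
    have : 0 ≤ (1 - x ^ 2) := by nlinarith [hx.2]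
    nlinarith [mul_nonneg this (sq_nonneg ‖(ι b).eval ((x ^ 2 : ℝ) : ℂ)‖)]
  have h2 := hg2 x hx
  have e : ‖P - 1‖ ^ 2 = ‖P‖ ^ 2 + 1 - 2 * P.re := by
    rw [← Complex.normSq_eq_norm_sq, ← Complex.normSq_eq_norm_sq, Complex.normSq_sub]
    simp
  rw [e, hPre]
  linarith

end Polynomials

section Circuits

variable {w : ℕ}

/-! ### Circuits as unitaries -/

/-- All gates of the machine are unitary. -/
def Machine.IsUnitary (M : Machine w) : Prop :=
  (∀ n, M.unif n ∈ Matrix.unitaryGroup (Word w) ℂ) ∧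
  ∀ a b, M.dec a b ∈ Matrix.unitaryGroup (Word w) ℂ

/-- The set of registers that an instruction modifies. -/
def Instr.writes : Instr → Finset Reg
  | .readCount _ _ dst => {dst}
  | .readEntry _ _ _ dst => {dst}
  | .unif _ dst _ => {dst}
  | .dec _ _ dst _ => {dst}
  | .testXY _ _ dst => {dst}
  | .testXYZ _ _ _ dst => {dst}
  | .copy _ dst => {dst}
  | .phaseFlag _ _ => ∅
  | .phaseZero _ _ => ∅
  | .phase _ => ∅

/-- The target register is not among the inputs, so that the instruction is unitary. -/
def Instr.WellFormed : Instr → Prop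
  | .readCount _ key dst => key ≠ some dst
  | .readEntry _ key idx dst => key ≠ some dst ∧ idx ≠ dst
  | .unif n dst _ => n ≠ dst
  | .dec x y dst _ => x ≠ dst ∧ y ≠ dst
  | .testXY x y dst => x ≠ dst ∧ y ≠ dst
  | .testXYZ x y z dst => x ≠ dst ∧ y ≠ dst ∧ z ≠ dst
  | .copy src dst => src ≠ dst
  | _ => True

/-- A well-formed circuit that modifies only registers of `R`. -/
def Circuit.ActsOn (R : Finset Reg) (P : Circuit) : Prop :=
  ∀ i ∈ P, i.WellFormed ∧ i.writes ⊆ R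

/-- The function does not depend on the registers of `R`. -/
def IndepOf {α : Type*} (R : Finset Reg) (f : Cfg w → α) : Prop :=
  ∀ s, ∀ r ∈ R, ∀ v, f (Function.update s r v) = f s

lemma IndepOf.mono {α : Type*} {R R' : Finset Reg} {f : Cfg w → α} (hf : IndepOf R f)
    (h : R' ⊆ R) : IndepOf R' f := fun s r hr v => hf s r (h hr) v

/-- Multiply the amplitudes by the values of `f`. -/
def mask (f : Cfg w → ℂ) (ψ : State w) : State w := WithLp.toLp 2 fun s => f s * ψ s

/-- The inner product, as an explicit sum. -/
def ip (φ ψ : State w) : ℂ := ∑ s, (starRingEnd ℂ) (φ s) * ψ s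

/-- A computational basis state, as a vector. -/
abbrev basis (κ : Cfg w) : State w := EuclideanSpace.single κ 1

lemma basis_apply (κ s : Cfg w) : basis κ s = if s = κ then 1 else 0 := by
  simp [basis]

@[simp] lemma mask_apply (f : Cfg w → ℂ) (ψ : State w) (s : Cfg w) : mask f ψ s = f s * ψ s := rfl

@[simp] lemma xorOn_apply (dst : Reg) (g : Cfg w → Word w) (ψ : State w) (s : Cfg w) :
    xorOn dst g ψ s = ψ (Function.update s dst (s dst ^^^ g s)) := rfl

@[simp] lemma gateOn_apply (dst : Reg) (U : Cfg w → Gate w) (adj : Bool) (ψ : State w) (s : Cfg w) :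
    gateOn dst U adj ψ s = ∑ v, (if adj then (U s).conjTranspose else U s) (s dst) v *
      ψ (Function.update s dst v) := rfl

open Classical in
lemma phaseOn_apply (p : Cfg w → Prop) (t : ℝ) (ψ : State w) (s : Cfg w) :
    phaseOn p t ψ s = (if p s then Complex.exp (t * Complex.I) else 1) * ψ s := rfl

/-- The three kinds of unitaries that instructions perform. -/
lemma Instr.apply_cases {M : Machine w} (hM : M.IsUnitary) {i : Instr} (hi : i.WellFormed) :
    (∃ dst g, i.writes = {dst} ∧ IndepOf {dst} g ∧ i.apply M = xorOn dst g ∧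
      i.inverse.apply M = xorOn dst g) ∨
    (∃ dst U adj, i.writes = {dst} ∧ IndepOf {dst} U ∧
      (∀ s, U s ∈ Matrix.unitaryGroup (Word w) ℂ) ∧ i.apply M = gateOn dst U adj ∧
      i.inverse.apply M = gateOn dst U (!adj)) ∨
    ∃ p t, i.writes = ∅ ∧ i.apply M = phaseOn p t ∧ i.inverse.apply M = phaseOn p (-t) := by
  have hne : ∀ {a b : Reg}, a ≠ b → ∀ (s : Cfg w) (v : Word w), Function.update s b v a = s a :=
    fun h s v => Function.update_of_ne h v s
  cases i with
  | readCount t key dst =>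
    refine Or.inl ⟨dst, _, rfl, fun s r hr v => ?_, rfl, rfl⟩
    rw [Finset.mem_singleton.1 hr]
    cases key with
    | none => rfl
    | some k => simp only [Option.elim]; rw [hne (fun h => hi (congrArg some h))]
  | readEntry t key idx dst =>
    refine Or.inl ⟨dst, _, rfl, fun s r hr v => ?_, rfl, rfl⟩
    rw [Finset.mem_singleton.1 hr, hne hi.2]
    cases key with
    | none => rfl
    | some k => simp only [Option.elim]; rw [hne (fun h => hi.1 (congrArg some h))]
  | unif n dst adj =>
    refine Or.inr (Or.inl ⟨dst, _, adj, rfl, fun s r hr v => ?_, fun s => hM.1 _, rfl, rfl⟩)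
    rw [Finset.mem_singleton.1 hr, hne hi]
  | dec x y dst adj =>
    refine Or.inr (Or.inl ⟨dst, _, adj, rfl, fun s r hr v => ?_, fun s => hM.2 _ _, rfl, rfl⟩)
    rw [Finset.mem_singleton.1 hr, hne hi.1, hne hi.2]
  | testXY x y dst =>
    refine Or.inl ⟨dst, _, rfl, fun s r hr v => ?_, rfl, rfl⟩
    rw [Finset.mem_singleton.1 hr, hne hi.1, hne hi.2]
  | testXYZ x y z dst =>
    refine Or.inl ⟨dst, _, rfl, fun s r hr v => ?_, rfl, rfl⟩
    rw [Finset.mem_singleton.1 hr, hne hi.1, hne hi.2.1, hne hi.2.2]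
  | copy src dst =>
    refine Or.inl ⟨dst, _, rfl, fun s r hr v => ?_, rfl, rfl⟩
    rw [Finset.mem_singleton.1 hr, hne hi]
  | phaseFlag r t => exact Or.inr (Or.inr ⟨_, t, rfl, rfl, rfl⟩)
  | phaseZero rs t => exact Or.inr (Or.inr ⟨_, t, rfl, rfl, rfl⟩)
  | phase t => exact Or.inr (Or.inr ⟨_, t, rfl, rfl, rfl⟩)

lemma xorOn_xorOn {dst : Reg} {g : Cfg w → Word w} (hg : IndepOf {dst} g) (ψ : State w) :
    xorOn dst g (xorOn dst g ψ) = ψ := by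
  ext s
  simp [hg s dst (Finset.mem_singleton_self _)]

lemma gateOn_gateOn {dst : Reg} {U : Cfg w → Gate w} (hU : IndepOf {dst} U)
    (hu : ∀ s, U s ∈ Matrix.unitaryGroup (Word w) ℂ) (adj : Bool) (ψ : State w) :
    gateOn dst U (!adj) (gateOn dst U adj ψ) = ψ := by
  ext s
  have h1 : (if (!adj) = true then (U s).conjTranspose else U s) *
      (if adj = true then (U s).conjTranspose else U s) = 1 := by
    cases adj
    · simpa [Matrix.star_eq_conjTranspose] using Matrix.mem_unitaryGroup_iff'.1 (hu s)
    · simpa [Matrix.star_eq_conjTranspose] using Matrix.mem_unitaryGroup_iff.1 (hu s)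
  simp only [gateOn_apply, hU s dst (Finset.mem_singleton_self _), Function.update_self,
    Function.update_idem, Finset.mul_sum]
  rw [Finset.sum_comm]
  simp only [← mul_assoc, ← Finset.sum_mul]
  have h2 : ∀ a b, ∑ v, (if (!adj) = true then (U s).conjTranspose else U s) a v *
      (if adj = true then (U s).conjTranspose else U s) v b = (1 : Gate w) a b := fun a b => by
    rw [← h1, Matrix.mul_apply]
  simp only [h2, Matrix.one_apply, ite_mul, one_mul, zero_mul]
  simp

lemma phaseOn_phaseOn (p : Cfg w → Prop) (t : ℝ) (ψ : State w) :
    phaseOn p (-t) (phaseOn p t ψ) = ψ := by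
  ext s
  rw [phaseOn_apply, phaseOn_apply]
  split_ifs
  · rw [← mul_assoc, ← Complex.exp_add]
    simp
  · simp

lemma Instr.inverse_inverse (i : Instr) : i.inverse.inverse = i := by
  cases i <;> simp [Instr.inverse]

lemma Instr.inverse_wellFormed {i : Instr} (hi : i.WellFormed) : i.inverse.WellFormed := by
  cases i <;> exact hi

lemma Instr.inverse_writes (i : Instr) : i.inverse.writes = i.writes := by
  cases i <;> rfl

lemma Instr.apply_inverse_apply {M : Machine w} (hM : M.IsUnitary) {i : Instr} (hi : i.WellFormed)
    (ψ : State w) : i.inverse.apply M (i.apply M ψ) = ψ := by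
  rcases Instr.apply_cases hM hi with ⟨dst, g, -, hg, h1, h2⟩ | ⟨dst, U, adj, -, hU, hu, h1, h2⟩ |
    ⟨p, t, -, h1, h2⟩
  · rw [h1, h2, xorOn_xorOn hg]
  · rw [h1, h2, gateOn_gateOn hU hu]
  · rw [h1, h2, phaseOn_phaseOn]

lemma ip_xorOn {dst : Reg} {g : Cfg w → Word w} (hg : IndepOf {dst} g) (φ ψ : State w) :
    ip (xorOn dst g φ) ψ = ip φ (xorOn dst g ψ) := by
  have hinv : Function.Involutive
      (fun s : Cfg w => Function.update s dst (s dst ^^^ g s)) := fun s => by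
    simp [hg s dst (Finset.mem_singleton_self _)]
  unfold ip
  refine Fintype.sum_equiv hinv.toPerm _ _ fun s => ?_
  simp only [xorOn_apply, Function.Involutive.coe_toPerm]
  have := hinv s
  simp only at this
  rw [this]

/-- Exchange the content of a register with a separate word. -/
def swapReg (dst : Reg) : Cfg w × Word w ≃ Cfg w × Word w :=
  Function.Involutive.toPerm (fun p => (Function.update p.1 dst p.2, p.1 dst)) fun p => by simp

lemma swapReg_apply (dst : Reg) (p : Cfg w × Word w) :
    swapReg dst p = (Function.update p.1 dst p.2, p.1 dst) := rfl

lemma ip_gateOn {dst : Reg} {U : Cfg w → Gate w} (hU : IndepOf {dst} U) (adj : Bool)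
    (φ ψ : State w) : ip (gateOn dst U adj φ) ψ = ip φ (gateOn dst U (!adj) ψ) := by
  unfold ip
  simp only [gateOn_apply, map_sum, Finset.sum_mul, Finset.mul_sum]
  rw [← Fintype.sum_prod_type', ← Fintype.sum_prod_type']
  refine Fintype.sum_equiv (swapReg dst) _ _ fun p => ?_
  simp only [swapReg_apply, Function.update_self, Function.update_idem,
    Function.update_eq_self, hU p.1 dst (Finset.mem_singleton_self _)]
  cases adj <;> simp [Matrix.conjTranspose_apply] <;> ring

lemma ip_phaseOn (p : Cfg w → Prop) (t : ℝ) (φ ψ : State w) :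
    ip (phaseOn p t φ) ψ = ip φ (phaseOn p (-t) ψ) := by
  unfold ip
  refine Finset.sum_congr rfl fun s _ => ?_
  rw [phaseOn_apply, phaseOn_apply]
  split_ifs
  · rw [map_mul, ← Complex.exp_conj, map_mul, Complex.conj_ofReal, Complex.conj_I]
    push_cast
    rw [neg_mul, mul_neg]
    ring
  · simp

lemma Instr.ip_apply {M : Machine w} (hM : M.IsUnitary) {i : Instr} (hi : i.WellFormed)
    (φ ψ : State w) : ip (i.apply M φ) ψ = ip φ (i.inverse.apply M ψ) := by
  rcases Instr.apply_cases hM hi with ⟨dst, g, -, hg, h1, h2⟩ | ⟨dst, U, adj, -, hU, hu, h1, h2⟩ |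
    ⟨p, t, -, h1, h2⟩
  · rw [h1, h2, ip_xorOn hg]
  · rw [h1, h2, ip_gateOn hU]
  · rw [h1, h2, ip_phaseOn]

lemma Instr.apply_add {M : Machine w} (hM : M.IsUnitary) {i : Instr} (hi : i.WellFormed)
    (φ ψ : State w) : i.apply M (φ + ψ) = i.apply M φ + i.apply M ψ := by
  rcases Instr.apply_cases hM hi with ⟨dst, g, -, hg, h1, h2⟩ | ⟨dst, U, adj, -, hU, hu, h1, h2⟩ |
    ⟨p, t, -, h1, h2⟩ <;> rw [h1] <;> ext s
  · simp
  · simp [mul_add, Finset.sum_add_distrib]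
  · simp only [phaseOn_apply, PiLp.add_apply]; ring

lemma Instr.apply_smul {M : Machine w} (hM : M.IsUnitary) {i : Instr} (hi : i.WellFormed)
    (c : ℂ) (ψ : State w) : i.apply M (c • ψ) = c • i.apply M ψ := by
  rcases Instr.apply_cases hM hi with ⟨dst, g, -, hg, h1, h2⟩ | ⟨dst, U, adj, -, hU, hu, h1, h2⟩ |
    ⟨p, t, -, h1, h2⟩ <;> rw [h1] <;> ext s
  · simp
  · simp only [gateOn_apply, PiLp.smul_apply, smul_eq_mul, Finset.mul_sum]
    exact Finset.sum_congr rfl fun v _ => by ring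
  · simp only [phaseOn_apply, PiLp.smul_apply, smul_eq_mul]; ring

lemma Instr.apply_mask {M : Machine w} (hM : M.IsUnitary) {i : Instr} (hi : i.WellFormed)
    {f : Cfg w → ℂ} (hf : IndepOf i.writes f) (ψ : State w) :
    i.apply M (mask f ψ) = mask f (i.apply M ψ) := by
  rcases Instr.apply_cases hM hi with ⟨dst, g, hw, hg, h1, h2⟩ |
    ⟨dst, U, adj, hw, hU, hu, h1, h2⟩ | ⟨p, t, hw, h1, h2⟩ <;> rw [h1] <;> rw [hw] at hf <;> ext s
  · simp [hf s dst (Finset.mem_singleton_self _)]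
  · simp only [gateOn_apply, mask_apply, hf s dst (Finset.mem_singleton_self _), Finset.mul_sum]
    exact Finset.sum_congr rfl fun v _ => by ring
  · simp only [phaseOn_apply, mask_apply]; ring

namespace Circuit

variable {M : Machine w} {P Q : Circuit} {R R' : Finset Reg}

@[simp] lemma run_nil (ψ : State w) : run M [] ψ = ψ := rfl

@[simp] lemma run_cons (i : Instr) (P : Circuit) (ψ : State w) :
    run M (i :: P) ψ = run M P (i.apply M ψ) := rfl

lemma run_append (P Q : Circuit) (ψ : State w) :
    run M (P ++ Q) ψ = run M Q (run M P ψ) := List.foldl_append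

lemma ActsOn.append (hP : P.ActsOn R) (hQ : Q.ActsOn R) : ActsOn R (P ++ Q) := fun i hi =>
  (List.mem_append.1 hi).elim (hP i) (hQ i)

lemma ActsOn.mono (hP : P.ActsOn R) (h : R ⊆ R') : P.ActsOn R' := fun i hi =>
  ⟨(hP i hi).1, (hP i hi).2.trans h⟩

lemma ActsOn.inverse (hP : P.ActsOn R) : P.inverse.ActsOn R := by
  intro i hi
  obtain ⟨j, hj, rfl⟩ := List.mem_map.1 (List.mem_reverse.1 hi)
  exact ⟨Instr.inverse_wellFormed (hP j hj).1, (Instr.inverse_writes j).symm ▸ (hP j hj).2⟩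

lemma inverse_inverse (P : Circuit) : P.inverse.inverse = P := by
  simp [Circuit.inverse, List.map_reverse, Function.comp_def, Instr.inverse_inverse]

lemma inverse_cons (i : Instr) (P : Circuit) :
    Circuit.inverse (i :: P) = P.inverse ++ [i.inverse] := by
  simp [Circuit.inverse]

lemma ActsOn.cons {i : Instr} (h : ActsOn R (i :: P)) :
    (i.WellFormed ∧ i.writes ⊆ R) ∧ P.ActsOn R :=
  ⟨h i List.mem_cons_self, fun j hj => h j (List.mem_cons_of_mem _ hj)⟩

lemma run_inverse_run (hM : M.IsUnitary) (hP : P.ActsOn R) (ψ : State w) :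
    run M P.inverse (run M P ψ) = ψ := by
  induction P generalizing ψ with
  | nil => rfl
  | cons i P ih =>
    rw [inverse_cons, run_append, run_cons i, ih hP.cons.2]
    exact Instr.apply_inverse_apply hM hP.cons.1.1 ψ

lemma run_run_inverse (hM : M.IsUnitary) (hP : P.ActsOn R) (ψ : State w) :
    run M P (run M P.inverse ψ) = ψ := by
  have := run_inverse_run hM hP.inverse ψ
  rwa [inverse_inverse] at this

lemma ip_run (hM : M.IsUnitary) (hP : P.ActsOn R) (φ ψ : State w) :
    ip (run M P φ) ψ = ip φ (run M P.inverse ψ) := by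
  induction P generalizing φ with
  | nil => rfl
  | cons i P ih =>
    rw [inverse_cons, run_append, run_cons, ih hP.cons.2, Instr.ip_apply hM hP.cons.1.1]
    rfl

lemma run_add (hM : M.IsUnitary) (hP : P.ActsOn R) (φ ψ : State w) :
    run M P (φ + ψ) = run M P φ + run M P ψ := by
  induction P generalizing φ ψ with
  | nil => rfl
  | cons i P ih => rw [run_cons, Instr.apply_add hM hP.cons.1.1, ih hP.cons.2]; rfl

lemma run_smul (hM : M.IsUnitary) (hP : P.ActsOn R) (c : ℂ) (ψ : State w) :
    run M P (c • ψ) = c • run M P ψ := by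
  induction P generalizing ψ with
  | nil => rfl
  | cons i P ih => rw [run_cons, Instr.apply_smul hM hP.cons.1.1, ih hP.cons.2]; rfl

/-- A circuit commutes with diagonal operators that involve only registers it does not modify. -/
lemma run_mask (hM : M.IsUnitary) (hP : P.ActsOn R) {f : Cfg w → ℂ} (hf : IndepOf R f)
    (ψ : State w) : run M P (mask f ψ) = mask f (run M P ψ) := by
  induction P generalizing ψ with
  | nil => rfl
  | cons i P ih =>
    rw [run_cons, Instr.apply_mask hM hP.cons.1.1 (hf.mono hP.cons.1.2), ih hP.cons.2]; rfl

end Circuit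

lemma ip_self (ψ : State w) : ip ψ ψ = ((∑ s, ‖ψ s‖ ^ 2 : ℝ) : ℂ) := by
  unfold ip
  push_cast
  refine Finset.sum_congr rfl fun s _ => ?_
  rw [mul_comm, Complex.mul_conj, Complex.normSq_eq_norm_sq]
  push_cast; rfl

lemma ip_basis (κ : Cfg w) (ψ : State w) : ip (basis κ) ψ = ψ κ := by
  simp [ip, apply_ite]

lemma sum_norm_sq_run {M : Machine w} {P : Circuit} {R : Finset Reg} (hM : M.IsUnitary)
    (hP : P.ActsOn R) (ψ : State w) :
    ∑ s, ‖Circuit.run M P ψ s‖ ^ 2 = ∑ s, ‖ψ s‖ ^ 2 := by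
  have h := ip_self (Circuit.run M P ψ)
  rw [Circuit.ip_run hM hP, Circuit.run_inverse_run hM hP, ip_self] at h
  exact_mod_cast h.symm

/-- The weight of an event that involves only registers not modified by the circuit is preserved. -/
lemma sum_norm_sq_run_of_indep {M : Machine w} {P : Circuit} {R : Finset Reg} (hM : M.IsUnitary)
    (hP : P.ActsOn R) (q : Cfg w → Prop) [DecidablePred q]
    (hq : IndepOf R q) (ψ : State w) :
    ∑ s, (if q s then ‖Circuit.run M P ψ s‖ ^ 2 else 0) =
      ∑ s, if q s then ‖ψ s‖ ^ 2 else 0 := by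
  have hf : IndepOf R (fun s => if q s then (1 : ℂ) else 0) := fun s r hr v => by
    simp only [hq s r hr v]
  have h := sum_norm_sq_run hM hP (mask (fun s => if q s then (1 : ℂ) else 0) ψ)
  rw [Circuit.run_mask hM hP hf] at h
  simpa [apply_ite, ite_pow] using h

/-- Reset the registers of `R` to zero. -/
def zeroOn (R : Finset Reg) (s : Cfg w) : Cfg w := fun r => if r ∈ R then 0 else s r

lemma zeroOn_of_mem {R : Finset Reg} {r : Reg} (h : r ∈ R) (s : Cfg w) : zeroOn R s r = 0 :=
  if_pos h

lemma zeroOn_of_notMem {R : Finset Reg} {r : Reg} (h : r ∉ R) (s : Cfg w) : zeroOn R s r = s r :=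
  if_neg h

lemma zeroOn_eq_self {R : Finset Reg} {s : Cfg w} (h : ∀ r ∈ R, s r = 0) : zeroOn R s = s := by
  funext r
  by_cases hr : r ∈ R
  · rw [zeroOn_of_mem hr, h r hr]
  · rw [zeroOn_of_notMem hr]

lemma zeroOn_indep (R : Finset Reg) : IndepOf R (zeroOn (w := w) R) := by
  intro s r hr v
  funext r'
  by_cases hr' : r' ∈ R
  · rw [zeroOn_of_mem hr', zeroOn_of_mem hr']
  · rw [zeroOn_of_notMem hr', zeroOn_of_notMem hr',
      Function.update_of_ne (fun h : r' = r => hr' (by rw [h]; exact hr))]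

/-- The registers of `R` are zero in the state. -/
def ZeroOn (R : Finset Reg) (ψ : State w) : Prop := ∀ s, ψ s ≠ 0 → ∀ r ∈ R, s r = 0

lemma ZeroOn.mono {R R' : Finset Reg} {ψ : State w} (h : ZeroOn R ψ) (hR : R' ⊆ R) :
    ZeroOn R' ψ := fun s hs r hr => h s hs r (hR hr)

lemma ZeroOn.apply_eq_zero {R : Finset Reg} {ψ : State w} (h : ZeroOn R ψ) {s : Cfg w} {r : Reg}
    (hr : r ∈ R) (hs : s r ≠ 0) : ψ s = 0 := by
  by_contra h0
  exact hs (h s h0 r hr)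

lemma ZeroOn.run {M : Machine w} {P : Circuit} {R R' : Finset Reg} (hM : M.IsUnitary)
    (hP : P.ActsOn R) (hd : Disjoint R R') {ψ : State w} (h : ZeroOn R' ψ) :
    ZeroOn R' (Circuit.run M P ψ) := by
  intro s hs r hr
  by_contra h0
  have hi : IndepOf R (fun s : Cfg w => if s r = 0 then (1 : ℂ) else 0) := fun s r' hr' v => by
    simp only [Function.update_of_ne
      (show r ≠ r' from fun h => Finset.disjoint_left.1 hd hr' (h ▸ hr))]
  have e : mask (fun s : Cfg w => if s r = 0 then (1 : ℂ) else 0) ψ = ψ := by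
    ext s
    by_cases h1 : s r = 0
    · simp [h1]
    · simp [h.apply_eq_zero hr h1]
  have h2 := Circuit.run_mask hM hP hi ψ
  rw [e] at h2
  apply hs
  rw [h2, mask_apply, if_neg h0, zero_mul]

/-- A circuit acts separately on every setting of the registers that it does not modify. -/
lemma run_eq_mul_run_basis {M : Machine w} {P : Circuit} {R : Finset Reg} (hM : M.IsUnitary)
    (hP : P.ActsOn R) {ψ : State w} (h : ZeroOn R ψ) (s : Cfg w) :
    Circuit.run M P ψ s = ψ (zeroOn R s) * Circuit.run M P (basis (zeroOn R s)) s := by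
  set f : Cfg w → ℂ := fun s' => if zeroOn R s' = zeroOn R s then 1 else 0 with hf_def
  have hf : IndepOf R f := fun s' r hr v => by
    simp only [hf_def, zeroOn_indep R s' r hr v]
  have e : mask f ψ = ψ (zeroOn R s) • basis (zeroOn R s) := by
    ext s'
    simp only [mask_apply, PiLp.smul_apply, basis_apply, smul_eq_mul, hf_def]
    by_cases h0 : ψ s' = 0
    · by_cases h1 : s' = zeroOn R s
      · rw [← h1, h0]; simp
      · simp [h1]; exact fun _ => h0
    · rw [zeroOn_eq_self (h s' h0)]
      by_cases h1 : s' = zeroOn R s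
      · simp [h1]
      · simp [h1]
  have h2 := congrArg (fun χ : State w => χ s) (Circuit.run_mask hM hP hf ψ)
  simp only [e, Circuit.run_smul hM hP, PiLp.smul_apply, smul_eq_mul, mask_apply] at h2
  rw [h2]
  simp [hf_def]

lemma zeroOn_eq_of_run_basis_ne_zero {M : Machine w} {P : Circuit} {R : Finset Reg}
    (hM : M.IsUnitary) (hP : P.ActsOn R) {κ s : Cfg w} (h : Circuit.run M P (basis κ) s ≠ 0) :
    zeroOn R s = zeroOn R κ := by
  by_contra hne
  set f : Cfg w → ℂ := fun s' => if zeroOn R s' = zeroOn R κ then 1 else 0 with hf_def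
  have hf : IndepOf R f := fun s' r hr v => by
    simp only [hf_def, zeroOn_indep R s' r hr v]
  have e : mask f (basis κ) = basis κ := by
    ext s'
    simp only [mask_apply, basis_apply, hf_def]
    by_cases h1 : s' = κ
    · simp [h1]
    · simp [h1]
  have h2 := Circuit.run_mask hM hP hf (basis κ)
  rw [e] at h2
  apply h
  rw [h2]
  simp [hf_def, hne]

/-! ### Amplitude amplification on circuits -/

/-- `v` with its accepted part multiplied by `p.1` and its rejected part by `p.2`; a basis state is
accepted if the check `g` has the value `1`. -/
def comb (g : Cfg w → Word w) (v : State w) (p : ℂ × ℂ) : State w :=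
  mask (fun s => if g s = 1 then p.1 else p.2) v

/-- The probability that the check `g` accepts in the state `v`. -/
def acceptProb (g : Cfg w → Word w) (v : State w) : ℝ :=
  ∑ s, if g s = 1 then ‖v s‖ ^ 2 else 0

lemma ip_comb {g : Cfg w → Word w} {v : State w} (hv : ∑ s, ‖v s‖ ^ 2 = 1) (p : ℂ × ℂ) :
    ip v (comb g v p) = acceptProb g v * p.1 + (1 - acceptProb g v) * p.2 := by
  have h1 : (1 - acceptProb g v : ℝ) = ∑ s, if g s = 1 then 0 else ‖v s‖ ^ 2 := by
    rw [acceptProb, ← hv, ← Finset.sum_sub_distrib]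
    exact Finset.sum_congr rfl fun s _ => by split_ifs <;> simp
  have h2 : (1 - acceptProb g v : ℂ) = ((1 - acceptProb g v : ℝ) : ℂ) := by push_cast; rfl
  rw [h2, h1, acceptProb, ip]
  push_cast
  rw [Finset.sum_mul, Finset.sum_mul, ← Finset.sum_add_distrib]
  refine Finset.sum_congr rfl fun s _ => ?_
  have hk : (starRingEnd ℂ) (v s) * v s = ((‖v s‖ ^ 2 : ℝ) : ℂ) := by
    rw [mul_comm, Complex.mul_conj, Complex.normSq_eq_norm_sq]
  simp only [comb, mask_apply]
  split_ifs
  · rw [Complex.ofReal_zero]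
    linear_combination p.1 * hk
  · rw [Complex.ofReal_zero]
    linear_combination p.2 * hk

open Classical in
/-- Computing the check, applying a phase to the flag, and uncomputing the check applies the phase
to the accepted part. -/
lemma check_phase_check {g : Cfg w → Word w} {fl : Reg} (hg : IndepOf {fl} g) {v : State w}
    (hv : ZeroOn {fl} v) (t : ℝ) (p : ℂ × ℂ) :
    xorOn fl g (phaseOn (fun s => s fl = 1) t (xorOn fl g (comb g v p))) =
      comb g v (Complex.exp (t * Complex.I) * p.1, p.2) := by
  ext s
  rw [xorOn_apply, phaseOn_apply, xorOn_apply]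
  simp only [hg s fl (Finset.mem_singleton_self _), Function.update_self, Function.update_idem,
    comb, mask_apply]
  have e : Function.update s fl (s fl ^^^ g s ^^^ g s) = s := by simp
  rw [e]
  by_cases h0 : s fl = 0
  · rw [h0, show (0 : Word w) ^^^ g s = g s from BitVec.zero_xor]
    split_ifs <;> ring
  · rw [hv.apply_eq_zero (Finset.mem_singleton_self _) h0]
    ring

/-- The state after `r` rounds of amplitude amplification of the sampled state `v`, applied to a
basis state whose registers `rs` and flag are zero: the sampling circuit maps the basis state to
`v`, so that the phase on the zero state acts as a reflection about `v`. -/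
lemma run_amplify {M : Machine w} (hM : M.IsUnitary) {samp check : Circuit} {fl : Reg}
    {rs : Finset Reg} (hs : samp.ActsOn rs) (hfl : fl ∉ rs) {g : Cfg w → Word w}
    (hg : IndepOf {fl} g) (hc : ∀ ψ : State w, Circuit.run M check ψ = xorOn fl g ψ)
    (hc' : ∀ ψ : State w, Circuit.run M check.inverse ψ = xorOn fl g ψ)
    (φ : Phases) (r : ℕ) {κ : Cfg w} (hκ : ∀ i ∈ insert fl rs, κ i = 0) (s : Cfg w) :
    Circuit.run M (amplify φ r samp check fl rs) (basis κ) s =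
      (if g s = 1 then goodAmp φ r (acceptProb g (Circuit.run M samp (basis κ)))
        else badAmp φ r (acceptProb g (Circuit.run M samp (basis κ)))) *
        xorOn fl g (Circuit.run M samp (basis κ)) s := by
  set v := Circuit.run M samp (basis κ) with hv_def
  have hz : ∀ {R : Finset Reg}, R ⊆ insert fl rs → ZeroOn R (basis κ) := fun hR s' h i hi => by
    rw [basis_apply] at h
    rw [show s' = κ by by_contra h'; simp [h'] at h]
    exact hκ i (hR hi)
  have hdisj : Disjoint rs {fl} := Finset.disjoint_singleton_right.2 hfl
  have hvfl : ZeroOn {fl} v := (hz (by simp)).run hM hs hdisj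
  have hvn : ∑ s, ‖v s‖ ^ 2 = 1 := by
    rw [hv_def, sum_norm_sq_run hM hs]
    simp [ite_pow, apply_ite]
  have hround : ∀ (j : ℕ) (p : ℂ × ℂ), Circuit.run M (check ++ [.phaseFlag fl (φ.flag j)] ++
      Circuit.inverse check ++ Circuit.inverse samp ++ [.phaseZero rs (φ.zero j)] ++ samp)
      (comb g v p) = comb g v
        (Complex.exp (φ.flag j * Complex.I) * p.1 + (Complex.exp (φ.zero j * Complex.I) - 1) *
          (acceptProb g v * (Complex.exp (φ.flag j * Complex.I) * p.1) +
            (1 - acceptProb g v) * p.2),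
        p.2 + (Complex.exp (φ.zero j * Complex.I) - 1) *
          (acceptProb g v * (Complex.exp (φ.flag j * Complex.I) * p.1) +
            (1 - acceptProb g v) * p.2)) := by
    intro j p
    simp only [Circuit.run_append, hc, hc', Circuit.run_cons, Circuit.run_nil]
    have h1 : Instr.apply M (.phaseFlag fl (φ.flag j)) (xorOn fl g (comb g v p)) =
        phaseOn (fun s => s fl = 1) (φ.flag j) (xorOn fl g (comb g v p)) := rfl
    rw [h1, check_phase_check hg hvfl]
    set p' : ℂ × ℂ := (Complex.exp (φ.flag j * Complex.I) * p.1, p.2) with hp'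
    set χ := comb g v p' with hχ
    set η := Circuit.run M samp.inverse χ with hη
    have hηκ : η κ = acceptProb g v * p'.1 + (1 - acceptProb g v) * p'.2 := by
      rw [← ip_basis κ η, hη, ← Circuit.ip_run hM hs, ← hv_def, hχ, ip_comb hvn]
    -- `η` agrees with `κ` outside `rs`, so that `κ` is its only basis state that is zero on `rs`
    have hblock : ∀ s', (∀ i ∈ rs, s' i = 0) → s' ≠ κ → η s' = 0 := by
      intro s' h0 hne
      set f : Cfg w → ℂ := fun t => if zeroOn rs t = zeroOn rs κ then 1 else 0 with hf
      have hfi : IndepOf rs f := fun t i hi u => by simp only [hf, zeroOn_indep rs t i hi u]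
      have e : mask f χ = χ := by
        ext t
        by_cases ht : zeroOn rs t = zeroOn rs κ
        · simp [hf, ht]
        · have : v t = 0 := by
            by_contra h; exact ht (zeroOn_eq_of_run_basis_ne_zero hM hs h)
          simp [hχ, comb, this]
      have h2 := Circuit.run_mask hM hs.inverse hfi χ
      rw [e, ← hη] at h2
      rw [h2, mask_apply, hf]
      simp only
      rw [zeroOn_eq_self h0, zeroOn_eq_self fun i hi => hκ i (Finset.mem_insert_of_mem hi),
        if_neg hne, zero_mul]
    have h3 : Instr.apply M (.phaseZero rs (φ.zero j)) η =
        η + ((Complex.exp (φ.zero j * Complex.I) - 1) * η κ) • basis κ := by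
      change phaseOn (fun s => ∀ i ∈ rs, s i = 0) (φ.zero j) η = _
      ext t
      rw [phaseOn_apply, PiLp.add_apply, PiLp.smul_apply, basis_apply, smul_eq_mul]
      by_cases ht : t = κ
      · subst ht
        rw [if_pos fun i hi => hκ i (Finset.mem_insert_of_mem hi), if_pos rfl]
        ring
      · rw [if_neg ht]
        by_cases h0 : ∀ i ∈ rs, t i = 0
        · rw [hblock t h0 ht]; ring
        · rw [if_neg h0]; ring
    rw [h3, Circuit.run_add hM hs, Circuit.run_smul hM hs, hη, Circuit.run_run_inverse hM hs,
      ← hη, hηκ, ← hv_def]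
    ext t
    simp only [hχ, comb, mask_apply, PiLp.add_apply, PiLp.smul_apply, smul_eq_mul, hp']
    split_ifs <;> ring
  have hrounds : ∀ n, Circuit.run M ((List.range n).flatMap fun j =>
      check ++ [.phaseFlag fl (φ.flag j)] ++ Circuit.inverse check ++ Circuit.inverse samp ++
        [.phaseZero rs (φ.zero j)] ++ samp) v = comb g v (roundAmp φ (acceptProb g v) n) := by
    intro n
    induction n with
    | zero => ext t; simp [comb, roundAmp]
    | succ n ih =>
      rw [List.range_succ, List.flatMap_append, Circuit.run_append, ih, List.flatMap_singleton,
        hround]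
      rfl
  unfold amplify
  rw [Circuit.run_append, Circuit.run_append, Circuit.run_append, ← hv_def, hrounds, hc]
  simp only [Circuit.run_cons, Circuit.run_nil]
  change phaseOn (fun _ => True) φ.global (phaseOn (fun s => s fl = 1) (φ.flag r) _) s = _
  rw [phaseOn_apply, phaseOn_apply, xorOn_apply, xorOn_apply, if_pos trivial]
  simp only [comb, mask_apply, hg s fl (Finset.mem_singleton_self _)]
  rw [goodAmp, badAmp]
  by_cases h : s fl = g s
  · rw [h, BitVec.xor_self]
    change _ * (_ * (_ * v (Function.update s fl 0))) = _ * v (Function.update s fl 0)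
    split_ifs <;> ring
  · rw [hvfl.apply_eq_zero (r := fl) (Finset.mem_singleton_self _)]
    · ring
    · rw [Function.update_self]
      exact fun h' => h (BitVec.xor_eq_zero_iff.1 h')

lemma xorOn_of_eq {g : Cfg w → Word w} {fl : Reg} (v : State w) {s : Cfg w} (h : s fl = g s) :
    xorOn fl g v s = v (Function.update s fl 0) := by
  rw [xorOn_apply, h, BitVec.xor_self]
  rfl

lemma eq_of_xorOn_ne_zero {g : Cfg w → Word w} {fl : Reg} {v : State w} (hv : ZeroOn {fl} v)
    {s : Cfg w} (h : xorOn fl g v s ≠ 0) : s fl = g s := by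
  by_contra hne
  refine h (hv.apply_eq_zero (r := fl) (Finset.mem_singleton_self _) ?_)
  rw [Function.update_self]
  exact fun h' => hne (BitVec.xor_eq_zero_iff.1 h')

lemma amplify_actsOn {samp check : Circuit} {fl : Reg} {rs R : Finset Reg} (hs : samp.ActsOn R)
    (hc : check.ActsOn R) (φ : Phases) (r : ℕ) : (amplify φ r samp check fl rs).ActsOn R := by
  have hp : ∀ i : Instr, i.WellFormed → i.writes = ∅ → Circuit.ActsOn R [i] := by
    intro i h1 h2 j hj
    rw [List.mem_singleton.1 hj, h2]; exact ⟨h1, Finset.empty_subset _⟩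
  refine (((hs.append fun i hi => ?_).append hc).append ?_)
  · obtain ⟨j, -, hj⟩ := List.mem_flatMap.1 hi
    exact (((((hc.append (hp (.phaseFlag fl (φ.flag j)) trivial rfl)).append
      hc.inverse).append hs.inverse).append
      (hp (.phaseZero rs (φ.zero j)) trivial rfl)).append hs) i hj
  · exact Circuit.ActsOn.append (hp (.phaseFlag fl (φ.flag r)) trivial rfl)
      (hp (.phase φ.global) trivial rfl)

lemma length_amplify (φ : Phases) (r : ℕ) (samp check : Circuit) (fl : Reg) (rs : Finset Reg) :
    List.length (amplify φ r samp check fl rs) =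
      List.length samp + r * (2 * List.length check + 2 * List.length samp + 2) +
        List.length check + 2 := by
  simp [amplify, Circuit.inverse, List.length_flatMap]
  ring

/-! ### Lookups in the stored arrays -/

lemma Table.Stores.mem_of_pointsTo {t : Table w} {bot k : Word w} {A : Finset (Word w)}
    (h : t.Stores bot k A) {i v : Word w} (hp : t.PointsTo k i v) : v ∈ A := by
  obtain ⟨hi, rfl⟩ := hp
  rw [h.1] at hi
  simpa using h.2.1.mapsTo (Set.mem_Iio.2 hi)

lemma Table.Stores.exists_pointsTo {t : Table w} {bot k : Word w} {A : Finset (Word w)}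
    (h : t.Stores bot k A) {v : Word w} (hv : v ∈ A) : ∃ i, t.PointsTo k i v := by
  obtain ⟨i, hi, rfl⟩ := h.2.1.surjOn hv
  refine ⟨BitVec.ofNat w i, ?_, rfl⟩
  rw [BitVec.toNat_ofNat, h.1]
  exact (Nat.mod_le _ _).trans_lt hi

lemma Table.Stores.pointsTo_inj {t : Table w} {bot k : Word w} {A : Finset (Word w)}
    (h : t.Stores bot k A) {i j v : Word w} (hi : t.PointsTo k i v) (hj : t.PointsTo k j v) :
    i = j := by
  refine BitVec.eq_of_toNat_eq (h.2.1.injOn (h.1 ▸ hi.1) (h.1 ▸ hj.1) ?_)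
  simp only [BitVec.ofNat_toNat, BitVec.setWidth_eq]
  rw [hi.2, hj.2]

lemma card_filter_toNat_lt (n : Word w) :
    (Finset.univ.filter fun i : Word w => i.toNat < n.toNat).card = n.toNat := by
  rw [← Finset.card_range n.toNat]
  refine Finset.card_nbij' BitVec.toNat (BitVec.ofNat w) ?_ ?_ ?_ ?_
  · intro i hi; simpa using hi
  · intro i hi
    have hi' : i < n.toNat := by simpa using hi
    simpa using (Nat.mod_le _ _).trans_lt hi'
  · intro i _; simp
  · intro i hi
    have hi' : i < n.toNat := by simpa using hi
    simpa using Nat.mod_eq_of_lt (hi'.trans n.isLt)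

lemma IsUniformGate.apply_of_pointsTo {U : Word w → Gate w} (hU : IsUniformGate U) {t : Table w}
    {bot k : Word w} {A : Finset (Word w)} (h : t.Stores bot k A) {i v : Word w}
    (hp : t.PointsTo k i v) : U (t.count k) i 0 = ((1 / √(A.card : ℝ) : ℝ) : ℂ) := by
  rw [(hU _).2 i, if_neg, if_pos, card_filter_toNat_lt, h.1]
  · simpa using hp.1
  · exact Finset.ne_empty_of_mem (Finset.mem_filter.2 ⟨Finset.mem_univ i, hp.1⟩)

lemma IsUniformGate.apply_ne_zero {U : Word w → Gate w} (hU : IsUniformGate U) {t : Table w}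
    {bot k : Word w} {A : Finset (Word w)} (h : t.Stores bot k A) {i : Word w}
    (hi : U (t.count k) i 0 ≠ 0) :
    (A = ∅ ∧ t.entry k i = bot) ∨ t.PointsTo k i (t.entry k i) := by
  rw [(hU _).2 i] at hi
  split_ifs at hi with h1 h2 h3
  · left
    have hA : A = ∅ := by
      rw [← Finset.card_eq_zero, ← h.1, ← card_filter_toNat_lt, h1, Finset.card_empty]
    exact ⟨hA, h2 ▸ h.2.2 hA⟩
  · exact absurd rfl hi
  · exact Or.inr ⟨by simpa using h3, rfl⟩
  · exact absurd rfl hi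

lemma lookup_actsOn {t : TableId} {key : Option Reg} {idx out : Reg}
    (hk : ∀ r ∈ key, r ≠ .N ∧ r ≠ idx ∧ r ≠ out) (hi : idx ≠ .N) (ho : idx ≠ out) :
    (lookup t key idx out).ActsOn {.N, idx, out} := by
  have h1 : key ≠ some .N := fun h => (hk _ h).1 rfl
  have h2 : key ≠ some out := fun h => (hk _ h).2.2 rfl
  intro i hmem
  simp only [lookup, List.mem_cons, List.not_mem_nil, or_false] at hmem
  rcases hmem with rfl | rfl | rfl | rfl <;>
    simp [Instr.WellFormed, Instr.writes, h1, h2, ho, hi.symm]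

/-- The amplitudes after a lookup; the scratch register is cleared again. -/
lemma run_lookup {M : Machine w} {t : TableId} {key : Option Reg} {idx out : Reg}
    (hk : ∀ r ∈ key, r ≠ .N ∧ r ≠ idx ∧ r ≠ out) (hi : idx ≠ .N) (ho : idx ≠ out) (hN : out ≠ .N)
    {ψ : State w} (hψ : ZeroOn {.N, idx, out} ψ) (s : Cfg w) :
    Circuit.run M (lookup t key idx out) ψ s =
      if s .N = 0 ∧ s out = (M.table t).entry (key.elim 0 s) (s idx) then
        M.unif ((M.table t).count (key.elim 0 s)) (s idx) 0 * ψ (zeroOn {.N, idx, out} s)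
      else 0 := by
  have hkey : ∀ (s' : Cfg w) r v, r ∈ ({.N, idx, out} : Finset Reg) →
      key.elim 0 (Function.update s' r v) = key.elim 0 s' := by
    intro s' r v hr
    cases key with
    | none => rfl
    | some k =>
      obtain ⟨h1, h2, h3⟩ := hk k rfl
      simp only [Option.elim]
      refine Function.update_of_ne (fun h => ?_) _ _
      subst h
      simp only [Finset.mem_insert, Finset.mem_singleton] at hr
      tauto
  simp only [lookup, Circuit.run_cons, Circuit.run_nil]
  simp only [Instr.apply, xorOn_apply, gateOn_apply, Bool.false_eq_true, if_false]
  set k := key.elim 0 s with hk_def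
  have e1 : ∀ v, key.elim 0 (Function.update s out v) = k := fun v => hkey s out v (by simp)
  have e2 : ∀ v v', key.elim 0 (Function.update (Function.update s out v) Reg.N v') = k :=
    fun v v' => by rw [hkey _ .N _ (by simp), e1]
  have e3 : ∀ v v' v'', key.elim 0 (Function.update (Function.update (Function.update s out v)
      Reg.N v') idx v'') = k := fun v v' v'' => by rw [hkey _ idx _ (by simp), e2]
  simp only [e1, e3, Function.update_self, Function.update_of_ne hN.symm,
    Function.update_of_ne hi, Function.update_of_ne hi.symm, Function.update_of_ne ho]
  set n := (M.table t).count k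
  set a := (M.table t).entry k (s idx)
  have hz : ∀ v : Word w, ψ (Function.update (Function.update (Function.update (Function.update
      s out (s out ^^^ a)) Reg.N (s .N ^^^ n)) idx v) Reg.N (s .N ^^^ n ^^^ n)) =
      if v = 0 ∧ s .N = 0 ∧ s out = a then ψ (zeroOn {.N, idx, out} s) else 0 := by
    intro v
    rw [BitVec.xor_assoc, BitVec.xor_self, show s .N ^^^ (0#w) = s .N from BitVec.xor_zero]
    split_ifs with h
    · obtain ⟨rfl, h0, ha⟩ := h
      refine congrArg (fun c : Cfg w => ψ c) (funext fun r => ?_)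
      rw [ha, BitVec.xor_self, h0]
      by_cases h1 : r = .N
      · subst h1; rw [Function.update_self, zeroOn_of_mem (by simp)]
      by_cases h2 : r = idx
      · subst h2
        rw [Function.update_of_ne h1, Function.update_self, zeroOn_of_mem (by simp)]
      by_cases h3 : r = out
      · subst h3
        rw [Function.update_of_ne h1, Function.update_of_ne h2, Function.update_of_ne h1,
          Function.update_self, zeroOn_of_mem (by simp)]
        rfl
      · rw [Function.update_of_ne h1, Function.update_of_ne h2, Function.update_of_ne h1,
          Function.update_of_ne h3, zeroOn_of_notMem (by simp [h1, h2, h3])]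
    · by_contra hne
      have hz := hψ _ hne
      refine h ⟨?_, ?_, ?_⟩
      · simpa [Function.update_of_ne hi] using hz idx (by simp)
      · simpa using hz .N (by simp)
      · have := hz out (by simp)
        rw [Function.update_of_ne hN, Function.update_of_ne ho.symm, Function.update_of_ne hN,
          Function.update_self] at this
        exact BitVec.xor_eq_zero_iff.1 this
  simp only [hz]
  by_cases h : s .N = 0 ∧ s out = a
  · rw [if_pos h, Finset.sum_eq_single 0]
    · rw [if_pos ⟨rfl, h⟩, h.1, show (0 : Word w) ^^^ n = n from BitVec.zero_xor]
    · intro v _ hv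
      rw [if_neg fun h' => hv h'.1, mul_zero]
    · exact fun h' => absurd (Finset.mem_univ _) h'
  · rw [if_neg h]
    exact Finset.sum_eq_zero fun v _ => by rw [if_neg fun h' => h h'.2, mul_zero]

end Circuits

/-! ### Amplitudes of the collision sampler -/

/-- An input with everything that the circuits have access to. -/
structure Setting {d w : ℕ} (I : SearchInput d) (e : Encoding I w) where
  θ : ℝ
  θ' : ℝ
  D : QData w
  D' : QData w
  S : Set (E d × E d)
  unif : Word w → Gate w
  dec : Word w → Word w → Gate w
  hD : D.StoresRel e I.C I.R
  hD' : D'.StoresRel e I.C' I.R'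
  hS : I.IsTruncation S
  hunif : IsUniformGate unif
  hdec : IsDecoder e S dec

section Fibers

variable {d : ℕ} {R : Set (E d × E d)} {A : Finset (E d)} {x c : E d}

lemma mem_fiber : c ∈ fiber R A x ↔ c ∈ A ∧ (x, c) ∈ R := by
  classical simp [fiber]

lemma mem_cofiber : x ∈ cofiber R A c ↔ x ∈ A ∧ (x, c) ∈ R := by
  classical simp [cofiber]

variable {I : SearchInput d} {y z c' : E d} {θ' : ℝ}

lemma mem_common : c ∈ I.common x y ↔ c ∈ fiber I.R I.C x ∧ c ∈ fiber I.R I.C y := by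
  classical simp [SearchInput.common]

lemma mem_common' : c ∈ I.common' x y ↔ c ∈ fiber I.R' I.C' x ∧ c ∈ fiber I.R' I.C' y := by
  classical simp [SearchInput.common']

lemma mem_third : z ∈ I.third θ' x y c' ↔
    z ∈ I.L ∧ Near θ' (dir x y) z ∧ c' ∈ I.common' (dir x y) z := by
  classical simp [SearchInput.third]

end Fibers

section Encoding

variable {d w : ℕ} {I : SearchInput d} (e : Encoding I w)

lemma Encoding.injOn_L : Set.InjOn e.code I.L := e.code_inj.mono fun _ h => Or.inl h

lemma Encoding.injOn_C : Set.InjOn e.code I.C := e.code_inj.mono fun _ h => Or.inr (Or.inl h)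

lemma Encoding.injOn_C' : Set.InjOn e.code I.C' := e.code_inj.mono fun _ h => Or.inr (Or.inr h)

lemma Encoding.one_ne_zero (e : Encoding I w) {x : E d} (hx : x ∈ I.L) : (1 : Word w) ≠ 0 := by
  intro h
  rcases Nat.eq_zero_or_pos w with rfl | hw
  · exact e.code_ne_bot x (Or.inl hx) (Subsingleton.elim _ _)
  · have := congrArg BitVec.toNat h
    simp [Nat.mod_eq_of_lt (Nat.one_lt_two_pow hw.ne')] at this

lemma Encoding.card_image_fiber (R : Set (E d × E d)) (x : E d) :
    ((fiber R I.C x).image e.code).card = (fiber R I.C x).card :=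
  Finset.card_image_of_injOn (e.injOn_C.mono fun _ h => (mem_fiber.1 h).1)

lemma Encoding.card_image_fiber' (R : Set (E d × E d)) (x : E d) :
    ((fiber R I.C' x).image e.code).card = (fiber R I.C' x).card :=
  Finset.card_image_of_injOn (e.injOn_C'.mono fun _ h => (mem_fiber.1 h).1)

lemma Encoding.card_image_cofiber (R : Set (E d × E d)) (c : E d) :
    ((cofiber R I.L c).image e.code).card = (cofiber R I.L c).card :=
  Finset.card_image_of_injOn (e.injOn_L.mono fun _ h => (mem_cofiber.1 h).1)

end Encoding

lemma run_lookup_zeroOn {w : ℕ} {M : Machine w} {t : TableId} {key : Option Reg} {idx out : Reg}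
    (hk : ∀ r ∈ key, r ≠ .N ∧ r ≠ idx ∧ r ≠ out) (hi : idx ≠ .N) (ho : idx ≠ out) (hN : out ≠ .N)
    {ψ : State w} {R : Finset Reg} (hψ : ZeroOn {.N, idx, out} ψ) (hR : ZeroOn R ψ)
    (h1 : idx ∉ R) (h2 : out ∉ R) : ZeroOn R (Circuit.run M (lookup t key idx out) ψ) := by
  intro s hs r hr
  rw [run_lookup hk hi ho hN hψ] at hs
  split_ifs at hs with h
  · by_cases hrN : r = .N
    · exact hrN ▸ h.1
    · have := hR _ (right_ne_zero_of_mul hs) r hr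
      rwa [zeroOn_of_notMem] at this
      simp only [Finset.mem_insert, Finset.mem_singleton]
      rintro (h | rfl | rfl)
      exacts [hrN h, h1 hr, h2 hr]
  · exact absurd rfl hs

/-- The registers used by the collision sampler. -/
def sampRegs : Finset Reg := {.N, .IX, .X, .IC, .C, .IY, .Y}

lemma rCollisionSamp_actsOn : rCollisionSamp.ActsOn sampRegs := by
  unfold rCollisionSamp
  refine Circuit.ActsOn.append (Circuit.ActsOn.append ?_ ?_) ?_
  · exact (lookup_actsOn (by simp) (by decide) (by decide)).mono (by decide)
  · exact (lookup_actsOn (by simp) (by decide) (by decide)).mono (by decide)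
  · exact (lookup_actsOn (by simp) (by decide) (by decide)).mono (by decide)

lemma zeroState_eq (w : ℕ) : zeroState w = basis fun _ => 0 := rfl

lemma zeroOn_zeroState (w : ℕ) (R : Finset Reg) : ZeroOn R (zeroState w) := by
  intro s hs r _
  rw [zeroState_eq, basis_apply] at hs
  by_cases h : s = fun _ => 0
  · rw [h]
  · rw [if_neg h] at hs; exact absurd rfl hs

namespace Setting

variable {d w : ℕ} {I : SearchInput d} {e : Encoding I w} (K : Setting I e)

/-- The machine on which the circuits run. -/
def M : Machine w := machine e K.θ K.θ' K.D K.D' K.unif K.dec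

lemma isUnitary : K.M.IsUnitary := ⟨fun n => (K.hunif n).1, K.hdec.1⟩

lemma M_list : K.M.table .list = K.D.list := rfl

lemma M_fwd : K.M.table .fwd = K.D.fwd := rfl

lemma M_inv : K.M.table .inv = K.D.inv := rfl

lemma M_inv' : K.M.table .inv' = K.D'.inv := rfl

lemma M_unif : K.M.unif = K.unif := rfl

/-- The state prepared by the collision sampler. -/
def psi : State w := Circuit.run K.M rCollisionSamp (zeroState w)

/-- The registers that the collision sampler does not use are zero. -/
def RestZero (s : Cfg w) : Prop :=
  s .C' = 0 ∧ s .Z = 0 ∧ s .IZ = 0 ∧ s .F₁ = 0 ∧ s .F = 0 ∧ s .G = 0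

lemma zeroOn_eq_zero_iff (s : Cfg w) :
    zeroOn {.N, .IX, .X} (zeroOn {.N, .IC, .C} (zeroOn {.N, .IY, .Y} s)) = (fun _ => 0) ↔
      RestZero s := by
  constructor
  · intro h
    have h' := fun r => congrFun h r
    refine ⟨?_, ?_, ?_, ?_, ?_, ?_⟩
    · simpa [zeroOn] using h' .C'
    · simpa [zeroOn] using h' .Z
    · simpa [zeroOn] using h' .IZ
    · simpa [zeroOn] using h' .F₁
    · simpa [zeroOn] using h' .F
    · simpa [zeroOn] using h' .G
  · rintro ⟨h1, h2, h3, h4, h5, h6⟩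
    funext r
    cases r <;> simp [zeroOn, h1, h2, h3, h4, h5, h6]

lemma nested_ite (p q r t u : Prop) [Decidable (p ∧ t)] [Decidable q] [Decidable r] [Decidable u]
    [Decidable (p ∧ q ∧ r ∧ t ∧ u)] (a b c : ℂ) :
    (if p ∧ t then a * (if r then b * (if q then c * (if u then 1 else 0) else 0) else 0) else 0) =
      if p ∧ q ∧ r ∧ t ∧ u then a * (b * c) else 0 := by
  by_cases hp : p <;> by_cases hq : q <;> by_cases hr : r <;> by_cases ht : t <;>
    by_cases hu : u <;> simp [hp, hq, hr, ht, hu]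

open Classical in
lemma psi_apply (s : Cfg w) : K.psi s =
    if s .N = 0 ∧ s .X = K.D.list.entry 0 (s .IX) ∧ s .C = K.D.fwd.entry (s .X) (s .IC) ∧
      s .Y = K.D.inv.entry (s .C) (s .IY) ∧ RestZero s then
      K.unif (K.D.inv.count (s .C)) (s .IY) 0 * (K.unif (K.D.fwd.count (s .X)) (s .IC) 0 *
        K.unif (K.D.list.count 0) (s .IX) 0) else 0 := by
  have z0 : ∀ R, ZeroOn R (zeroState w) := zeroOn_zeroState w
  have k1 : ∀ r ∈ (none : Option Reg), r ≠ .N ∧ r ≠ .IX ∧ r ≠ .X := by simp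
  have k2 : ∀ r ∈ some Reg.X, r ≠ .N ∧ r ≠ .IC ∧ r ≠ .C := by simp
  have k3 : ∀ r ∈ some Reg.C, r ≠ .N ∧ r ≠ .IY ∧ r ≠ .Y := by simp
  have z1 : ZeroOn {.N, .IC, .C, .IY, .Y}
      (Circuit.run K.M (lookup .list none .IX .X) (zeroState w)) :=
    run_lookup_zeroOn k1 (by decide) (by decide) (by decide) (z0 _) (z0 _) (by decide) (by decide)
  have z2 : ZeroOn {.N, .IY, .Y} (Circuit.run K.M (lookup .fwd (some .X) .IC .C)
      (Circuit.run K.M (lookup .list none .IX .X) (zeroState w))) :=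
    run_lookup_zeroOn k2 (by decide) (by decide) (by decide) (z1.mono (by decide))
      (z1.mono (by decide)) (by decide) (by decide)
  rw [psi, rCollisionSamp, Circuit.run_append, Circuit.run_append,
    run_lookup k3 (by decide) (by decide) (by decide) z2,
    run_lookup k2 (by decide) (by decide) (by decide) (z1.mono (by decide)),
    run_lookup k1 (by decide) (by decide) (by decide) (z0 _), zeroState_eq, basis_apply]
  have e1 : zeroOn {.N, .IY, .Y} s .N = 0 := zeroOn_of_mem (by decide) s
  have e2 : zeroOn {.N, .IY, .Y} s .C = s .C := zeroOn_of_notMem (by decide) s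
  have e3 : zeroOn {.N, .IY, .Y} s .X = s .X := zeroOn_of_notMem (by decide) s
  have e4 : zeroOn {.N, .IY, .Y} s .IC = s .IC := zeroOn_of_notMem (by decide) s
  have e5 : zeroOn {.N, .IC, .C} (zeroOn {.N, .IY, .Y} s) .N = 0 := zeroOn_of_mem (by decide) _
  have e6 : zeroOn {.N, .IC, .C} (zeroOn {.N, .IY, .Y} s) .X = s .X := by
    rw [zeroOn_of_notMem (by decide), e3]
  have e7 : zeroOn {.N, .IC, .C} (zeroOn {.N, .IY, .Y} s) .IX = s .IX := by
    rw [zeroOn_of_notMem (by decide), zeroOn_of_notMem (by decide)]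
  simp only [zeroOn_eq_zero_iff, Option.elim, e1, e2, e3, e4, e5, e6, e7, true_and, M_list, M_fwd,
    M_inv, M_unif]
  exact nested_ite _ _ _ _ _ _ _ _

/-- The registers `X`, `C`, `Y` hold `x`, `c`, `y` that the collision sampler may find, and the
index registers hold the positions of their code words. -/
structure Sampled (s : Cfg w) (x c y : E d) : Prop where
  x_mem : x ∈ I.L
  c_mem : c ∈ fiber I.R I.C x
  y_mem : y ∈ cofiber I.R I.L c
  hX : s .X = e.code x
  hC : s .C = e.code c
  hY : s .Y = e.code y
  hN : s .N = 0
  hIX : K.D.list.PointsTo 0 (s .IX) (e.code x)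
  hIC : K.D.fwd.PointsTo (e.code x) (s .IC) (e.code c)
  hIY : K.D.inv.PointsTo (e.code c) (s .IY) (e.code y)

variable {K}

lemma Sampled.apply {s : Cfg w} {x c y : E d} (h : K.Sampled s x c y) (hr : RestZero s) :
    K.psi s = ((1 / √((I.L.card : ℝ) * (fiber I.R I.C x).card * (cofiber I.R I.L c).card) : ℝ) :
      ℂ) := by
  classical
  rw [psi_apply, if_pos, h.hX, h.hC,
    K.hunif.apply_of_pointsTo K.hD.1 h.hIX,
    K.hunif.apply_of_pointsTo (K.hD.2.1 x h.x_mem) h.hIC,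
    K.hunif.apply_of_pointsTo (K.hD.2.2.2.1 c (mem_fiber.1 h.c_mem).1) h.hIY,
    e.card_image_fiber, e.card_image_cofiber, Finset.card_image_of_injOn e.injOn_L,
    Real.sqrt_mul (by positivity), Real.sqrt_mul (by positivity)]
  · push_cast
    rw [one_div, one_div, one_div, one_div, mul_inv, mul_inv]
    ring
  · refine ⟨h.hN, ?_, ?_, ?_, hr⟩
    · rw [h.hIX.2, h.hX]
    · rw [h.hX, h.hIC.2, h.hC]
    · rw [h.hC, h.hIY.2, h.hY]

/-- A basis state in the support of the sampled state whose register `Y` holds a vector of `L`,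
rather than `⊥`, comes from a proper tuple. -/
lemma exists_sampled_of_psi_ne_zero {s : Cfg w} (hs : K.psi s ≠ 0) {y : E d} (hy : y ∈ I.L)
    (hsY : s .Y = e.code y) : RestZero s ∧ ∃ x c, K.Sampled s x c y := by
  classical
  rw [psi_apply] at hs
  split_ifs at hs with h
  swap
  · exact absurd rfl hs
  obtain ⟨hN, hX, hC, hY, hr⟩ := h
  refine ⟨hr, ?_⟩
  have u3 := left_ne_zero_of_mul hs
  have u2 := left_ne_zero_of_mul (right_ne_zero_of_mul hs)
  have u1 := right_ne_zero_of_mul (right_ne_zero_of_mul hs)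
  rcases K.hunif.apply_ne_zero K.hD.1 u1 with ⟨h1, -⟩ | h1
  · rw [Finset.image_eq_empty] at h1
    rw [h1] at hy
    exact absurd hy (Finset.notMem_empty _)
  rw [← hX] at h1
  obtain ⟨x, hx, hxs⟩ := Finset.mem_image.1 (K.hD.1.mem_of_pointsTo h1)
  rw [← hxs] at u2 hC h1
  rcases K.hunif.apply_ne_zero (K.hD.2.1 x hx) u2 with ⟨-, h2⟩ | h2
  · rw [hC, h2] at u3 hY
    rcases K.hunif.apply_ne_zero K.hD.2.2.2.2 u3 with ⟨-, h3⟩ | h3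
    · exact absurd (hsY.symm.trans (hY.trans h3)) (e.code_ne_bot y (Or.inl hy))
    · exact absurd (K.hD.2.2.2.2.mem_of_pointsTo h3) (Finset.notMem_empty _)
  rw [← hC] at h2
  obtain ⟨c, hc, hcs⟩ := Finset.mem_image.1 ((K.hD.2.1 x hx).mem_of_pointsTo h2)
  rw [← hcs] at u3 hY h2
  have hcC := (mem_fiber.1 hc).1
  rcases K.hunif.apply_ne_zero (K.hD.2.2.2.1 c hcC) u3 with ⟨-, h3⟩ | h3
  · exact absurd (hsY.symm.trans (hY.trans h3)) (e.code_ne_bot y (Or.inl hy))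
  rw [← hY, hsY] at h3
  obtain ⟨y', hy', hys⟩ := Finset.mem_image.1 ((K.hD.2.2.2.1 c hcC).mem_of_pointsTo h3)
  have hyy : y' = y := e.injOn_L (mem_cofiber.1 hy').1 hy hys
  subst hyy
  exact ⟨x, c, hx, hc, hy', hxs.symm, hcs.symm, hsY, hN, h1, h2, h3⟩

lemma Sampled.common {s : Cfg w} {x c y : E d} (h : K.Sampled s x c y) :
    y ∈ I.L ∧ c ∈ I.common x y :=
  ⟨(mem_cofiber.1 h.y_mem).1, mem_common.2 ⟨h.c_mem,
    mem_fiber.2 ⟨(mem_fiber.1 h.c_mem).1, (mem_cofiber.1 h.y_mem).2⟩⟩⟩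

variable (K)

open Classical in
/-- The value written by the check of the collision sampler. -/
def g1 (s : Cfg w) : Word w := if K.M.testXY (s .X) (s .Y) then 1 else 0

open Classical in
/-- The value written by the check of the search for `z`. -/
def g2 (s : Cfg w) : Word w := if K.M.testXYZ (s .X) (s .Y) (s .Z) then 1 else 0

variable {K}

lemma testXY_iff {x y : E d} (hx : x ∈ I.L) (hy : y ∈ I.L) :
    K.M.testXY (e.code x) (e.code y) ↔ Near K.θ x y := by
  constructor
  · rintro ⟨x', hx', y', hy', h1, h2, h3⟩
    rwa [e.injOn_L hx' hx h1, e.injOn_L hy' hy h2] at h3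
  · exact fun h => ⟨x, hx, y, hy, rfl, rfl, h⟩

lemma testXYZ_iff {x y z : E d} (hx : x ∈ I.L) (hy : y ∈ I.L) (hz : z ∈ I.L) :
    K.M.testXYZ (e.code x) (e.code y) (e.code z) ↔ Near K.θ' (dir x y) z := by
  constructor
  · rintro ⟨x', hx', y', hy', z', hz', h1, h2, h3, h4⟩
    rwa [e.injOn_L hx' hx h1, e.injOn_L hy' hy h2, e.injOn_L hz' hz h3] at h4
  · exact fun h => ⟨x, hx, y, hy, z, hz, rfl, rfl, rfl, h⟩

lemma g1_eq_one_iff {s : Cfg w} {x y : E d} (hx : x ∈ I.L) (hy : y ∈ I.L) (hX : s .X = e.code x)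
    (hY : s .Y = e.code y) : K.g1 s = 1 ↔ Near K.θ x y := by
  classical
  rw [g1, hX, hY, testXY_iff hx hy]
  by_cases h : Near K.θ x y
  · simp [h]
  · simp only [h, if_false, iff_false]
    exact (e.one_ne_zero hx).symm

lemma g2_eq_one_iff {s : Cfg w} {x y z : E d} (hx : x ∈ I.L) (hy : y ∈ I.L) (hz : z ∈ I.L)
    (hX : s .X = e.code x) (hY : s .Y = e.code y) (hZ : s .Z = e.code z) :
    K.g2 s = 1 ↔ Near K.θ' (dir x y) z := by
  classical
  rw [g2, hX, hY, hZ, testXYZ_iff hx hy hz]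
  by_cases h : Near K.θ' (dir x y) z
  · simp [h]
  · simp only [h, if_false, iff_false]
    exact (e.one_ne_zero hx).symm

variable (K)

/-- The norm of the projection of the sampled state onto `M₁`. -/
def p : ℝ := ‖projPairs e (I.M1 K.θ) K.psi‖

lemma acceptProb_g1 (hL : I.L.Nonempty) : acceptProb K.g1 K.psi = K.p ^ 2 := by
  classical
  rw [p, EuclideanSpace.norm_sq_eq, acceptProb]
  refine Finset.sum_congr rfl fun s _ => ?_
  simp only [projPairs]
  by_cases hs : K.psi s = 0
  · simp [hs]
  have hiff : K.g1 s = 1 ↔ ∃ q ∈ I.M1 K.θ, s .X = e.code q.1 ∧ s .Y = e.code q.2 := by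
    constructor
    · intro h
      by_cases ht : K.M.testXY (s .X) (s .Y)
      · obtain ⟨x, hx, y, hy, h1, h2, h3⟩ := ht
        obtain ⟨-, x', c, hS⟩ := exists_sampled_of_psi_ne_zero hs hy h2.symm
        have hxx : x' = x := e.injOn_L hS.x_mem hx (hS.hX.symm.trans h1.symm)
        subst hxx
        exact ⟨(x', y), ⟨hx, hy, h3, c, hS.common.2⟩, h1.symm, h2.symm⟩
      · rw [g1, if_neg ht] at h
        obtain ⟨x, hx⟩ := hL
        exact absurd h.symm (e.one_ne_zero hx)
    · rintro ⟨q, hq, h1, h2⟩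
      exact (g1_eq_one_iff hq.1 hq.2.1 h1 h2).2 hq.2.2.1
  simp only [hiff]
  split_ifs <;> simp

lemma sum_norm_sq_psi : ∑ s, ‖K.psi s‖ ^ 2 = 1 := by
  rw [psi, sum_norm_sq_run K.isUnitary rCollisionSamp_actsOn, zeroState_eq]
  simp [ite_pow, apply_ite]

lemma acceptProb_le_one {w : ℕ} (g : Cfg w → Word w) {v : State w} (hv : ∑ s, ‖v s‖ ^ 2 = 1) :
    acceptProb g v ≤ 1 := by
  rw [← hv]
  exact Finset.sum_le_sum fun s _ => by split_ifs <;> simp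

lemma nonempty_of_p_pos (h : 0 < K.p) : I.L.Nonempty := by
  by_contra hL
  rw [Finset.not_nonempty_iff_eq_empty] at hL
  have : projPairs e (I.M1 K.θ) K.psi = 0 := by
    classical
    ext s
    simp only [projPairs]
    rw [if_neg]
    · rfl
    · rintro ⟨q, hq, -⟩
      have := hq.1
      simp [hL] at this
  rw [p, this, norm_zero] at h
  exact h.false

lemma p_le_one (h : 0 < K.p) : K.p ≤ 1 := by
  have := acceptProb_le_one K.g1 K.sum_norm_sq_psi
  rw [K.acceptProb_g1 (K.nonempty_of_p_pos h)] at this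
  nlinarith

end Setting

/-! ### Amplitudes of the tuple sampler -/

namespace Setting

variable {d w : ℕ} {I : SearchInput d} {e : Encoding I w} (K : Setting I e)

lemma g1_indep : IndepOf {.F₁} K.g1 := by
  intro s r hr v
  rw [Finset.mem_singleton.1 hr]
  rfl

lemma g2_indep : IndepOf {.F} K.g2 := by
  intro s r hr v
  rw [Finset.mem_singleton.1 hr]
  rfl

/-- The amplified collision sampler. -/
def collisionSamp (φ : ℕ → Phases) (r₁ : ℕ) : Circuit :=
  amplify (φ r₁) r₁ rCollisionSamp [.testXY .X .Y .F₁] .F₁ sampRegs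

/-- The amplified search for `z`. -/
def thirdSamp (φ : ℕ → Phases) (r₂ : ℕ) : Circuit :=
  amplify (φ r₂) r₂ (lookup .inv' (some .C') .IZ .Z) [.testXYZ .X .Y .Z .F] .F {.N, .IZ, .Z}

lemma tupleSamp_eq (φ : ℕ → Phases) (r₁ r₂ : ℕ) :
    tupleSamp φ r₁ r₂ = collisionSamp φ r₁ ++ [.dec .X .Y .C' false] ++ thirdSamp φ r₂ := rfl

lemma collisionSamp_actsOn (φ : ℕ → Phases) (r₁ : ℕ) :
    (collisionSamp φ r₁).ActsOn (insert .F₁ sampRegs) := by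
  refine amplify_actsOn (rCollisionSamp_actsOn.mono (by decide)) (fun i hi => ?_) _ _
  rw [List.mem_singleton.1 hi]
  exact ⟨by simp [Instr.WellFormed], by decide⟩

lemma dec_actsOn : Circuit.ActsOn {.C'} [.dec .X .Y .C' false] := fun i hi => by
  rw [List.mem_singleton.1 hi]
  exact ⟨by simp [Instr.WellFormed], by decide⟩

lemma lookupZ_actsOn : (lookup .inv' (some .C') .IZ .Z).ActsOn {.N, .IZ, .Z} :=
  lookup_actsOn (by simp) (by decide) (by decide)

lemma thirdSamp_actsOn (φ : ℕ → Phases) (r₂ : ℕ) :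
    (thirdSamp φ r₂).ActsOn {.N, .IZ, .Z, .F} := by
  refine amplify_actsOn (lookupZ_actsOn.mono (by decide)) (fun i hi => ?_) _ _
  rw [List.mem_singleton.1 hi]
  exact ⟨by simp [Instr.WellFormed], by decide⟩

lemma tupleSamp_actsOn (φ : ℕ → Phases) (r₁ r₂ : ℕ) :
    (tupleSamp φ r₁ r₂).ActsOn (Finset.univ \ {.G}) := by
  rw [tupleSamp_eq]
  exact (((collisionSamp_actsOn φ r₁).mono (by decide)).append
    (dec_actsOn.mono (by decide))).append ((thirdSamp_actsOn φ r₂).mono (by decide))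

/-- The state after amplification of the collision sampler. -/
def psi1 (φ : ℕ → Phases) (r₁ : ℕ) : State w := Circuit.run K.M (collisionSamp φ r₁) (zeroState w)

/-- The state prepared by the tuple sampler. -/
def psi' (φ : ℕ → Phases) (r₁ r₂ : ℕ) : State w :=
  Circuit.run K.M (tupleSamp φ r₁ r₂) (zeroState w)

lemma psi1_apply (φ : ℕ → Phases) (r₁ : ℕ) (s : Cfg w) : K.psi1 φ r₁ s =
    (if K.g1 s = 1 then goodAmp (φ r₁) r₁ (acceptProb K.g1 K.psi)
      else badAmp (φ r₁) r₁ (acceptProb K.g1 K.psi)) * xorOn .F₁ K.g1 K.psi s :=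
  run_amplify K.isUnitary rCollisionSamp_actsOn (by decide) K.g1_indep (fun _ => rfl)
    (fun _ => rfl) (φ r₁) r₁ (fun _ _ => rfl) s

lemma psi_zeroOn : ZeroOn {.C', .Z, .IZ, .F₁, .F, .G} K.psi :=
  (zeroOn_zeroState w _).run K.isUnitary rCollisionSamp_actsOn (by decide)

lemma psi_zeroOn_N : ZeroOn {.N} K.psi := by
  classical
  intro s hs r hr
  rw [psi_apply] at hs
  split_ifs at hs with h
  · rw [Finset.mem_singleton.1 hr]
    exact h.1
  · exact absurd rfl hs

lemma psi1_zeroOn_N (φ : ℕ → Phases) (r₁ : ℕ) : ZeroOn {.N} (K.psi1 φ r₁) := by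
  intro s hs r hr
  rw [psi1_apply, xorOn_apply] at hs
  have := K.psi_zeroOn_N _ (right_ne_zero_of_mul hs) r hr
  rw [Finset.mem_singleton.1 hr] at this ⊢
  rwa [Function.update_of_ne (by decide)] at this

lemma psi1_zeroOn (φ : ℕ → Phases) (r₁ : ℕ) : ZeroOn {.C', .Z, .IZ, .F, .G} (K.psi1 φ r₁) :=
  (zeroOn_zeroState w _).run K.isUnitary (collisionSamp_actsOn φ r₁) (by decide)

/-- The state after the oracle call. -/
def psi2 (φ : ℕ → Phases) (r₁ : ℕ) : State w :=
  Circuit.run K.M [.dec .X .Y .C' false] (K.psi1 φ r₁)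

lemma psi2_apply (φ : ℕ → Phases) (r₁ : ℕ) (s : Cfg w) : K.psi2 φ r₁ s =
    K.dec (s .X) (s .Y) (s .C') 0 * K.psi1 φ r₁ (Function.update s .C' 0) := by
  change ∑ v, K.dec (s .X) (s .Y) (s .C') v * K.psi1 φ r₁ (Function.update s .C' v) = _
  refine Finset.sum_eq_single 0 (fun v _ hv => ?_) fun h => absurd (Finset.mem_univ _) h
  rw [(K.psi1_zeroOn φ r₁).apply_eq_zero (r := .C') (by decide), mul_zero]
  rwa [Function.update_self]

lemma psi2_zeroOn (φ : ℕ → Phases) (r₁ : ℕ) : ZeroOn {.N, .IZ, .Z, .F} (K.psi2 φ r₁) := by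
  have h1 : ZeroOn {.N, .IZ, .Z, .F} (K.psi1 φ r₁) := by
    intro s hs r hr
    by_cases h : r = .N
    · exact K.psi1_zeroOn_N φ r₁ s hs r (by simp [h])
    · refine K.psi1_zeroOn φ r₁ s hs r ?_
      revert hr h; revert r; decide
  exact h1.run K.isUnitary dec_actsOn (by decide)

/-- The state sampled by the lookup of `z`, on the setting of the other registers in `s`. -/
def psiZ (s : Cfg w) : State w :=
  Circuit.run K.M (lookup .inv' (some .C') .IZ .Z) (basis (zeroOn {.N, .IZ, .Z, .F} s))

lemma mul_ite_ite (p q r : Prop) [Decidable (p ∧ q)] [Decidable r] [Decidable (p ∧ q ∧ r)] (a : ℂ) :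
    (if p ∧ q then a * (if r then 1 else 0) else 0) = if p ∧ q ∧ r then a else 0 := by
  by_cases hp : p <;> by_cases hq : q <;> by_cases hr : r <;> simp [hp, hq, hr]

lemma psiZ_apply (s t : Cfg w) : K.psiZ s t =
    if t .N = 0 ∧ t .Z = K.D'.inv.entry (t .C') (t .IZ) ∧
      zeroOn {.N, .IZ, .Z} t = zeroOn {.N, .IZ, .Z, .F} s then
      K.unif (K.D'.inv.count (t .C')) (t .IZ) 0 else 0 := by
  have hz : ZeroOn {.N, .IZ, .Z} (basis (zeroOn {.N, .IZ, .Z, .F} s)) := by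
    intro t ht r hr
    rw [basis_apply] at ht
    split_ifs at ht with h
    · rw [h]
      exact zeroOn_of_mem (by revert hr; revert r; decide) _
    · exact absurd rfl ht
  rw [psiZ, run_lookup (by simp) (by decide) (by decide) (by decide) hz, basis_apply]
  simp only [M_inv', M_unif, Option.elim]
  exact mul_ite_ite _ _ _ _

/-- All amplitudes of the tuple state. The second amplification is conditional on the other
registers, so its success probability is that of the lookup started in the basis state they describe. -/
lemma psi'_apply (φ : ℕ → Phases) (r₁ r₂ : ℕ) (s : Cfg w) : K.psi' φ r₁ r₂ s =
    if s .F = K.g2 s ∧ s .N = 0 ∧ s .Z = K.D'.inv.entry (s .C') (s .IZ) then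
      (if K.g2 s = 1 then goodAmp (φ r₂) r₂ (acceptProb K.g2 (K.psiZ s))
        else badAmp (φ r₂) r₂ (acceptProb K.g2 (K.psiZ s))) *
      K.unif (K.D'.inv.count (s .C')) (s .IZ) 0 *
      (K.dec (s .X) (s .Y) (s .C') 0 * K.psi1 φ r₁ (zeroOn {.N, .IZ, .Z, .F, .C'} s)) else 0 := by
  have e0 : K.psi' φ r₁ r₂ = Circuit.run K.M (thirdSamp φ r₂) (K.psi2 φ r₁) := by
    rw [psi', tupleSamp_eq, Circuit.run_append, Circuit.run_append]
    rfl
  have hz : ∀ r ∈ insert Reg.F ({.N, .IZ, .Z} : Finset Reg),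
      zeroOn {.N, .IZ, .Z, .F} s r = 0 := fun r hr =>
    zeroOn_of_mem (by revert hr; revert r; decide) s
  rw [e0, run_eq_mul_run_basis K.isUnitary (thirdSamp_actsOn φ r₂) (K.psi2_zeroOn φ r₁), thirdSamp,
    run_amplify K.isUnitary lookupZ_actsOn (by decide) K.g2_indep (fun _ => rfl) (fun _ => rfl)
      (φ r₂) r₂ hz s, psi2_apply]
  have e1 : zeroOn {.N, .IZ, .Z, .F} s .X = s .X := zeroOn_of_notMem (by decide) s
  have e2 : zeroOn {.N, .IZ, .Z, .F} s .Y = s .Y := zeroOn_of_notMem (by decide) s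
  have e3 : zeroOn {.N, .IZ, .Z, .F} s .C' = s .C' := zeroOn_of_notMem (by decide) s
  have e4 : Function.update (zeroOn {.N, .IZ, .Z, .F} s) .C' 0 =
      zeroOn {.N, .IZ, .Z, .F, .C'} s := by
    funext r
    cases r <;> simp [zeroOn, Function.update]
  rw [e1, e2, e3, e4]
  change _ * ((if K.g2 s = 1 then goodAmp (φ r₂) r₂ (acceptProb K.g2 (K.psiZ s))
    else badAmp (φ r₂) r₂ (acceptProb K.g2 (K.psiZ s))) * xorOn .F K.g2 (K.psiZ s) s) = _
  generalize (if K.g2 s = 1 then goodAmp (φ r₂) r₂ (acceptProb K.g2 (K.psiZ s))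
    else badAmp (φ r₂) r₂ (acceptProb K.g2 (K.psiZ s))) = α
  have hzF : ZeroOn {.F} (K.psiZ s) := by
    refine ZeroOn.run K.isUnitary lookupZ_actsOn (by decide) fun t ht r hr => ?_
    rw [basis_apply] at ht
    split_ifs at ht with h
    · rw [h, Finset.mem_singleton.1 hr]
      exact zeroOn_of_mem (by decide) _
    · exact absurd rfl ht
  by_cases hF : s .F = K.g2 s
  · have e5 : zeroOn {.N, .IZ, .Z} (Function.update s .F 0) = zeroOn {.N, .IZ, .Z, .F} s := by
      funext r
      cases r <;> simp [zeroOn, Function.update]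
    have e6 : xorOn .F K.g2 (K.psiZ s) s = if s .N = 0 ∧ s .Z = K.D'.inv.entry (s .C') (s .IZ) then
        K.unif (K.D'.inv.count (s .C')) (s .IZ) 0 else 0 := by
      rw [xorOn_of_eq _ hF, psiZ_apply, e5]
      simp [Function.update]
    rw [e6]
    by_cases h : s .N = 0 ∧ s .Z = K.D'.inv.entry (s .C') (s .IZ)
    · rw [if_pos h, if_pos ⟨hF, h⟩]
      ring
    · rw [if_neg h, if_neg fun h' => h h'.2, mul_zero, mul_zero]
  · rw [if_neg fun h => hF h.1]
    have : xorOn .F K.g2 (K.psiZ s) s = 0 := by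
      by_contra h
      exact hF (eq_of_xorOn_ne_zero hzF h)
    rw [this, mul_zero, mul_zero]

/-- The registers hold a tuple that the tuple sampler may find, with the positions of the code
words; the flags of the checks are not constrained. -/
structure Full (s : Cfg w) (x c y c' z : E d) : Prop where
  sampled : K.Sampled s x c y
  c'_mem : c' ∈ fiber K.S I.C' (dir x y)
  z_mem : z ∈ cofiber I.R' I.L c'
  hC' : s .C' = e.code c'
  hZ : s .Z = e.code z
  hIZ : K.D'.inv.PointsTo (e.code c') (s .IZ) (e.code z)
  hG : s .G = 0

variable {K}

lemma fiber_S_subset {u c' : E d} (h : c' ∈ fiber K.S I.C' u) : c' ∈ fiber I.R' I.C' u :=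
  mem_fiber.2 ⟨(mem_fiber.1 h).1, K.hS.1 (mem_fiber.1 h).2⟩

lemma Full.common' {s : Cfg w} {x c y c' z : E d} (h : K.Full s x c y c' z) :
    z ∈ I.L ∧ c' ∈ I.common' (dir x y) z :=
  ⟨(mem_cofiber.1 h.z_mem).1, mem_common'.2 ⟨fiber_S_subset h.c'_mem,
    mem_fiber.2 ⟨(mem_fiber.1 h.c'_mem).1, (mem_cofiber.1 h.z_mem).2⟩⟩⟩

/-- The success probability of the search for `z`. -/
lemma Full.acceptProb_eq {s : Cfg w} {x c y c' z : E d} (h : K.Full s x c y c' z) :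
    acceptProb K.g2 (K.psiZ s) =
      ((I.third K.θ' x y c').card : ℝ) / (cofiber I.R' I.L c').card := by
  classical
  have hx := h.sampled.x_mem
  have hy := h.sampled.common.1
  have hst := K.hD'.2.2.2.1 c' (mem_fiber.1 h.c'_mem).1
  have hthird : ∀ v ∈ I.third K.θ' x y c', v ∈ cofiber I.R' I.L c' := fun v hv =>
    mem_cofiber.2 ⟨(mem_third.1 hv).1, (mem_fiber.1 (mem_common'.1 (mem_third.1 hv).2.2).2).2⟩
  have hex : ∀ v : E d, ∃ i, v ∈ cofiber I.R' I.L c' →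
      K.D'.inv.PointsTo (e.code c') i (e.code v) := fun v => by
    by_cases hv : v ∈ cofiber I.R' I.L c'
    · obtain ⟨i, hi⟩ := hst.exists_pointsTo (Finset.mem_image_of_mem e.code hv)
      exact ⟨i, fun _ => hi⟩
    · exact ⟨0, fun h => absurd h hv⟩
  choose ix hix using hex
  set κ := zeroOn {.N, .IZ, .Z, .F} s with hκ
  -- the basis state in which `v` has been found
  let T : E d → Cfg w := fun v => Function.update (Function.update κ .Z (e.code v)) .IZ (ix v)
  have hTZ : ∀ v, T v .Z = e.code v := fun v => by simp [T]
  have hTIZ : ∀ v, T v .IZ = ix v := fun v => by simp [T]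
  have hTC : ∀ v, T v .C' = e.code c' := fun v => by
    simpa [T, Function.update, hκ, zeroOn] using h.hC'
  have hTX : ∀ v, T v .X = e.code x := fun v => by
    simpa [T, Function.update, hκ, zeroOn] using h.sampled.hX
  have hTY : ∀ v, T v .Y = e.code y := fun v => by
    simpa [T, Function.update, hκ, zeroOn] using h.sampled.hY
  have hTN : ∀ v, T v .N = 0 := fun v => by simp [T, Function.update, hκ, zeroOn]
  have hTκ : ∀ v, zeroOn {.N, .IZ, .Z} (T v) = κ := fun v => by
    funext r
    cases r <;> simp [T, zeroOn, Function.update, hκ]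
  have hval : ∀ v ∈ I.third K.θ' x y c', (if K.g2 (T v) = 1 then ‖K.psiZ s (T v)‖ ^ 2 else 0) =
      1 / ((cofiber I.R' I.L c').card : ℝ) := by
    intro v hv
    have hvt := mem_third.1 hv
    rw [if_pos ((g2_eq_one_iff hx hy hvt.1 (hTX v) (hTY v) (hTZ v)).2 hvt.2.1), psiZ_apply, if_pos,
      hTC, hTIZ, K.hunif.apply_of_pointsTo hst (hix v (hthird v hv)), e.card_image_cofiber,
      Complex.norm_real, Real.norm_eq_abs, sq_abs, div_pow, one_pow, Real.sq_sqrt (by positivity)]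
    refine ⟨hTN v, ?_, hTκ v⟩
    rw [hTZ, hTC, hTIZ, (hix v (hthird v hv)).2]
  have hinj : Set.InjOn T (I.third K.θ' x y c') := fun v hv v' hv' hvv => by
    have := congrFun hvv .Z
    rw [hTZ, hTZ] at this
    exact e.injOn_L (mem_third.1 hv).1 (mem_third.1 hv').1 this
  rw [acceptProb, ← Finset.sum_subset (Finset.subset_univ ((I.third K.θ' x y c').image T)),
    Finset.sum_image hinj, Finset.sum_congr rfl hval, Finset.sum_const, nsmul_eq_mul, mul_one_div]
  intro t _ ht
  by_contra hne
  apply ht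
  split_ifs at hne with hg
  · have hne' : K.psiZ s t ≠ 0 := fun h0 => hne (by simp [h0])
    rw [psiZ_apply] at hne'
    split_ifs at hne' with hc
    · obtain ⟨htN, htZ, htκ⟩ := hc
      have hsub : ∀ r ∉ ({.N, .IZ, .Z, .F} : Finset Reg), r ∉ ({.N, .IZ, .Z} : Finset Reg) := by
        decide
      have htr : ∀ r ∉ ({.N, .IZ, .Z, .F} : Finset Reg), t r = s r := fun r hr => by
        have := congrFun htκ r
        rwa [zeroOn_of_notMem (hsub r hr), zeroOn_of_notMem hr] at this
      have htX := (htr .X (by decide)).trans h.sampled.hX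
      have htY := (htr .Y (by decide)).trans h.sampled.hY
      have htC := (htr .C' (by decide)).trans h.hC'
      rw [htC] at hne' htZ
      rcases K.hunif.apply_ne_zero hst hne' with ⟨h1, -⟩ | h1
      · rw [Finset.image_eq_empty] at h1
        exact absurd (h1 ▸ h.z_mem) (Finset.notMem_empty _)
      obtain ⟨v, hv, hvt⟩ := Finset.mem_image.1 (hst.mem_of_pointsTo h1)
      rw [← hvt] at h1 htZ
      have hvL := (mem_cofiber.1 hv).1
      have hvthird : v ∈ I.third K.θ' x y c' := mem_third.2 ⟨hvL,
        (g2_eq_one_iff hx hy hvL htX htY htZ).1 hg, mem_common'.2 ⟨fiber_S_subset h.c'_mem,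
          mem_fiber.2 ⟨(mem_fiber.1 h.c'_mem).1, (mem_cofiber.1 hv).2⟩⟩⟩
      refine Finset.mem_image.2 ⟨v, hvthird, ?_⟩
      have hidx : ix v = t .IZ := hst.pointsTo_inj (hix v hv) h1
      rw [← hκ] at htκ
      funext r
      by_cases h1 : r = .IZ
      · subst h1; rw [hTIZ, hidx]
      by_cases h2 : r = .Z
      · subst h2; rw [hTZ, htZ]
      by_cases h3 : r = .N
      · subst h3; rw [hTN, htN]
      · have hr : r ∉ ({.N, .IZ, .Z} : Finset Reg) := by simp [h1, h2, h3]
        have := congrFun ((hTκ v).trans htκ.symm) r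
        rwa [zeroOn_of_notMem hr, zeroOn_of_notMem hr] at this
    · exact absurd rfl hne'
  · exact absurd rfl hne

lemma Sampled.congr {s t : Cfg w} {x c y : E d} (h : K.Sampled s x c y)
    (ht : ∀ r ∈ sampRegs, t r = s r) : K.Sampled t x c y := by
  refine ⟨h.x_mem, h.c_mem, h.y_mem, ?_, ?_, ?_, ?_, ?_, ?_, ?_⟩
  · rw [ht _ (by decide), h.hX]
  · rw [ht _ (by decide), h.hC]
  · rw [ht _ (by decide), h.hY]
  · rw [ht _ (by decide), h.hN]
  · rw [ht _ (by decide)]; exact h.hIX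
  · rw [ht _ (by decide)]; exact h.hIC
  · rw [ht _ (by decide)]; exact h.hIY

/-- The product of the sizes that determine the amplitude of a tuple before amplification. -/
def size (K : Setting I e) (x c y c' : E d) : ℝ :=
  (I.L.card : ℝ) * (fiber I.R I.C x).card * (cofiber I.R I.L c).card *
    (fiber K.S I.C' (dir x y)).card * (cofiber I.R' I.L c').card

/-- The amplitude of a solution tuple, in terms of the two amplifications that it went through. -/
lemma Full.apply {s : Cfg w} {x c y c' z : E d} (h : K.Full s x c y c' z)
    (hθ : Near K.θ x y) (hθ' : Near K.θ' (dir x y) z) (hF₁ : s .F₁ = 1) (hF : s .F = 1)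
    (φ : ℕ → Phases) (r₁ r₂ : ℕ) : K.psi' φ r₁ r₂ s =
      goodAmp (φ r₁) r₁ (acceptProb K.g1 K.psi) *
      goodAmp (φ r₂) r₂ ((((I.third K.θ' x y c').card : ℝ) / (cofiber I.R' I.L c').card : ℝ) : ℂ) *
      ((1 / √(K.size x c y c') : ℝ) : ℂ) := by
  classical
  have hx := h.sampled.x_mem
  have hy := h.sampled.common.1
  have hg2 : K.g2 s = 1 :=
    (g2_eq_one_iff hx hy h.common'.1 h.sampled.hX h.sampled.hY h.hZ).2 hθ'
  have hg1 : K.g1 s = 1 := (g1_eq_one_iff hx hy h.sampled.hX h.sampled.hY).2 hθ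
  have hst := K.hD'.2.2.2.1 c' (mem_fiber.1 h.c'_mem).1
  set t := zeroOn {.N, .IZ, .Z, .F, .C'} s with ht
  have htg1 : K.g1 t = 1 := by
    rw [← hg1, g1, g1, ht, zeroOn_of_notMem (by decide), zeroOn_of_notMem (by decide)]
  have htF : t .F₁ = K.g1 t := by rw [htg1, ht, zeroOn_of_notMem (by decide), hF₁]
  have hdec : K.dec (e.code x) (e.code y) (e.code c') 0 =
      ((1 / √((fiber K.S I.C' (dir x y)).card : ℝ) : ℝ) : ℂ) := by
    have hmem := Finset.mem_image_of_mem e.code h.c'_mem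
    rw [(K.hdec.2 x hx y hy).2, if_neg (Finset.ne_empty_of_mem hmem), if_pos hmem,
      e.card_image_fiber']
  have hs : K.Sampled (Function.update t .F₁ 0) x c y := by
    refine h.sampled.congr fun r hr => ?_
    by_cases hN : r = .N
    · subst hN
      rw [Function.update_of_ne (by decide), ht, zeroOn_of_mem (by decide), h.sampled.hN]
    · rw [Function.update_of_ne (by revert hr; revert r; decide), ht,
        zeroOn_of_notMem (by revert hr hN; revert r; decide)]
  have hrest : RestZero (Function.update t .F₁ 0) := by
    simp [RestZero, Function.update, ht, zeroOn, h.hG]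
  have hsize : √(K.size x c y c') = √((I.L.card : ℝ) * (fiber I.R I.C x).card *
      (cofiber I.R I.L c).card) * √((fiber K.S I.C' (dir x y)).card : ℝ) *
      √((cofiber I.R' I.L c').card : ℝ) := by
    rw [size, Real.sqrt_mul (by positivity), Real.sqrt_mul (by positivity)]
  rw [psi'_apply, if_pos ⟨hF.trans hg2.symm, h.sampled.hN, by rw [h.hZ, h.hC', h.hIZ.2]⟩,
    if_pos hg2, h.acceptProb_eq, h.hC', h.sampled.hX, h.sampled.hY, hdec,
    K.hunif.apply_of_pointsTo hst h.hIZ, e.card_image_cofiber, psi1_apply, if_pos htg1,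
    xorOn_of_eq _ htF, hs.apply hrest, hsize]
  simp only [one_div, mul_inv]
  push_cast
  ring

/-- Only proper tuples have flag `1`: the check of `z` accepts only codes of vectors of `L` in the
registers `X`, `Y`, `Z`, and `⊥` in the register `C` or `C'` would carry over to `Y` or `Z`. -/
lemma exists_full_of_psi'_ne_zero {φ : ℕ → Phases} {r₁ r₂ : ℕ} {s : Cfg w}
    (hs : K.psi' φ r₁ r₂ s ≠ 0) (hF : s .F = 1) (hL : I.L.Nonempty) :
    ∃ x c y c' z, K.Full s x c y c' z ∧ Near K.θ' (dir x y) z ∧ s .F₁ = K.g1 s := by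
  classical
  rw [psi'_apply] at hs
  split_ifs at hs with h hg
  rotate_left
  · exact absurd (hF ▸ h.1).symm hg
  · exact absurd rfl hs
  obtain ⟨h1, hN, hZ⟩ := h
  have htest : K.M.testXYZ (s .X) (s .Y) (s .Z) := by
    by_contra ht
    rw [g2, if_neg ht] at hg
    obtain ⟨x, hx⟩ := hL
    exact absurd hg.symm (e.one_ne_zero hx)
  obtain ⟨x₀, hx₀, y, hy, z, hz, hX, hY, hZ', hθ'⟩ := htest
  have hunif := right_ne_zero_of_mul (left_ne_zero_of_mul hs)
  have hdec := left_ne_zero_of_mul (right_ne_zero_of_mul hs)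
  have hpsi := right_ne_zero_of_mul (right_ne_zero_of_mul hs)
  set t := zeroOn {.N, .IZ, .Z, .F, .C'} s with ht
  rw [psi1_apply] at hpsi
  have hxor := right_ne_zero_of_mul hpsi
  have htF : t .F₁ = K.g1 t := eq_of_xorOn_ne_zero (K.psi_zeroOn.mono (by decide)) hxor
  rw [xorOn_of_eq _ htF] at hxor
  have htr : ∀ r ∉ ({.N, .IZ, .Z, .F, .C'} : Finset Reg), t r = s r := fun r hr =>
    zeroOn_of_notMem hr s
  obtain ⟨hrest, x, c, hS⟩ := exists_sampled_of_psi_ne_zero hxor hy (by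
    rw [Function.update_of_ne (by decide), htr _ (by decide), hY])
  have hS' : K.Sampled s x c y := by
    refine hS.congr fun r hr => ?_
    by_cases hr' : r = .N
    · subst hr'
      rw [Function.update_of_ne (by decide), ht, zeroOn_of_mem (by decide), hN]
    · rw [Function.update_of_ne (by revert hr; revert r; decide),
        htr _ (by revert hr hr'; revert r; decide)]
  have hxx : x = x₀ := e.injOn_L hS.x_mem hx₀ (hS'.hX.symm.trans hX.symm)
  subst hxx
  have hG : s .G = 0 := by
    have := hrest.2.2.2.2.2
    rwa [Function.update_of_ne (by decide), htr _ (by decide)] at this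
  have hF₁ : s .F₁ = K.g1 s := by
    rw [← htr .F₁ (by decide), htF, g1, g1, htr .X (by decide), htr .Y (by decide)]
  rw [← hX, ← hY, (K.hdec.2 x hx₀ y hy).2] at hdec
  have hbot : s .C' ≠ e.bot := by
    intro hb
    rw [hb] at hunif hZ
    rcases K.hunif.apply_ne_zero K.hD'.2.2.2.2 hunif with ⟨-, h3⟩ | h3
    · exact absurd (hZ'.trans (hZ.trans h3)) (e.code_ne_bot z (Or.inl hz))
    · exact absurd (K.hD'.2.2.2.2.mem_of_pointsTo h3) (Finset.notMem_empty _)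
  have hmem : s .C' ∈ (fiber K.S I.C' (dir x y)).image e.code := by
    by_contra hmem
    rw [if_neg hmem] at hdec
    split_ifs at hdec <;> exact absurd rfl hdec
  obtain ⟨c', hc', hcs⟩ := Finset.mem_image.1 hmem
  have hst := K.hD'.2.2.2.1 c' (mem_fiber.1 hc').1
  rw [← hcs] at hunif hZ
  rcases K.hunif.apply_ne_zero hst hunif with ⟨-, h3⟩ | h3
  · exact absurd (hZ'.trans (hZ.trans h3)) (e.code_ne_bot z (Or.inl hz))
  rw [← hZ, ← hZ'] at h3
  obtain ⟨z', hz', hzs⟩ := Finset.mem_image.1 (hst.mem_of_pointsTo h3)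
  have hzz : z' = z := e.injOn_L (mem_cofiber.1 hz').1 hz hzs
  subst hzz
  exact ⟨x, c, y, c', z', ⟨hS', hc', hz', hcs.symm, hZ'.symm, h3, hG⟩, hθ', hF₁⟩

end Setting

/-! ### Amplitudes and output distribution of the search -/

/-- In `r` rounds, the angles `φ` amplify every success amplitude `x ∈ [lo, 1]` to `1`, phase
included, up to an error `η`. -/
def FixedPoint (φ : Phases) (r : ℕ) (lo η : ℝ) : Prop :=
  ∀ x : ℝ, lo ≤ x → x ≤ 1 → ‖(x : ℂ) * goodAmp φ r ((x ^ 2 : ℝ) : ℂ) - 1‖ ≤ η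

lemma norm_mul_goodAmp_le_one (φ : Phases) (r : ℕ) {x : ℝ} (hx0 : 0 ≤ x) (hx : x ≤ 1) :
    ‖(x : ℂ) * goodAmp φ r ((x ^ 2 : ℝ) : ℂ)‖ ≤ 1 := by
  have h := amp_norm φ r (x ^ 2)
  have h1 : 0 ≤ (1 - x ^ 2) * ‖badAmp φ r ((x ^ 2 : ℝ) : ℂ)‖ ^ 2 :=
    mul_nonneg (by nlinarith) (sq_nonneg _)
  rw [norm_mul, Complex.norm_real, Real.norm_eq_abs, abs_of_nonneg hx0]
  rw [← sq_le_one_iff₀ (by positivity), mul_pow]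
  linarith

lemma norm_mul_sub_one_le {a b : ℂ} {η : ℝ} (ha : ‖a - 1‖ ≤ η) (hb : ‖b - 1‖ ≤ η)
    (hb1 : ‖b‖ ≤ 1) : ‖a * b - 1‖ ≤ 2 * η := by
  have e : a * b - 1 = (a - 1) * b + (b - 1) := by ring
  rw [e]
  have h1 : ‖(a - 1) * b‖ ≤ ‖a - 1‖ := by
    rw [norm_mul]
    exact mul_le_of_le_one_right (norm_nonneg _) hb1
  linarith [norm_add_le ((a - 1) * b) (b - 1)]

lemma one_sub_le_norm {a : ℂ} {η : ℝ} (ha : ‖a - 1‖ ≤ η) : 1 - η ≤ ‖a‖ := by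
  have h := norm_sub_norm_le (1 : ℂ) a
  rw [norm_one, norm_sub_rev] at h
  linarith

lemma norm_projTriples_sq {d w : ℕ} {I : SearchInput d} (e : Encoding I w)
    (A : Set (E d × E d × E d)) (ψ : State w) [DecidablePred fun s : Cfg w =>
      ∃ t ∈ A, s .X = e.code t.1 ∧ s .Y = e.code t.2.1 ∧ s .Z = e.code t.2.2] :
    ‖projTriples e A ψ‖ ^ 2 = ∑ s, if ∃ t ∈ A, s .X = e.code t.1 ∧ s .Y = e.code t.2.1 ∧
      s .Z = e.code t.2.2 then ‖ψ s‖ ^ 2 else 0 := by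
  rw [EuclideanSpace.norm_sq_eq]
  refine Finset.sum_congr rfl fun s _ => ?_
  simp only [projTriples]
  split_ifs <;> simp

namespace Setting

variable {d w : ℕ} {I : SearchInput d} {e : Encoding I w} (K : Setting I e)

/-- The norm of the projection of the tuple state onto `T`. -/
def p' (φ : ℕ → Phases) (r₁ r₂ : ℕ) : ℝ := ‖projTriples e (I.T K.θ K.θ') (K.psi' φ r₁ r₂)‖

/-- The weight of a tuple, with the truncated relation `S` in place of `R'`. -/
def weightS (x c y c' : E d) : ℝ :=
  (I.L.card : ℝ) * (fiber I.R I.C x).card * (cofiber I.R I.L c).card *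
    (fiber K.S I.C' (dir x y)).card * (I.third K.θ' x y c').card

variable {K}

lemma sum_norm_sq_psi' (φ : ℕ → Phases) (r₁ r₂ : ℕ) : ∑ s, ‖K.psi' φ r₁ r₂ s‖ ^ 2 = 1 := by
  rw [psi', sum_norm_sq_run K.isUnitary (tupleSamp_actsOn φ r₁ r₂), zeroState_eq]
  simp [ite_pow, apply_ite]

lemma norm_psi'_le_one (φ : ℕ → Phases) (r₁ r₂ : ℕ) (s : Cfg w) : ‖K.psi' φ r₁ r₂ s‖ ≤ 1 := by
  rw [← sq_le_one_iff₀ (norm_nonneg _), ← sum_norm_sq_psi' (K := K) φ r₁ r₂]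
  exact Finset.single_le_sum (f := fun s => ‖K.psi' φ r₁ r₂ s‖ ^ 2)
    (fun _ _ => sq_nonneg _) (Finset.mem_univ s)

lemma Full.third_pos {s : Cfg w} {x c y c' z : E d} (h : K.Full s x c y c' z)
    (hθ' : Near K.θ' (dir x y) z) : 0 < (I.third K.θ' x y c').card :=
  Finset.card_pos.2 ⟨z, mem_third.2 ⟨h.common'.1, hθ', h.common'.2⟩⟩

lemma Full.weightS_pos {s : Cfg w} {x c y c' z : E d} (h : K.Full s x c y c' z)
    (hθ' : Near K.θ' (dir x y) z) : 0 < K.weightS x c y c' := by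
  have h1 := Finset.card_pos.2 ⟨x, h.sampled.x_mem⟩
  have h2 := Finset.card_pos.2 ⟨c, h.sampled.c_mem⟩
  have h3 := Finset.card_pos.2 ⟨y, h.sampled.y_mem⟩
  have h4 := Finset.card_pos.2 ⟨c', h.c'_mem⟩
  have h5 := h.third_pos hθ'
  unfold weightS
  positivity

/-- The amplitude of a solution tuple after fixed-point amplification. -/
lemma Full.exists_apply_eq {s : Cfg w} {x c y c' z : E d} (h : K.Full s x c y c' z)
    (hθ : Near K.θ x y) (hθ' : Near K.θ' (dir x y) z) (hF₁ : s .F₁ = 1) (hF : s .F = 1)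
    (hp : 0 < K.p) {φ : ℕ → Phases} {r₁ r₂ : ℕ} {η : ℝ} (h1 : FixedPoint (φ r₁) r₁ K.p η)
    (h2 : FixedPoint (φ r₂) r₂ (1 / √(max 1 (I.maxBucket : ℝ))) η) :
    ∃ a : ℂ, ‖a - 1‖ ≤ 2 * η ∧ ‖a‖ ≤ 1 ∧
      K.psi' φ r₁ r₂ s = a * ((1 / √(K.p ^ 2 * K.weightS x c y c') : ℝ) : ℂ) := by
  have ht : 0 < ((I.third K.θ' x y c').card : ℝ) := by exact_mod_cast h.third_pos hθ'
  have hb : 0 < ((cofiber I.R' I.L c').card : ℝ) := by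
    exact_mod_cast Finset.card_pos.2 ⟨z, h.z_mem⟩
  have htb : ((I.third K.θ' x y c').card : ℝ) ≤ (cofiber I.R' I.L c').card := by
    exact_mod_cast Finset.card_le_card fun v hv => mem_cofiber.2
      ⟨(mem_third.1 hv).1, (mem_fiber.1 (mem_common'.1 (mem_third.1 hv).2.2).2).2⟩
  have hbm : ((cofiber I.R' I.L c').card : ℝ) ≤ max 1 (I.maxBucket : ℝ) := by
    refine le_trans ?_ (le_max_right _ _)
    exact_mod_cast Finset.le_sup (f := fun c' => (cofiber I.R' I.L c').card)
      (mem_fiber.1 h.c'_mem).1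
  have ht1 : (1 : ℝ) ≤ (I.third K.θ' x y c').card := by exact_mod_cast h.third_pos hθ'
  set t : ℝ := ((I.third K.θ' x y c').card : ℝ) with ht_def
  set b : ℝ := ((cofiber I.R' I.L c').card : ℝ) with hb_def
  set l := √(t / b) with hl
  have hl2 : l ^ 2 = t / b := Real.sq_sqrt (by positivity)
  have hl0 : 0 < l := Real.sqrt_pos.2 (by positivity)
  have hl1 : l ≤ 1 := Real.sqrt_le_one.2 ((div_le_one hb).2 htb)
  have hlm : 1 / √(max 1 (I.maxBucket : ℝ)) ≤ l := by
    have e0 : 1 / √(max 1 (I.maxBucket : ℝ)) = √(1 / max 1 (I.maxBucket : ℝ)) := by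
      rw [Real.sqrt_div zero_le_one, Real.sqrt_one]
    rw [e0]
    exact Real.sqrt_le_sqrt (div_le_div₀ ht.le ht1 hb hbm)
  have e1 := h1 K.p le_rfl (K.p_le_one hp)
  have e2 := h2 l hlm hl1
  have n1 := norm_mul_goodAmp_le_one (φ r₁) r₁ hp.le (K.p_le_one hp)
  have n2 := norm_mul_goodAmp_le_one (φ r₂) r₂ hl0.le hl1
  refine ⟨_, norm_mul_sub_one_le e1 e2 n2, ?_, ?_⟩
  · rw [norm_mul]
    exact mul_le_one₀ n1 (norm_nonneg _) n2
  rw [h.apply hθ hθ' hF₁ hF, K.acceptProb_g1 (K.nonempty_of_p_pos hp), ← hl2]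
  have hw : K.p ^ 2 * K.weightS x c y c' = K.p ^ 2 * (l ^ 2 * K.size x c y c') := by
    rw [hl2, weightS, size, ← ht_def, ← hb_def]
    field_simp
  rw [hw, Real.sqrt_mul (by positivity), Real.sqrt_mul (by positivity), Real.sqrt_sq hp.le,
    Real.sqrt_sq hl0.le]
  have hpc : (K.p : ℂ) ≠ 0 := by exact_mod_cast hp.ne'
  have hlc : (l : ℂ) ≠ 0 := by exact_mod_cast hl0.ne'
  push_cast
  rw [one_div, one_div, mul_inv, mul_inv]
  field_simp

/-- A basis state that represents a solution with a witness in `S` is one that the sampler finds. -/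
lemma full_of_represents {s : Cfg w} {x c y c' z : E d}
    (h : Represents e K.D K.D' s x c y c' z) (hT : (x, y, z) ∈ I.T K.θ K.θ')
    (hc : c ∈ I.common x y) (hc' : c' ∈ I.common' (dir x y) z) (hS : (dir x y, c') ∈ K.S) :
    K.Full s x c y c' z := by
  obtain ⟨hX, hC, hY, hC', hZ, hF, hF₁, hG, hN, h1, h2, h3, h4⟩ := h
  obtain ⟨hx, hy, hz, -⟩ := hT
  have hcy := mem_fiber.1 (mem_common.1 hc).2
  have hcz := mem_fiber.1 (mem_common'.1 hc').2
  exact ⟨⟨hx, (mem_common.1 hc).1, mem_cofiber.2 ⟨hy, hcy.2⟩, hX, hC, hY, hN, h1, h2, h3⟩,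
    mem_fiber.2 ⟨hcz.1, hS⟩, mem_cofiber.2 ⟨hz, hcz.2⟩, hC', hZ, h4, hG⟩

lemma exists_represents {x y z c c' : E d} (hT : (x, y, z) ∈ I.T K.θ K.θ')
    (hc : c ∈ I.common x y) (hc' : c' ∈ I.common' (dir x y) z) :
    ∃ s, Represents e K.D K.D' s x c y c' z := by
  obtain ⟨hx, hy, hz, -⟩ := hT
  have hcx := (mem_common.1 hc).1
  have hcy := mem_fiber.1 (mem_common.1 hc).2
  have hcz := mem_fiber.1 (mem_common'.1 hc').2
  obtain ⟨i1, h1⟩ := K.hD.1.exists_pointsTo (Finset.mem_image_of_mem e.code hx)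
  obtain ⟨i2, h2⟩ := (K.hD.2.1 x hx).exists_pointsTo (Finset.mem_image_of_mem e.code hcx)
  obtain ⟨i3, h3⟩ := (K.hD.2.2.2.1 c hcy.1).exists_pointsTo
    (Finset.mem_image_of_mem e.code (mem_cofiber.2 ⟨hy, hcy.2⟩))
  obtain ⟨i4, h4⟩ := (K.hD'.2.2.2.1 c' hcz.1).exists_pointsTo
    (Finset.mem_image_of_mem e.code (mem_cofiber.2 ⟨hz, hcz.2⟩))
  exact ⟨fun
    | .X => e.code x | .C => e.code c | .Y => e.code y | .C' => e.code c' | .Z => e.code z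
    | .IX => i1 | .IC => i2 | .IY => i3 | .IZ => i4 | .N => 0 | .F₁ => 1 | .F => 1 | .G => 0,
    rfl, rfl, rfl, rfl, rfl, rfl, rfl, rfl, rfl, h1, h2, h3, h4⟩

/-- A tuple and its flags determine the basis state, because the stored arrays have no
repetitions. -/
lemma Full.ext {s t : Cfg w} {x c y c' z : E d} (hs : K.Full s x c y c' z)
    (ht : K.Full t x c y c' z) (hF : s .F = t .F) (hF₁ : s .F₁ = t .F₁) : s = t := by
  funext r
  cases r
  · rw [hs.sampled.hX, ht.sampled.hX]
  · rw [hs.sampled.hC, ht.sampled.hC]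
  · rw [hs.sampled.hY, ht.sampled.hY]
  · rw [hs.hC', ht.hC']
  · rw [hs.hZ, ht.hZ]
  · exact K.hD.1.pointsTo_inj hs.sampled.hIX ht.sampled.hIX
  · exact (K.hD.2.1 x hs.sampled.x_mem).pointsTo_inj hs.sampled.hIC ht.sampled.hIC
  · exact (K.hD.2.2.2.1 c (mem_fiber.1 hs.sampled.c_mem).1).pointsTo_inj hs.sampled.hIY
      ht.sampled.hIY
  · exact (K.hD'.2.2.2.1 c' (mem_fiber.1 hs.c'_mem).1).pointsTo_inj hs.hIZ ht.hIZ
  · rw [hs.sampled.hN, ht.sampled.hN]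
  · exact hF₁
  · exact hF
  · rw [hs.hG, ht.hG]

lemma mem_S_of_small {u c' : E d} (hu : I.Small u) (hc : c' ∈ fiber I.R' I.C' u) :
    (u, c') ∈ K.S := by
  rw [← K.hS.2 u hu] at hc
  exact (mem_fiber.1 hc).2

lemma weightS_eq {x y : E d} (hu : I.Small (dir x y)) (c c' : E d) :
    K.weightS x c y c' = I.weight K.θ' x c y c' := by
  rw [weightS, SearchInput.weight, K.hS.2 _ hu]

/-- The amplitudes of the solution tuples. -/
lemma norm_psi'_sub_le (hp : 0 < K.p) {φ : ℕ → Phases} {r₁ r₂ : ℕ} {η : ℝ} (hη : η ≤ 1 / 4)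
    (h1 : FixedPoint (φ r₁) r₁ K.p η) (h2 : FixedPoint (φ r₂) r₂ (1 / √(max 1 (I.maxBucket : ℝ))) η)
    {x y z c c' : E d} (hT : (x, y, z) ∈ I.T K.θ K.θ') (hu : I.Small (dir x y))
    (hc : c ∈ I.common x y) (hc' : c' ∈ I.common' (dir x y) z) {s : Cfg w}
    (hs : Represents e K.D K.D' s x c y c' z) :
    ‖K.psi' φ r₁ r₂ s - ((1 / √(K.p ^ 2 * I.weight K.θ' x c y c') : ℝ) : ℂ)‖ ≤ 4 * η := by
  have hfull := full_of_represents hs hT hc hc' (mem_S_of_small hu (mem_common'.1 hc').1)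
  obtain ⟨a, ha, -, hpsi⟩ := hfull.exists_apply_eq hT.2.2.2.1 hT.2.2.2.2.1
    hs.2.2.2.2.2.2.1 hs.2.2.2.2.2.1 hp h1 h2
  rw [weightS_eq hu] at hpsi
  have hn := norm_psi'_le_one (K := K) φ r₁ r₂ s
  set q : ℝ := 1 / √(K.p ^ 2 * I.weight K.θ' x c y c')
  have hq : 0 ≤ q := by positivity
  rw [hpsi, norm_mul, Complex.norm_real, Real.norm_eq_abs, abs_of_nonneg hq] at hn
  have ha' := one_sub_le_norm ha
  have hq2 : q ≤ 2 := by nlinarith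
  have e1 : K.psi' φ r₁ r₂ s - (q : ℂ) = (a - 1) * (q : ℂ) := by rw [hpsi]; ring
  rw [e1, norm_mul, Complex.norm_real, Real.norm_eq_abs, abs_of_nonneg hq]
  nlinarith [norm_nonneg (a - 1)]

/-- On the support of `ψ'`, a register content that is a solution has flag `1`. -/
lemma flag_eq_one_of_mem_T {φ : ℕ → Phases} {r₁ r₂ : ℕ} {s : Cfg w} (hs : K.psi' φ r₁ r₂ s ≠ 0)
    (h : ∃ t ∈ I.T K.θ K.θ', s .X = e.code t.1 ∧ s .Y = e.code t.2.1 ∧ s .Z = e.code t.2.2) :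
    s .F = 1 := by
  rw [psi'_apply] at hs
  obtain ⟨t, hT, hX, hY, hZ⟩ := h
  by_cases hc : s .F = K.g2 s ∧ s .N = 0 ∧ s .Z = K.D'.inv.entry (s .C') (s .IZ)
  · rw [hc.1]
    exact (g2_eq_one_iff hT.1 hT.2.1 hT.2.2.1 hX hY hZ).2 hT.2.2.2.2.1
  · rw [if_neg hc] at hs
    exact absurd rfl hs

/-- A tuple with flag `1` is a solution, unless the check of the collision failed. -/
lemma exists_mem_T {φ : ℕ → Phases} {r₁ r₂ : ℕ} {s : Cfg w} (hs : K.psi' φ r₁ r₂ s ≠ 0)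
    (hF : s .F = 1) (hF₁ : s .F₁ = 1) (hL : I.L.Nonempty) :
    ∃ x c y c' z, K.Full s x c y c' z ∧ (x, y, z) ∈ I.T K.θ K.θ' := by
  obtain ⟨x, c, y, c', z, hfull, hθ', h1⟩ := exists_full_of_psi'_ne_zero hs hF hL
  have hx := hfull.sampled.x_mem
  have hy := hfull.sampled.common.1
  refine ⟨x, c, y, c', z, hfull, hx, hy, hfull.common'.1, ?_, hθ',
    ⟨c, hfull.sampled.common.2⟩, ⟨c', hfull.common'.2⟩⟩
  exact (g1_eq_one_iff hx hy hfull.sampled.hX hfull.sampled.hY).1 (h1 ▸ hF₁)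

open Classical in
/-- The weight of the tuples whose collision check failed is small after amplification. -/
lemma sum_failed_le (hp : 0 < K.p) {φ : ℕ → Phases} {r₁ : ℕ} (r₂ : ℕ) {η : ℝ} (hη : η ≤ 1)
    (h1 : FixedPoint (φ r₁) r₁ K.p η) :
    ∑ s, (if s .F₁ ≠ 1 then ‖K.psi' φ r₁ r₂ s‖ ^ 2 else 0) ≤ 2 * η := by
  have hacc := K.acceptProb_g1 (K.nonempty_of_p_pos hp)
  have hP : Circuit.ActsOn {.N, .IZ, .Z, .F, .C'}
      ([.dec .X .Y .C' false] ++ thirdSamp φ r₂) :=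
    (dec_actsOn.mono (by decide)).append ((thirdSamp_actsOn φ r₂).mono (by decide))
  have e0 : K.psi' φ r₁ r₂ =
      Circuit.run K.M ([.dec .X .Y .C' false] ++ thirdSamp φ r₂) (K.psi1 φ r₁) := by
    rw [psi', tupleSamp_eq, List.append_assoc, Circuit.run_append]
    rfl
  have hq : IndepOf {.N, .IZ, .Z, .F, .C'} fun s : Cfg w => s .F₁ ≠ 1 := fun s r hr v => by
    change (Function.update s r v .F₁ ≠ 1) = (s .F₁ ≠ 1)
    rw [Function.update_of_ne (by revert hr; revert r; decide)]
  rw [e0, sum_norm_sq_run_of_indep K.isUnitary hP _ hq]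
  set b := badAmp (φ r₁) r₁ ((K.p ^ 2 : ℝ) : ℂ) with hb
  have hterm : ∀ s, (if s .F₁ ≠ 1 then ‖K.psi1 φ r₁ s‖ ^ 2 else 0) ≤
      ‖b‖ ^ 2 * if K.g1 s ≠ 1 then ‖xorOn .F₁ K.g1 K.psi s‖ ^ 2 else 0 := by
    intro s
    by_cases hx : xorOn .F₁ K.g1 K.psi s = 0
    · rw [psi1_apply, hx]
      simp
    · have := eq_of_xorOn_ne_zero (K.psi_zeroOn.mono (by decide)) hx
      rw [psi1_apply, hacc, this]
      by_cases hg : K.g1 s = 1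
      · simp [hg]
      · rw [if_pos hg, if_neg hg, if_pos hg, norm_mul, mul_pow]
  have hcheck : Circuit.ActsOn {.F₁} [.testXY .X .Y .F₁] := fun i hi => by
    rw [List.mem_singleton.1 hi]
    exact ⟨by simp [Instr.WellFormed], by decide⟩
  have hq2 : IndepOf {.F₁} fun s => K.g1 s ≠ 1 := fun s r hr v => by
    change (K.g1 (Function.update s r v) ≠ 1) = (K.g1 s ≠ 1)
    rw [K.g1_indep s r hr v]
  have hsum : ∑ s, (if K.g1 s ≠ 1 then ‖xorOn .F₁ K.g1 K.psi s‖ ^ 2 else 0) = 1 - K.p ^ 2 := by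
    have h3 := sum_norm_sq_run_of_indep K.isUnitary hcheck _ hq2 K.psi
    have h4 : ∑ s, (if K.g1 s ≠ 1 then ‖K.psi s‖ ^ 2 else 0) = 1 - K.p ^ 2 := by
      rw [← hacc, ← K.sum_norm_sq_psi, acceptProb, ← Finset.sum_sub_distrib]
      exact Finset.sum_congr rfl fun s _ => by
        by_cases h : K.g1 s = 1
        · rw [if_neg (not_not.2 h), if_pos h, sub_self]
        · rw [if_pos h, if_neg h, sub_zero]
    exact Eq.trans h3 h4
  refine (Finset.sum_le_sum fun s _ => hterm s).trans ?_
  rw [← Finset.mul_sum, hsum]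
  have hamp := amp_norm (φ r₁) r₁ (K.p ^ 2)
  rw [← hb] at hamp
  have h5 := one_sub_le_norm (h1 K.p le_rfl (K.p_le_one hp))
  rw [norm_mul, Complex.norm_real, Real.norm_eq_abs, abs_of_pos hp] at h5
  have h6 : (1 - η) ^ 2 ≤ (K.p * ‖goodAmp (φ r₁) r₁ ((K.p ^ 2 : ℝ) : ℂ)‖) ^ 2 :=
    pow_le_pow_left₀ (by linarith) h5 2
  nlinarith [sq_nonneg η]

open Classical in
/-- The probability of flag `1` in the tuple state is the probability of a solution, up to tuples
whose collision check failed. -/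
lemma acceptProb_psi'_bounds (hp : 0 < K.p) {φ : ℕ → Phases} {r₁ : ℕ} (r₂ : ℕ) {η : ℝ}
    (hη : η ≤ 1) (h1 : FixedPoint (φ r₁) r₁ K.p η) :
    K.p' φ r₁ r₂ ^ 2 ≤ acceptProb (fun s => s .F) (K.psi' φ r₁ r₂) ∧
      acceptProb (fun s => s .F) (K.psi' φ r₁ r₂) ≤ K.p' φ r₁ r₂ ^ 2 + 2 * η := by
  rw [p', norm_projTriples_sq, acceptProb]
  constructor
  · refine Finset.sum_le_sum fun s _ => ?_
    by_cases hs : K.psi' φ r₁ r₂ s = 0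
    · simp [hs]
    by_cases hm : ∃ t ∈ I.T K.θ K.θ', s .X = e.code t.1 ∧ s .Y = e.code t.2.1 ∧ s .Z = e.code t.2.2
    · rw [if_pos hm, if_pos (flag_eq_one_of_mem_T hs hm)]
    · rw [if_neg hm]
      split_ifs <;> positivity
  · refine le_trans ?_ (add_le_add_right (sum_failed_le hp r₂ hη h1) _)
    rw [← Finset.sum_add_distrib]
    refine Finset.sum_le_sum fun s _ => ?_
    by_cases hs : K.psi' φ r₁ r₂ s = 0
    · simp [hs]
    by_cases hF : s .F = 1
    · by_cases hF₁ : s .F₁ = 1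
      · obtain ⟨x, c, y, c', z, hfull, hT⟩ := exists_mem_T hs hF hF₁ (K.nonempty_of_p_pos hp)
        have hm : ∃ t ∈ I.T K.θ K.θ',
            s .X = e.code t.1 ∧ s .Y = e.code t.2.1 ∧ s .Z = e.code t.2.2 :=
          ⟨_, hT, hfull.sampled.hX, hfull.sampled.hY, hfull.hZ⟩
        rw [if_pos hF, if_pos hm, if_neg (not_not.2 hF₁), add_zero]
      · rw [if_pos hF, if_pos hF₁]
        have : (0 : ℝ) ≤ if ∃ t ∈ I.T K.θ K.θ', s .X = e.code t.1 ∧ s .Y = e.code t.2.1 ∧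
            s .Z = e.code t.2.2 then ‖K.psi' φ r₁ r₂ s‖ ^ 2 else 0 := by
          split_ifs <;> positivity
        linarith
    · rw [if_neg hF]
      split_ifs <;> positivity

lemma weightS_le {N : ℕ} (hL : I.L.card ≤ N) (hC : I.C.card ≤ N) (hC' : I.C'.card ≤ N)
    (x c y c' : E d) : K.weightS x c y c' ≤ (N : ℝ) ^ 5 := by
  classical
  have hf : ∀ (R : Set (E d × E d)) (A : Finset (E d)) v, A.card ≤ N →
      (((fiber R A v).card : ℕ) : ℝ) ≤ N := fun R A v h => by
    exact_mod_cast (Finset.card_le_card fun a ha => (mem_fiber.1 ha).1).trans h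
  have h1 : ((I.L.card : ℕ) : ℝ) ≤ N := by exact_mod_cast hL
  have h2 := hf I.R I.C x hC
  have h3 : (((cofiber I.R I.L c).card : ℕ) : ℝ) ≤ N := by
    exact_mod_cast (Finset.card_le_card fun a ha => (mem_cofiber.1 ha).1).trans hL
  have h4 := hf K.S I.C' (dir x y) hC'
  have h5 : (((I.third K.θ' x y c').card : ℕ) : ℝ) ≤ N := by
    exact_mod_cast (Finset.card_le_card fun a ha => (mem_third.1 ha).1).trans hL
  unfold weightS
  calc _ ≤ (N : ℝ) * N * N * N * N := by gcongr
    _ = _ := by ring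

/-- A single solution with a witness in `S` already bounds `p'` from below. -/
lemma p'_lower (hp : 0 < K.p) {φ : ℕ → Phases} {r₁ r₂ : ℕ} {η : ℝ} (hη : η ≤ 1 / 4)
    (h1 : FixedPoint (φ r₁) r₁ K.p η) (h2 : FixedPoint (φ r₂) r₂ (1 / √(max 1 (I.maxBucket : ℝ))) η)
    {N : ℕ} (hL : I.L.card ≤ N) (hC : I.C.card ≤ N) (hC' : I.C'.card ≤ N)
    (hT : (I.TWitnessed K.θ K.θ' K.S).Nonempty) :
    1 / (4 * (N : ℝ) ^ 5) ≤ K.p' φ r₁ r₂ ^ 2 := by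
  classical
  obtain ⟨⟨x, y, z⟩, hT, c', hc', hS⟩ := hT
  obtain ⟨c, hc⟩ := hT.2.2.2.2.2.1
  obtain ⟨s, hs⟩ := exists_represents hT hc hc'
  have hfull := full_of_represents hs hT hc hc' hS
  obtain ⟨a, ha, -, hpsi⟩ := hfull.exists_apply_eq hT.2.2.2.1 hT.2.2.2.2.1
    hs.2.2.2.2.2.2.1 hs.2.2.2.2.2.1 hp h1 h2
  have hw := hfull.weightS_pos hT.2.2.2.2.1
  have hwN := weightS_le (K := K) hL hC hC' x c y c'
  have ha' : 1 / 2 ≤ ‖a‖ := by linarith [one_sub_le_norm ha]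
  have hp1 := K.p_le_one hp
  have hle : ‖K.psi' φ r₁ r₂ s‖ ^ 2 ≤ K.p' φ r₁ r₂ ^ 2 := by
    rw [p', norm_projTriples_sq]
    refine le_trans ?_ (Finset.single_le_sum (fun s _ => ?_) (Finset.mem_univ s))
    · rw [if_pos ⟨_, hT, hs.1, hs.2.2.1, hs.2.2.2.2.1⟩]
    · split_ifs <;> positivity
  refine le_trans ?_ hle
  rw [hpsi, norm_mul, mul_pow, Complex.norm_real, Real.norm_eq_abs, sq_abs, div_pow, one_pow,
    Real.sq_sqrt (by positivity)]
  have h3 : K.p ^ 2 * K.weightS x c y c' ≤ (N : ℝ) ^ 5 := by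
    calc _ ≤ 1 * (N : ℝ) ^ 5 := by
          gcongr
          exact pow_le_one₀ hp.le hp1
      _ = _ := one_mul _
  calc 1 / (4 * (N : ℝ) ^ 5) = (1 / 2) ^ 2 * (1 / (N : ℝ) ^ 5) := by
        rw [one_div, mul_inv]; norm_num
    _ ≤ ‖a‖ ^ 2 * (1 / (K.p ^ 2 * K.weightS x c y c')) := by gcongr

open Classical in
/-- The probability of a solution triple in the tuple state is a sum over its witnesses. -/
lemma outputProb_psi' {φ : ℕ → Phases} {r₁ r₂ : ℕ} (hp : 0 < K.p) {x y z : E d}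
    (hT : (x, y, z) ∈ I.T K.θ K.θ') (hu : I.Small (dir x y)) :
    ∃ f : E d → E d → Cfg w,
      (∀ c ∈ I.common x y, ∀ c' ∈ I.common' (dir x y) z,
        Represents e K.D K.D' (f c c') x c y c' z) ∧
      outputProb e {(x, y, z)} (K.psi' φ r₁ r₂) =
        ∑ c ∈ I.common x y, ∑ c' ∈ I.common' (dir x y) z, ‖K.psi' φ r₁ r₂ (f c c')‖ ^ 2 := by
  have hex : ∀ c c', ∃ s, c ∈ I.common x y → c' ∈ I.common' (dir x y) z →
      Represents e K.D K.D' s x c y c' z := by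
    intro c c'
    by_cases h : c ∈ I.common x y ∧ c' ∈ I.common' (dir x y) z
    · obtain ⟨s, hs⟩ := exists_represents hT h.1 h.2
      exact ⟨s, fun _ _ => hs⟩
    · exact ⟨fun _ => 0, fun h1 h2 => absurd ⟨h1, h2⟩ h⟩
  choose f hf using hex
  refine ⟨f, fun c hc c' hc' => hf c c' hc hc', ?_⟩
  have hcC : ∀ {c}, c ∈ I.common x y → c ∈ I.C := fun h => (mem_fiber.1 (mem_common.1 h).1).1
  have hcC' : ∀ {c'}, c' ∈ I.common' (dir x y) z → c' ∈ I.C' := fun h =>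
    (mem_fiber.1 (mem_common'.1 h).1).1
  have hinj : Set.InjOn (fun q : E d × E d => f q.1 q.2)
      (I.common x y ×ˢ I.common' (dir x y) z : Finset (E d × E d)) := by
    rintro ⟨c, c'⟩ h ⟨b, b'⟩ h' heq
    rw [Finset.mem_coe, Finset.mem_product] at h h'
    have r1 := hf c c' h.1 h.2
    have r2 := hf b b' h'.1 h'.2
    simp only at heq
    rw [heq] at r1
    exact Prod.ext (e.injOn_C (hcC h.1) (hcC h'.1) (r1.2.1.symm.trans r2.2.1))
      (e.injOn_C' (hcC' h.2) (hcC' h'.2) (r1.2.2.2.1.symm.trans r2.2.2.2.1))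
  rw [outputProb, norm_projTriples_sq, ← Finset.sum_product',
    ← Finset.sum_subset (Finset.subset_univ ((I.common x y ×ˢ I.common' (dir x y) z).image
      fun q : E d × E d => f q.1 q.2)), Finset.sum_image hinj]
  · refine Finset.sum_congr rfl fun q hq => ?_
    have r1 := hf q.1 q.2 (Finset.mem_product.1 hq).1 (Finset.mem_product.1 hq).2
    rw [if_pos ⟨_, rfl, r1.1, r1.2.2.1, r1.2.2.2.2.1⟩]
  · intro s _ hs
    by_contra hne
    apply hs
    split_ifs at hne with hm
    swap
    · exact absurd rfl hne
    have hs0 : K.psi' φ r₁ r₂ s ≠ 0 := fun h => hne (by simp [h])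
    obtain ⟨t, ht, hX, hY, hZ⟩ := hm
    rw [Set.mem_singleton_iff] at ht
    subst ht
    have hF := flag_eq_one_of_mem_T hs0 ⟨_, hT, hX, hY, hZ⟩
    obtain ⟨x', c, y', c', z', hfull, -, hF₁⟩ :=
      exists_full_of_psi'_ne_zero hs0 hF (K.nonempty_of_p_pos hp)
    have hxx : x' = x := e.injOn_L hfull.sampled.x_mem hT.1 (hfull.sampled.hX.symm.trans hX)
    have hyy : y' = y := e.injOn_L hfull.sampled.common.1 hT.2.1 (hfull.sampled.hY.symm.trans hY)
    have hzz : z' = z := e.injOn_L hfull.common'.1 hT.2.2.1 (hfull.hZ.symm.trans hZ)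
    subst hxx hyy hzz
    have hF₁' : s .F₁ = 1 := hF₁.trans ((g1_eq_one_iff hT.1 hT.2.1 hX hY).2 hT.2.2.2.1)
    have hc := hfull.sampled.common.2
    have hc' := hfull.common'.2
    have hr := hf c c' hc hc'
    have hfull2 := full_of_represents hr hT hc hc' (mem_S_of_small hu (mem_common'.1 hc').1)
    refine Finset.mem_image.2 ⟨(c, c'), Finset.mem_product.2 ⟨hc, hc'⟩, ?_⟩
    exact hfull2.ext hfull (hr.2.2.2.2.2.1.trans hF.symm) (hr.2.2.2.2.2.2.1.trans hF₁'.symm)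

variable (K)

/-- The state before the final measurement. -/
def out (φ : ℕ → Phases) (r₁ r₂ r₃ : ℕ) : State w :=
  Circuit.run K.M (solutionSearch φ r₁ r₂ r₃) (zeroState w)

variable {K}

lemma out_apply (φ : ℕ → Phases) (r₁ r₂ r₃ : ℕ) (s : Cfg w) : K.out φ r₁ r₂ r₃ s =
    (if s .F = 1 then goodAmp (φ r₃) r₃ (acceptProb (fun s => s .F) (K.psi' φ r₁ r₂))
      else badAmp (φ r₃) r₃ (acceptProb (fun s => s .F) (K.psi' φ r₁ r₂))) *
      xorOn .G (fun s => s .F) (K.psi' φ r₁ r₂) s := by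
  refine run_amplify K.isUnitary (g := fun s => s .F) (tupleSamp_actsOn φ r₁ r₂) (by decide)
    ?_ (fun _ => rfl) (fun _ => rfl) (φ r₃) r₃ (fun _ _ => rfl) s
  intro s r hr v
  rw [Finset.mem_singleton.1 hr]
  rfl

open Classical in
/-- The last amplification rescales the probabilities of all solutions by the same factor. -/
lemma outputProb_out (φ : ℕ → Phases) (r₁ r₂ r₃ : ℕ) {A : Set (E d × E d × E d)}
    (hA : A ⊆ I.T K.θ K.θ') : outputProb e A (K.out φ r₁ r₂ r₃) =
      ‖goodAmp (φ r₃) r₃ (acceptProb (fun s => s .F) (K.psi' φ r₁ r₂))‖ ^ 2 *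
        outputProb e A (K.psi' φ r₁ r₂) := by
  have hcheck : Circuit.ActsOn {.G} [.copy .F .G] := fun i hi => by
    rw [List.mem_singleton.1 hi]
    exact ⟨by simp [Instr.WellFormed], by decide⟩
  have hq : IndepOf {.G} fun s : Cfg w => ∃ t ∈ A, s .X = e.code t.1 ∧ s .Y = e.code t.2.1 ∧
      s .Z = e.code t.2.2 := fun s r hr v => by
    rw [Finset.mem_singleton.1 hr]
    rfl
  have h := sum_norm_sq_run_of_indep K.isUnitary hcheck _ hq (K.psi' φ r₁ r₂)
  rw [outputProb, outputProb, norm_projTriples_sq, norm_projTriples_sq, ← h, Finset.mul_sum]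
  refine Finset.sum_congr rfl fun s _ => ?_
  change _ = _ * if _ then ‖xorOn .G (fun s => s .F) (K.psi' φ r₁ r₂) s‖ ^ 2 else 0
  by_cases hm : ∃ t ∈ A, s .X = e.code t.1 ∧ s .Y = e.code t.2.1 ∧ s .Z = e.code t.2.2
  · rw [if_pos hm, if_pos hm, out_apply]
    by_cases hx : xorOn .G (fun s => s .F) (K.psi' φ r₁ r₂) s = 0
    · rw [hx]; simp
    · have hF : s .F = 1 := by
        rw [xorOn_apply] at hx
        have := flag_eq_one_of_mem_T hx (by
          obtain ⟨t, ht, h1, h2, h3⟩ := hm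
          exact ⟨t, hA ht, h1, h2, h3⟩)
        rwa [Function.update_of_ne (by decide)] at this
      rw [if_pos hF, norm_mul, mul_pow]
  · rw [if_neg hm, if_neg hm, mul_zero]

end Setting

/-! ### Success probability and cost of the search -/

namespace Setting

variable {d w : ℕ} {I : SearchInput d} {e : Encoding I w} (K : Setting I e)

lemma p_pos (hT : (I.T K.θ K.θ').Nonempty) : 0 < K.p := by
  classical
  obtain ⟨⟨x, y, z⟩, hT⟩ := hT
  obtain ⟨c, hc⟩ := hT.2.2.2.2.2.1
  obtain ⟨c', hc'⟩ := hT.2.2.2.2.2.2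
  obtain ⟨s, hX, hC, hY, -, -, -, -, -, hN, h1, h2, h3, -⟩ := exists_represents hT hc hc'
  set t := zeroOn {.C', .Z, .IZ, .F₁, .F, .G} s with ht
  have hcy := mem_fiber.1 (mem_common.1 hc).2
  have hs : K.Sampled s x c y :=
    ⟨hT.1, (mem_common.1 hc).1, mem_cofiber.2 ⟨hT.2.1, hcy.2⟩, hX, hC, hY, hN, h1, h2, h3⟩
  have hts : ∀ r ∈ sampRegs, t r = s r := fun r hr =>
    zeroOn_of_notMem (by revert hr; revert r; decide) s
  have hrest : RestZero t := by simp [RestZero, ht, zeroOn]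
  have happ := (hs.congr hts).apply hrest
  have c1 := Finset.card_pos.2 ⟨x, hs.x_mem⟩
  have c2 := Finset.card_pos.2 ⟨c, hs.c_mem⟩
  have c3 := Finset.card_pos.2 ⟨y, hs.y_mem⟩
  rw [p, norm_pos_iff]
  intro h0
  have h1 : projPairs e (I.M1 K.θ) K.psi t = 0 := by rw [h0]; rfl
  rw [projPairs] at h1
  simp only at h1
  rw [if_pos ⟨(x, y), ⟨hT.1, hT.2.1, hT.2.2.2.1, c, hc⟩, (hts .X (by decide)).trans hX,
    (hts .Y (by decide)).trans hY⟩, happ] at h1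
  have h2 : (1 / √((I.L.card : ℝ) * (fiber I.R I.C x).card * (cofiber I.R I.L c).card) : ℝ) ≠
      0 := by positivity
  exact h2 (by exact_mod_cast h1)

variable {K}

/-- The factor by which the last amplification multiplies the probabilities of the solutions is
`1 / p'²`, up to a small relative error. -/
lemma normSq_goodAmp_bounds (hp : 0 < K.p) {φ : ℕ → Phases} {r₁ r₂ r₃ : ℕ} {η : ℝ} (hη0 : 0 ≤ η)
    (hη : η ≤ 1) (h1 : FixedPoint (φ r₁) r₁ K.p η) (hp' : 0 < K.p' φ r₁ r₂)
    (h3 : FixedPoint (φ r₃) r₃ (K.p' φ r₁ r₂) η) :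
    1 - 4 * η / K.p' φ r₁ r₂ ^ 2 ≤
      ‖goodAmp (φ r₃) r₃ (acceptProb (fun s => s .F) (K.psi' φ r₁ r₂))‖ ^ 2 * K.p' φ r₁ r₂ ^ 2 ∧
    ‖goodAmp (φ r₃) r₃ (acceptProb (fun s => s .F) (K.psi' φ r₁ r₂))‖ ^ 2 * K.p' φ r₁ r₂ ^ 2 ≤
      1 := by
  obtain ⟨b1, b2⟩ := acceptProb_psi'_bounds hp r₂ hη h1
  have b3 := acceptProb_le_one (fun s => s .F) (sum_norm_sq_psi' (K := K) φ r₁ r₂)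
  set q := K.p' φ r₁ r₂ with hq
  set x2 := acceptProb (fun s => s .F) (K.psi' φ r₁ r₂) with hx2
  have hx2pos : 0 < x2 := lt_of_lt_of_le (by positivity) b1
  have hx : √x2 ^ 2 = x2 := Real.sq_sqrt hx2pos.le
  have hqx : q ≤ √x2 := Real.le_sqrt_of_sq_le b1
  have hx1 : √x2 ≤ 1 := Real.sqrt_le_one.2 b3
  have e1 := one_sub_le_norm (h3 _ hqx hx1)
  have e2 := norm_mul_goodAmp_le_one (φ r₃) r₃ (Real.sqrt_nonneg x2) hx1
  rw [hx, norm_mul, Complex.norm_real, Real.norm_eq_abs, abs_of_nonneg (Real.sqrt_nonneg _)]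
    at e1 e2
  set g := ‖goodAmp (φ r₃) r₃ (x2 : ℂ)‖ with hg
  have hg0 : 0 ≤ g := norm_nonneg _
  have e3 : x2 * g ^ 2 ≤ 1 := by
    rw [← hx, ← mul_pow]
    exact pow_le_one₀ (by positivity) e2
  have e4 : (1 - η) ^ 2 ≤ x2 * g ^ 2 := by
    rw [← hx, ← mul_pow]
    exact pow_le_pow_left₀ (by linarith) e1 2
  have hq2 : 0 < q ^ 2 := by positivity
  have hgq : g ^ 2 * q ^ 2 ≤ 1 := by nlinarith [sq_nonneg g]
  refine ⟨?_, hgq⟩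
  have hq1 : q ^ 2 ≤ 1 := b1.trans b3
  have e5 : 2 * η ≤ 2 * η / q ^ 2 := by
    rw [le_div_iff₀ hq2]
    nlinarith
  have e6 : 2 * η * g ^ 2 ≤ 2 * η / q ^ 2 := by
    rw [le_div_iff₀ hq2]
    nlinarith
  have e7 : 4 * η / q ^ 2 = 2 * η / q ^ 2 + 2 * η / q ^ 2 := by ring
  nlinarith [sq_nonneg g, sq_nonneg η]

/-- Distribution of the outputs of the search: the total probability of the solutions, and the
probability of each solution. -/
lemma outputProb_out_bounds (hp : 0 < K.p) {φ : ℕ → Phases} {r₁ r₂ r₃ : ℕ} {η : ℝ} (hη0 : 0 ≤ η)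
    (hη : η ≤ 1 / 8) (h1 : FixedPoint (φ r₁) r₁ K.p η)
    (h2 : FixedPoint (φ r₂) r₂ (1 / √(max 1 (I.maxBucket : ℝ))) η) (hp' : 0 < K.p' φ r₁ r₂)
    (h3 : FixedPoint (φ r₃) r₃ (K.p' φ r₁ r₂) η) :
    1 - 4 * η / K.p' φ r₁ r₂ ^ 2 ≤ outputProb e (I.T K.θ K.θ') (K.out φ r₁ r₂ r₃) ∧
    ∀ x y z, (x, y, z) ∈ I.T K.θ K.θ' → I.Small (dir x y) →
      |outputProb e {(x, y, z)} (K.out φ r₁ r₂ r₃) -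
        ∑ c ∈ I.common x y, ∑ c' ∈ I.common' (dir x y) z,
          1 / (K.p ^ 2 * K.p' φ r₁ r₂ ^ 2 * I.weight K.θ' x c y c')| ≤
        16 * η / K.p' φ r₁ r₂ ^ 2 := by
  classical
  obtain ⟨g1, g2⟩ := normSq_goodAmp_bounds hp hη0 (by linarith) h1 hp' h3
  refine ⟨?_, fun x y z hT hu => ?_⟩
  · rw [outputProb_out φ r₁ r₂ r₃ subset_rfl]
    exact g1
  rw [outputProb_out φ r₁ r₂ r₃ (Set.singleton_subset_iff.2 hT)]
  have hle : outputProb e {(x, y, z)} (K.psi' φ r₁ r₂) ≤ K.p' φ r₁ r₂ ^ 2 := by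
    rw [outputProb, p', norm_projTriples_sq, norm_projTriples_sq]
    refine Finset.sum_le_sum fun s _ => ?_
    by_cases hm : ∃ t ∈ ({(x, y, z)} : Set (E d × E d × E d)),
        s .X = e.code t.1 ∧ s .Y = e.code t.2.1 ∧ s .Z = e.code t.2.2
    · rw [if_pos hm, if_pos]
      obtain ⟨t, ht, h⟩ := hm
      exact ⟨t, Set.mem_singleton_iff.1 ht ▸ hT, h⟩
    · rw [if_neg hm]
      split_ifs <;> positivity
  obtain ⟨f, hf, hprob⟩ := outputProb_psi' (φ := φ) (r₁ := r₁) (r₂ := r₂) hp hT hu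
  set q := K.p' φ r₁ r₂ with hq
  set P := outputProb e {(x, y, z)} (K.psi' φ r₁ r₂) with hP
  set G := ‖goodAmp (φ r₃) r₃ (acceptProb (fun s => s .F) (K.psi' φ r₁ r₂))‖ ^ 2 with hG
  have hG0 : 0 ≤ G := by positivity
  have hq2 : 0 < q ^ 2 := by positivity
  set Q := ∑ c ∈ I.common x y, ∑ c' ∈ I.common' (dir x y) z,
    1 / (K.p ^ 2 * I.weight K.θ' x c y c') with hQ
  have hsum : ∑ c ∈ I.common x y, ∑ c' ∈ I.common' (dir x y) z,
      1 / (K.p ^ 2 * q ^ 2 * I.weight K.θ' x c y c') = Q / q ^ 2 := by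
    rw [hQ, Finset.sum_div]
    refine Finset.sum_congr rfl fun c _ => ?_
    rw [Finset.sum_div]
    refine Finset.sum_congr rfl fun c' _ => ?_
    rw [div_div, mul_right_comm]
  have hterm : ∀ c ∈ I.common x y, ∀ c' ∈ I.common' (dir x y) z,
      (1 - 4 * η) * (1 / (K.p ^ 2 * I.weight K.θ' x c y c')) ≤ ‖K.psi' φ r₁ r₂ (f c c')‖ ^ 2 ∧
      ‖K.psi' φ r₁ r₂ (f c c')‖ ^ 2 ≤ 1 / (K.p ^ 2 * I.weight K.θ' x c y c') := by
    intro c hc c' hc'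
    have hs := hf c hc c' hc'
    have hfull := full_of_represents hs hT hc hc' (mem_S_of_small hu (mem_common'.1 hc').1)
    obtain ⟨a, ha, ha1, hpsi⟩ := hfull.exists_apply_eq hT.2.2.2.1 hT.2.2.2.2.1
      hs.2.2.2.2.2.2.1 hs.2.2.2.2.2.1 hp h1 h2
    have hw := hfull.weightS_pos hT.2.2.2.2.1
    rw [weightS_eq hu] at hpsi hw
    have hV : 0 ≤ 1 / (K.p ^ 2 * I.weight K.θ' x c y c') := by positivity
    rw [hpsi, norm_mul, mul_pow, Complex.norm_real, Real.norm_eq_abs, sq_abs, div_pow, one_pow,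
      Real.sq_sqrt (by positivity)]
    have ha' := one_sub_le_norm ha
    constructor
    · refine mul_le_mul_of_nonneg_right ?_ hV
      nlinarith [norm_nonneg a]
    · exact mul_le_of_le_one_left hV (pow_le_one₀ (norm_nonneg _) ha1)
  have hPQ : P ≤ Q := by
    rw [hprob]
    exact Finset.sum_le_sum fun c hc => Finset.sum_le_sum fun c' hc' => (hterm c hc c' hc').2
  have hQP : (1 - 4 * η) * Q ≤ P := by
    rw [hprob, hQ, Finset.mul_sum]
    refine Finset.sum_le_sum fun c hc => ?_
    rw [Finset.mul_sum]
    exact Finset.sum_le_sum fun c' hc' => (hterm c hc c' hc').1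
  have hP0 : 0 ≤ P := sq_nonneg _
  have hQ0 : 0 ≤ Q := hP0.trans hPQ
  have hQq : Q ≤ 2 * q ^ 2 := by nlinarith
  rw [hsum]
  have hq1 : q ^ 2 ≤ 1 := by
    obtain ⟨b1, -⟩ := acceptProb_psi'_bounds hp r₂ (by linarith) h1
    exact b1.trans (acceptProb_le_one (fun s => s .F) (sum_norm_sq_psi' (K := K) φ r₁ r₂))
  set u := η / q ^ 2 with hu'
  have huq : u * q ^ 2 = η := by rw [hu']; field_simp
  have hu0 : 0 ≤ u := by positivity
  have hηu : η ≤ u := by nlinarith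
  have e1 : 4 * η / q ^ 2 = 4 * u := by rw [hu']; ring
  have e2 : 16 * η / q ^ 2 = 16 * u := by rw [hu']; ring
  rw [e1] at g1
  rw [e2]
  have up : G * P ≤ Q / q ^ 2 := by
    rw [le_div_iff₀ hq2]
    calc G * P * q ^ 2 = G * q ^ 2 * P := by ring
      _ ≤ 1 * P := by gcongr
      _ ≤ Q := by linarith
  have low : Q / q ^ 2 - 16 * u ≤ G * P := by
    rw [sub_le_iff_le_add, div_le_iff₀ hq2]
    have m1 : (1 - 4 * u) * P ≤ G * q ^ 2 * P := mul_le_mul_of_nonneg_right g1 hP0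
    have m2 : u * P ≤ u * Q := mul_le_mul_of_nonneg_left hPQ hu0
    have m3 : u * Q ≤ u * (2 * q ^ 2) := mul_le_mul_of_nonneg_left hQq hu0
    have m4 : η * Q ≤ u * Q := mul_le_mul_of_nonneg_right hηu hQ0
    nlinarith
  rw [abs_le]
  constructor <;> linarith

lemma p'_le_one (hp : 0 < K.p) {φ : ℕ → Phases} {r₁ : ℕ} (r₂ : ℕ) {η : ℝ} (hη : η ≤ 1)
    (h1 : FixedPoint (φ r₁) r₁ K.p η) : K.p' φ r₁ r₂ ≤ 1 := by
  obtain ⟨b1, -⟩ := acceptProb_psi'_bounds hp r₂ hη h1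
  have h := b1.trans (acceptProb_le_one (fun s => s .F) (sum_norm_sq_psi' (K := K) φ r₁ r₂))
  exact (sq_le_one_iff₀ (norm_nonneg _)).1 h

end Setting

lemma length_tupleSamp (φ : ℕ → Phases) (r₁ r₂ : ℕ) :
    List.length (tupleSamp φ r₁ r₂) = 28 * r₁ + 12 * r₂ + 23 := by
  rw [tupleSamp, List.length_append, List.length_append, length_amplify, length_amplify]
  simp only [rCollisionSamp, lookup, List.length_append, List.length_cons, List.length_nil]
  ring

lemma length_solutionSearch (φ : ℕ → Phases) (r₁ r₂ r₃ : ℕ) :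
    List.length (solutionSearch φ r₁ r₂ r₃) = List.length (tupleSamp φ r₁ r₂) +
      r₃ * (2 * List.length (tupleSamp φ r₁ r₂) + 4) + 3 := by
  rw [solutionSearch, length_amplify]
  simp only [List.length_cons, List.length_nil]
  ring

/-- Lengths of the circuits, when the numbers of rounds are of the order of the reciprocal success
amplitudes. -/
lemma length_bounds (φ : ℕ → Phases) {r₁ r₂ r₃ k m : ℕ} {p p' : ℝ} (hk : 1 ≤ k) (hp : 0 < p)
    (hp1 : p ≤ 1) (hr₁ : (r₁ : ℝ) ≤ 6 * k / p)
    (hr₂ : (r₂ : ℝ) ≤ 6 * k / (1 / √(max 1 (m : ℝ)))) :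
    (List.length (tupleSamp φ r₁ r₂) : ℝ) ≤ 4000 * k ^ 2 * (p⁻¹ + √m) ∧
    (0 < p' → p' ≤ 1 → (r₃ : ℝ) ≤ 6 * k / p' →
      (List.length (solutionSearch φ r₁ r₂ r₃) : ℝ) ≤ 4000 * k ^ 2 * (p'⁻¹ * (p⁻¹ + √m))) := by
  have hk' : (1 : ℝ) ≤ k := by exact_mod_cast hk
  have hpi : 1 ≤ p⁻¹ := (one_le_inv₀ hp).2 hp1
  set B := p⁻¹ + √(m : ℝ) with hB
  have hB1 : 1 ≤ B := by linarith [Real.sqrt_nonneg (m : ℝ)]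
  have hm : √(max 1 (m : ℝ)) ≤ B := by
    rcases le_total 1 (m : ℝ) with h | h
    · rw [max_eq_right h]
      linarith
    · rw [max_eq_left h, Real.sqrt_one]
      exact hB1
  have h1 : (r₁ : ℝ) ≤ 6 * (k * B) := by
    rw [div_eq_mul_inv] at hr₁
    have : (k : ℝ) * p⁻¹ ≤ k * B := by gcongr; linarith [Real.sqrt_nonneg (m : ℝ)]
    linarith
  have h2 : (r₂ : ℝ) ≤ 6 * (k * B) := by
    rw [div_div_eq_mul_div, div_one] at hr₂
    have : (k : ℝ) * √(max 1 (m : ℝ)) ≤ k * B := by gcongr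
    linarith
  have hkB : 1 ≤ k * B := one_le_mul_of_one_le_of_one_le hk' hB1
  have hkk : k * B ≤ k ^ 2 * B := by
    rw [sq, mul_assoc]
    exact le_mul_of_one_le_left (by linarith) hk'
  have hl : (List.length (tupleSamp φ r₁ r₂) : ℝ) ≤ 263 * (k * B) := by
    rw [length_tupleSamp]
    push_cast
    linarith
  refine ⟨by linarith, fun hp' hp'1 hr₃ => ?_⟩
  have hpi' : 1 ≤ p'⁻¹ := (one_le_inv₀ hp').2 hp'1
  rw [div_eq_mul_inv] at hr₃
  set V := k * (k * B) * p'⁻¹ with hV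
  have e1 : k * B ≤ V := by
    have h := le_mul_of_one_le_right (zero_le_one.trans hkB)
      (one_le_mul_of_one_le_of_one_le hk' hpi')
    rw [hV]
    linarith
  have e2 : (r₃ : ℝ) * (2 * List.length (tupleSamp φ r₁ r₂) + 4) ≤ 3180 * V := by
    calc _ ≤ (6 * k * p'⁻¹) * (530 * (k * B)) := by
          gcongr
          linarith
      _ = 3180 * V := by rw [hV]; ring
  rw [length_solutionSearch]
  push_cast
  calc _ ≤ 4000 * V := by linarith
    _ = _ := by rw [hV]; ring

/-! ### Number of rounds -/

/-- One family of angles, indexed by the number of rounds, amplifies every success amplitude: for a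
lower bound `x` on it, a number of rounds of order `log (1 / η) / x` suffices. -/
lemma exists_fixedPoint_family {η : ℝ} (hη0 : 0 < η) (hη1 : η ≤ 1) :
    ∃ (k : ℕ) (φ : ℕ → Phases), 1 ≤ k ∧ (k : ℝ) ≤ 2 * Real.log (1 / η) + 5 ∧
      ∀ x : ℝ, 0 < x → x ≤ 1 → ∃ r : ℕ, (r : ℝ) ≤ 6 * k / x ∧ FixedPoint (φ r) r x η := by
  have hε0 : 0 < η ^ 2 / 4 := by positivity
  have hε1 : η ^ 2 / 4 ≤ 1 := by nlinarith
  set l := Real.log (1 / (η ^ 2 / 4)) with hl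
  have hl0 : 0 ≤ l := Real.log_nonneg (by rw [le_div_iff₀ hε0]; linarith)
  set n := ⌈l⌉₊ with hn
  have hnl : l ≤ n := Nat.le_ceil _
  have hpow : (1 / 4 : ℝ) ^ n ≤ η ^ 2 / 4 := by
    have h1 : (1 / 4 : ℝ) ≤ Real.exp (-1) := by
      rw [Real.exp_neg, one_div]
      exact inv_anti₀ (Real.exp_pos _) (by linarith [Real.exp_one_lt_d9])
    calc (1 / 4 : ℝ) ^ n ≤ Real.exp (-1) ^ n := pow_le_pow_left₀ (by norm_num) h1 n
      _ = Real.exp (-n) := by rw [← Real.exp_nat_mul]; ring_nf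
      _ ≤ Real.exp (-l) := Real.exp_le_exp.2 (by linarith)
      _ = η ^ 2 / 4 := by rw [hl, one_div, Real.log_inv, neg_neg, Real.exp_log hε0]
  choose φ hφ using fun j => exists_fixedPoint_phases j n hε0 hε1 hpow
  have hll : l = 2 * Real.log (1 / η) + Real.log 4 := by
    have : 1 / (η ^ 2 / 4) = (1 / η) ^ 2 * 4 := by field_simp
    rw [hl, this, Real.log_mul (by positivity) (by norm_num), Real.log_pow]
    norm_num
  have hlog4 : Real.log 4 ≤ 3 := by
    have := Real.log_le_sub_one_of_pos (show (0 : ℝ) < 4 by norm_num)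
    linarith
  refine ⟨n + 1, fun r => φ (r / (2 * (n + 1))), by omega, ?_, fun x hx0 hx1 => ?_⟩
  · have := Nat.ceil_lt_add_one hl0
    push_cast
    linarith
  set j := ⌈2 / x⌉₊ with hj
  have hj1 : 2 / x ≤ j := Nat.le_ceil _
  have hj2 : (j : ℝ) ≤ 3 / x := by
    have h1 := Nat.ceil_lt_add_one (show 0 ≤ 2 / x by positivity)
    have h2 : 1 ≤ 1 / x := (one_le_div hx0).2 hx1
    have h3 : 3 / x = 2 / x + 1 / x := by ring
    linarith
  refine ⟨2 * (n + 1) * j, ?_, fun y hy hy1 => ?_⟩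
  · push_cast
    calc 2 * ((n : ℝ) + 1) * j ≤ 2 * ((n : ℝ) + 1) * (3 / x) := by gcongr
      _ = _ := by ring
  · have hdiv : 2 * (n + 1) * j / (2 * (n + 1)) = j := Nat.mul_div_cancel_left _ (by omega)
    have hlo : 4 / (2 * j + 1 : ℝ) ≤ x := by
      rw [div_le_iff₀ (by positivity)]
      rw [div_le_iff₀ hx0] at hj1
      nlinarith
    have h := hφ j y ⟨hlo.trans hy, hy1⟩
    beta_reduce
    rw [hdiv]
    have h' : 4 * (η ^ 2 / 4) = η ^ 2 := by ring
    rw [h'] at h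
    exact (pow_le_pow_iff_left₀ (norm_nonneg _) hη0.le two_ne_zero).1 h

/-! ### Subexponential bounds -/

lemma isLittleO_const_natCast (c : ℝ) : (fun _ : ℕ => c) =o[atTop] fun d : ℕ => (d : ℝ) :=
  (isLittleO_const_id_atTop c).comp_tendsto tendsto_natCast_atTop_atTop

namespace Subexp

variable {g h : ℕ → ℝ}

lemma mono (hg : Subexp g) (hle : ∀ d, h d ≤ g d) : Subexp h := by
  obtain ⟨f, hf, hgf⟩ := hg
  exact ⟨f, hf, fun d => (hle d).trans (hgf d)⟩

lemma max_zero (hg : Subexp g) : Subexp fun d => max (g d) 0 := by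
  obtain ⟨f, hf, hgf⟩ := hg
  exact ⟨f, hf, fun d => max_le (hgf d) (by positivity)⟩

lemma const (c : ℝ) : Subexp fun _ => c := by
  refine ⟨fun _ => Real.logb 2 (max c 1), isLittleO_const_natCast _, fun _ => ?_⟩
  rw [Real.rpow_logb (by norm_num) (by norm_num) (by positivity)]
  exact le_max_left _ _

lemma natCast : Subexp fun d => (d : ℝ) := by
  refine ⟨fun d => Real.logb 2 (d + 1), ?_, fun d => ?_⟩
  · have h1 : (fun d : ℕ => Real.log ((d : ℝ) + 1)) =o[atTop] fun d : ℕ => (d : ℝ) + 1 :=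
      Real.isLittleO_log_id_atTop.comp_tendsto
        (tendsto_atTop_add_const_right _ _ tendsto_natCast_atTop_atTop)
    have h2 : (fun d : ℕ => (d : ℝ) + 1) =O[atTop] fun d : ℕ => (d : ℝ) :=
      (isBigO_refl _ _).add (isLittleO_const_natCast 1).isBigO
    have h3 := (h1.trans_isBigO h2).const_mul_left (Real.log 2)⁻¹
    refine h3.congr_left fun d => ?_
    rw [Real.logb, div_eq_inv_mul]
  · rw [Real.rpow_logb (by norm_num) (by norm_num) (by positivity)]
    linarith

lemma mul (hg : Subexp g) (hh : Subexp h) (hh0 : ∀ d, 0 ≤ h d) :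
    Subexp fun d => g d * h d := by
  obtain ⟨f, hf, hgf⟩ := hg
  obtain ⟨f', hf', hhf⟩ := hh
  refine ⟨fun d => f d + f' d, hf.add hf', fun d => ?_⟩
  rw [Real.rpow_add (by norm_num)]
  exact mul_le_mul (hgf d) (hhf d) (hh0 d) (by positivity)

lemma add (hg : Subexp g) (hh : Subexp h) : Subexp fun d => g d + h d := by
  obtain ⟨f, hf, hgf⟩ := hg
  obtain ⟨f', hf', hhf⟩ := hh
  refine ⟨fun d => 1 + (|f d| + |f' d|),
    (isLittleO_const_natCast 1).add (hf.abs_left.add hf'.abs_left), fun d => ?_⟩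
  have h1 : (2 : ℝ) ^ f d ≤ 2 ^ (|f d| + |f' d|) :=
    Real.rpow_le_rpow_of_exponent_le (by norm_num)
      (by linarith [le_abs_self (f d), abs_nonneg (f' d)])
  have h2 : (2 : ℝ) ^ f' d ≤ 2 ^ (|f d| + |f' d|) :=
    Real.rpow_le_rpow_of_exponent_le (by norm_num)
      (by linarith [le_abs_self (f' d), abs_nonneg (f d)])
  rw [Real.rpow_add (by norm_num), Real.rpow_one]
  linarith [hgf d, hhf d]

end Subexp

/-- The accuracy required of each amplitude amplification so that the search has accuracy `δ`. -/
def ampError (A : ℕ) (δ : ℕ → ℝ) (d : ℕ) : ℝ := min (δ d) 1 / (64 * ((2 ^ (A * d) : ℕ) : ℝ) ^ 5)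

lemma subexp_log_ampError (A : ℕ) {δ : ℕ → ℝ} (hδ₀ : ∀ d, 0 < δ d)
    (hδ : Subexp fun d => Real.log (1 / δ d)) :
    Subexp fun d => Real.log (1 / ampError A δ d) := by
  have hlin : Subexp fun d : ℕ => 5 * A * Real.log 2 * (d : ℝ) :=
    (Subexp.const (5 * A * Real.log 2)).mul Subexp.natCast fun d => Nat.cast_nonneg d
  refine (((Subexp.const (Real.log 64)).add hlin).add hδ.max_zero).mono fun d => ?_
  have hm : 0 < min (δ d) 1 := lt_min (hδ₀ d) one_pos
  have e1 : 1 / ampError A δ d = 64 * ((2 ^ (A * d) : ℕ) : ℝ) ^ 5 * (1 / min (δ d) 1) := by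
    rw [ampError]
    field_simp
  have e2 : Real.log (1 / min (δ d) 1) ≤ max (Real.log (1 / δ d)) 0 := by
    rcases le_total (δ d) 1 with h | h
    · rw [min_eq_left h]
      exact le_max_left _ _
    · rw [min_eq_right h]
      simp
  rw [e1, Real.log_mul (by positivity) (by positivity), Real.log_mul (by norm_num) (by positivity),
    Real.log_pow]
  push_cast
  rw [Real.log_pow]
  push_cast
  linarith

lemma ampError_pos (A : ℕ) {δ : ℕ → ℝ} (hδ₀ : ∀ d, 0 < δ d) (d : ℕ) : 0 < ampError A δ d :=
  div_pos (lt_min (hδ₀ d) one_pos) (by positivity)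

lemma ampError_mul_le (A : ℕ) (δ : ℕ → ℝ) (d : ℕ) :
    64 * ampError A δ d * ((2 ^ (A * d) : ℕ) : ℝ) ^ 5 ≤ min (δ d) 1 := by
  apply le_of_eq
  rw [ampError]
  field_simp

end TripleSearch

end

theorem mainTheorem9 (A : ℕ) (w κ a : ℕ → ℕ) (δ : ℕ → ℝ)
    (hw : Subexp fun d => (w d : ℝ)) (hκ : Subexp fun d => (κ d : ℝ))
    (ha : Subexp fun d => (a d : ℝ))
    (hδ₀ : ∀ d, 0 < δ d) (hδ : Subexp fun d => Real.log (1 / δ d)) :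
    ∃ (φ : ℕ → ℕ → Phases) (f : ℕ → ℝ), f =o[atTop] (fun d : ℕ => (d : ℝ)) ∧
    ∀ (d : ℕ) (I : SearchInput d) (θ θ' : ℝ),
    I.L.card ≤ 2 ^ (A * d) → I.C.card ≤ 2 ^ (A * d) → I.C'.card ≤ 2 ^ (A * d) →
    ∀ (e : Encoding I (w d)) (D D' : QData (w d)),
    D.StoresRel e I.C I.R → D'.StoresRel e I.C' I.R' →
    ∀ S : Set (E d × E d), I.IsTruncation S →
    ∀ (unif : Word (w d) → Gate (w d)) (dec : Word (w d) → Word (w d) → Gate (w d)),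
    IsUniformGate unif → IsDecoder e S dec →
    let M := machine e θ θ' D D' unif dec
    let ψ : State (w d) := Circuit.run M rCollisionSamp (zeroState (w d))
    let p : ℝ := ‖projPairs e (I.M1 θ) ψ‖
    (qubits (w d) (a d) : ℝ) ≤ (2 : ℝ) ^ f d ∧
    ((I.T θ θ').Nonempty → 0 < p) ∧
    (0 < p → ∃ r₁ r₂ : ℕ,
      let P' := tupleSamp (φ d) r₁ r₂
      let ψ' : State (w d) := Circuit.run M P' (zeroState (w d))
      let p' : ℝ := ‖projTriples e (I.T θ θ') ψ'‖
      (∀ x y z, (x, y, z) ∈ I.T θ θ' → I.Small (dir x y) →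
        ∀ c ∈ I.common x y, ∀ c' ∈ I.common' (dir x y) z,
        ∀ s : Cfg (w d), Represents e D D' s x c y c' z →
          ‖ψ' s - ((1 / Real.sqrt (p ^ 2 * I.weight θ' x c y c') : ℝ) : ℂ)‖ ≤ δ d) ∧
      (Circuit.time (κ d) P' : ℝ) ≤ (p⁻¹ + Real.sqrt I.maxBucket) * (2 : ℝ) ^ f d ∧
      (Circuit.queries (w d) P' : ℝ) ≤ (p⁻¹ + Real.sqrt I.maxBucket) * (2 : ℝ) ^ f d ∧
      ((I.TWitnessed θ θ' S).Nonempty → 0 < p' ∧ ∃ r₃ : ℕ,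
        let Q := solutionSearch (φ d) r₁ r₂ r₃
        let out : State (w d) := Circuit.run M Q (zeroState (w d))
        1 - δ d ≤ outputProb e (I.T θ θ') out ∧
        (∀ x y z, (x, y, z) ∈ I.T θ θ' → I.Small (dir x y) →
          |outputProb e {(x, y, z)} out -
            ∑ c ∈ I.common x y, ∑ c' ∈ I.common' (dir x y) z,
              1 / (p ^ 2 * p' ^ 2 * I.weight θ' x c y c')| ≤ δ d) ∧
        (Circuit.time (κ d) Q : ℝ) ≤
          p'⁻¹ * (p⁻¹ + Real.sqrt I.maxBucket) * (2 : ℝ) ^ f d ∧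
        (Circuit.queries (w d) Q : ℝ) ≤
          p'⁻¹ * (p⁻¹ + Real.sqrt I.maxBucket) * (2 : ℝ) ^ f d)) := by
  -- an error `η` per amplification that is small compared with `δ` and with the smallest possible
  -- `p'²`, since the last amplification divides by `p'²`
  have hη0 := ampError_pos A hδ₀
  have hηN : ∀ d, 64 * ampError A δ d * ((2 ^ (A * d) : ℕ) : ℝ) ^ 5 ≤ min (δ d) 1 :=
    ampError_mul_le A δ
  have hN1 : ∀ d, (1 : ℝ) ≤ ((2 ^ (A * d) : ℕ) : ℝ) ^ 5 := fun d =>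
    one_le_pow₀ (by exact_mod_cast Nat.one_le_two_pow)
  have hη64 : ∀ d, 64 * ampError A δ d ≤ min (δ d) 1 := fun d =>
    le_trans (le_mul_of_one_le_right (by linarith [hη0 d]) (hN1 d)) (hηN d)
  have hη8 : ∀ d, ampError A δ d ≤ 1 / 8 := fun d => by
    linarith [hη64 d, min_le_right (δ d) 1, hη0 d]
  choose k φ hk1 hk hφ using fun d => exists_fixedPoint_family (hη0 d) (by linarith [hη8 d])
  have hlog := subexp_log_ampError A hδ₀ hδ
  have hksub : Subexp fun d => (k d : ℝ) := by
    refine ((hlog.add hlog).add (Subexp.const 5)).mono fun d => ?_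
    linarith [hk d]
  -- `4000 k²` bounds the circuit lengths up to the amplitudes; the second summand counts qubits
  have hcost : Subexp fun d => ((κ d : ℝ) + w d) * (4000 * (k d : ℝ) ^ 2) +
      (13 * (w d : ℝ) + a d) := by
    have hksq := (Subexp.const 4000).mul
      (hksub.mul hksub fun d => Nat.cast_nonneg _) fun d => by positivity
    refine (((hκ.add hw).mul hksq fun d => by positivity).add
      (((Subexp.const 13).mul hw fun d => Nat.cast_nonneg _).add ha)).mono
      fun d => ?_
    rw [sq]
  obtain ⟨f, hf, hle⟩ := hcost
  beta_reduce at hle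
  refine ⟨φ, f, hf, ?_⟩
  intro d I θ θ' hL hC hC' e D D' hD hD' S hS unif dec hunif hdec
  let K : Setting I e := ⟨θ, θ', D, D', S, unif, dec, hD, hD', hS, hunif, hdec⟩
  have hκf : (κ d : ℝ) * (4000 * (k d : ℝ) ^ 2) ≤ (2 : ℝ) ^ f d := by
    refine le_trans ?_ (hle d)
    rw [add_mul, add_assoc]
    exact le_add_of_nonneg_right (by positivity)
  have hwf : (w d : ℝ) * (4000 * (k d : ℝ) ^ 2) ≤ (2 : ℝ) ^ f d := by
    refine le_trans ?_ (hle d)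
    rw [add_mul, add_assoc, add_left_comm]
    exact le_add_of_nonneg_right (by positivity)
  have htime : ∀ (P : Circuit) (b : ℝ), 0 ≤ b → (List.length P : ℝ) ≤ 4000 * (k d : ℝ) ^ 2 * b →
      (Circuit.time (κ d) P : ℝ) ≤ b * (2 : ℝ) ^ f d ∧
        (Circuit.queries (w d) P : ℝ) ≤ b * (2 : ℝ) ^ f d := by
    intro P b hb hP
    have hcount : (List.countP Instr.isRead P : ℝ) ≤ List.length P := by
      exact_mod_cast List.countP_le_length
    rw [Circuit.time, Circuit.queries]
    push_cast
    constructor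
    · calc (κ d : ℝ) * List.length P ≤ κ d * (4000 * (k d : ℝ) ^ 2 * b) := by gcongr
        _ = b * (κ d * (4000 * (k d : ℝ) ^ 2)) := by ring
        _ ≤ _ := by gcongr
    · calc (w d : ℝ) * List.countP Instr.isRead P ≤ w d * (4000 * (k d : ℝ) ^ 2 * b) := by
            gcongr
            exact hcount.trans hP
        _ = b * (w d * (4000 * (k d : ℝ) ^ 2)) := by ring
        _ ≤ _ := by gcongr
  intro M ψ p
  refine ⟨?_, K.p_pos, fun hp => ?_⟩
  · refine le_trans ?_ (hle d)
    have hcard : Fintype.card Reg = 13 := rfl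
    rw [qubits, hcard]
    push_cast
    exact le_add_of_nonneg_left (by positivity)
  change 0 < K.p at hp
  have hm1 : 1 ≤ √(max 1 (I.maxBucket : ℝ)) := Real.one_le_sqrt.2 (le_max_left _ _)
  -- `max 1` because `maxBucket` may be `0`, in which case there is nothing to find
  obtain ⟨r₁, hr₁, h1⟩ := hφ d K.p hp (K.p_le_one hp)
  obtain ⟨r₂, hr₂, h2⟩ := hφ d (1 / √(max 1 (I.maxBucket : ℝ))) (by positivity)
    ((div_le_one (by positivity)).2 hm1)
  refine ⟨r₁, r₂, ?_⟩
  intro P' ψ' p'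
  have hlen := fun (r₃ : ℕ) (q : ℝ) => length_bounds (φ d) (r₁ := r₁) (r₂ := r₂) (r₃ := r₃)
    (p' := q) (hk1 d) hp (K.p_le_one hp) hr₁ hr₂
  have hB : 0 ≤ K.p⁻¹ + √(I.maxBucket : ℝ) := by positivity
  have hT1 := htime P' _ hB (hlen 0 0).1
  refine ⟨fun x y z hT hu c hc c' hc' s hs => ?_, hT1.1, hT1.2, fun hTW => ?_⟩
  · have h := K.norm_psi'_sub_le hp (by linarith [hη8 d]) h1 h2 hT hu hc hc' hs
    refine h.trans ?_
    linarith [hη64 d, min_le_left (δ d) 1, hη0 d]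
  have hlow := K.p'_lower (φ := φ d) hp (by linarith [hη8 d]) h1 h2 hL hC hC' hTW
  have hp'0 : 0 < K.p' (φ d) r₁ r₂ := by
    have h4 : 0 < 1 / (4 * ((2 ^ (A * d) : ℕ) : ℝ) ^ 5) := by positivity
    refine lt_of_le_of_ne (norm_nonneg _) fun h => ?_
    rw [← h, zero_pow two_ne_zero] at hlow
    exact absurd hlow (not_le.2 h4)
  have hη16 : 16 * ampError A δ d / K.p' (φ d) r₁ r₂ ^ 2 ≤ δ d := by
    rw [div_le_iff₀ (by positivity)]
    have hδη : 64 * ampError A δ d * ((2 ^ (A * d) : ℕ) : ℝ) ^ 5 ≤ δ d :=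
      (hηN d).trans (min_le_left _ _)
    rw [div_le_iff₀ (by positivity)] at hlow
    have := mul_le_mul_of_nonneg_left hlow (hη0 d).le
    have := mul_le_mul_of_nonneg_right hδη (sq_nonneg (K.p' (φ d) r₁ r₂))
    linarith
  have hp'1 := K.p'_le_one hp r₂ (by linarith [hη8 d]) h1
  obtain ⟨r₃, hr₃, h3⟩ := hφ d (K.p' (φ d) r₁ r₂) hp'0 hp'1
  refine ⟨hp'0, r₃, ?_⟩
  intro Q out
  obtain ⟨ho1, ho2⟩ := K.outputProb_out_bounds hp (hη0 d).le (hη8 d) h1 h2 hp'0 h3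
  have hT2 := htime Q _ (mul_nonneg (inv_nonneg.2 hp'0.le) hB) ((hlen r₃ _).2 hp'0 hp'1 hr₃)
  refine ⟨le_trans ?_ ho1, fun x y z hT hu => (ho2 x y z hT hu).trans hη16, hT2.1, hT2.2⟩
  have h4 : 4 * ampError A δ d / K.p' (φ d) r₁ r₂ ^ 2 ≤
      16 * ampError A δ d / K.p' (φ d) r₁ r₂ ^ 2 := by
    gcongr
    · exact (hη0 d).le
    · norm_num
  linarith
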